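/- Let $U\subseteq\mathbb C$ be a domain (a non-empty connected open set), let $\Delta=\{x+iy: \alpha x+\beta y+\gamma=0\}$, $(\alpha,\beta)\ne(0,0)$, be a line, and let $\sigma_\Delta$ be the orthogonal reflection over $\Delta$. Put $U^+=U\cap\{\alpha x+\beta y+\gamma>0\}$ and $U^-=U\cap\{\alpha x+\beta y+\gamma<0\}$. Suppose that $\Delta$ is a partial symmetry axis for $U$, that is, $\sigma_\Delta(U^+)\subseteq U$ or $\sigma_\Delta(U^-)\subseteq U$, and let $S$ be a symmetric side of $U$ over $\Delta$, that is, $S\in\{U^+,U^-\}$ and $\sigma_\Delta(S)\subseteq U$. For a planar Brownian motion $Z$ (independent standard real Brownian coordinates with a.s. continuous paths) let $\tau_U(Z)=\inf\{t\ge 0: Z_t\notin U\}\in[0,\infty]$ be its exit time from $U$, and write $E_z[\tau_U^p]\in[0,\infty]$ for the $p$-th moment of $\tau_U$ for a planar Brownian motion started at $z$. Let $a\in S$. Then the following hold. 1. There are planar Brownian motions $Z$ started at $a$ and $\tilde Z$ started at $\sigma_\Delta(a)$, defined on the same probability space, such that $\tau_U(Z)\le\tau_U(\tilde Z)$ almost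 surely and such that, moreover, if $\sigma_\Delta(S)$ is strictly contained in $U\setminus(S\cup\Delta)$ with non-polar difference $\big(U\setminus(S\cup\Delta)\big)\setminus\sigma_\Delta(S)$, then $P\big(\tau_U(Z)<\tau_U(\tilde Z)\big)>0$. 2. For every real $p>0$, $E_a[\tau_U^p]\le E_{\sigma_\Delta(a)}[\tau_U^p]$. If $\big(U\setminus(S\cup\Delta)\big)\setminus\sigma_\Delta(S)$ is non-polar and $E_a[\tau_U^p]<\infty$, then the inequality is strict. Here a set $K\subseteq\mathbb C$ is called non-polar (of positive logarithmic capacity) if some compact subset of $K$ carries a Borel probability measure $\mu$ of finite logarithmic energy, $\iint\log\frac1{|z-w|}\,d\mu(z)\,d\mu(w)<\infty$. -/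

import Mathlib

open MeasureTheory ProbabilityTheory
open scoped NNReal ENNReal

noncomputable section

/-- A straight line in the plane, given by an equation `a x + b y + c = 0` with `(a, b) ≠ (0, 0)`. -/
structure PlaneLine where
  a : ℝ
  b : ℝ
  c : ℝ
  ne_zero : a ≠ 0 ∨ b ≠ 0

namespace PlaneLine

/-- The affine function `z = x + i y ↦ a x + b y + c`. -/
def form (Δ : PlaneLine) (z : ℂ) : ℝ := Δ.a * z.re + Δ.b * z.im + Δ.c

/-- The line itself, as an affine subspace of the plane. -/
def toAffineSubspace (Δ : PlaneLine) : AffineSubspace ℝ ℂ where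
  carrier := {z | Δ.form z = 0}
  smul_vsub_vadd_mem' := by
    intro r p q s hp hq hs
    simp only [form, Set.mem_ofPred_eq] at hp hq hs ⊢
    simp only [vsub_eq_sub, vadd_eq_add, Complex.add_re, Complex.add_im, Complex.real_smul,
      Complex.mul_re, Complex.mul_im, Complex.sub_re, Complex.sub_im, Complex.ofReal_re,
      Complex.ofReal_im]
    linear_combination r * hp - r * hq + hs

theorem mem_toAffineSubspace (Δ : PlaneLine) (z : ℂ) :
    z ∈ Δ.toAffineSubspace ↔ Δ.form z = 0 := Iff.rfl

theorem normSq_pos (Δ : PlaneLine) : 0 < Δ.a ^ 2 + Δ.b ^ 2 := by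
  rcases Δ.ne_zero with h | h <;> positivity

instance (Δ : PlaneLine) : Nonempty Δ.toAffineSubspace := by
  refine ⟨⟨⟨-Δ.c * Δ.a / (Δ.a ^ 2 + Δ.b ^ 2), -Δ.c * Δ.b / (Δ.a ^ 2 + Δ.b ^ 2)⟩, ?_⟩⟩
  have := Δ.normSq_pos
  rw [mem_toAffineSubspace, form]
  field_simp
  ring

/-- The orthogonal symmetry `σ_Δ` over the line `Δ`. -/
def refl (Δ : PlaneLine) (z : ℂ) : ℂ := EuclideanGeometry.reflection Δ.toAffineSubspace z

/-- The explicit formula for the symmetry over a line. -/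
theorem refl_eq (Δ : PlaneLine) (z : ℂ) :
    Δ.refl z = z - ((2 * Δ.form z / (Δ.a ^ 2 + Δ.b ^ 2) : ℝ) : ℂ) * (⟨Δ.a, Δ.b⟩ : ℂ) := by
  have hpos := Δ.normSq_pos
  set k : ℝ := Δ.form z / (Δ.a ^ 2 + Δ.b ^ 2) with hk
  have hkm : k * (Δ.a ^ 2 + Δ.b ^ 2) = Δ.form z := by rw [hk]; field_simp
  set n : ℂ := ⟨Δ.a, Δ.b⟩ with hn
  have hfoot : z - (k : ℂ) * n ∈ Δ.toAffineSubspace := by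
    rw [mem_toAffineSubspace]
    simp only [form, hn, Complex.sub_re, Complex.sub_im, Complex.mul_re, Complex.mul_im,
      Complex.ofReal_re, Complex.ofReal_im] at hkm ⊢
    linear_combination -hkm
  have horth : (k : ℂ) * n ∈ Δ.toAffineSubspace.directionᗮ := by
    rw [Submodule.mem_orthogonal]
    intro u hu
    rw [AffineSubspace.mem_direction_iff_eq_vsub_right hfoot] at hu
    obtain ⟨q, hq, rfl⟩ := hu
    have hq' := (Δ.mem_toAffineSubspace q).1 hq
    have hf' := (Δ.mem_toAffineSubspace _).1 hfoot
    simp only [form, hn, Complex.sub_re, Complex.sub_im, Complex.mul_re, Complex.mul_im,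
      Complex.ofReal_re, Complex.ofReal_im] at hq' hf'
    simp only [vsub_eq_sub, Complex.inner, hn, Complex.sub_re, Complex.sub_im, Complex.mul_re,
      Complex.mul_im, Complex.ofReal_re, Complex.ofReal_im, map_sub, map_mul, Complex.conj_re,
      Complex.conj_im, Complex.conj_ofReal]
    linear_combination k * hq' - k * hf'
  have h := EuclideanGeometry.reflection_orthogonal_vadd (s := Δ.toAffineSubspace) hfoot horth
  have hz : (k : ℂ) * n +ᵥ (z - (k : ℂ) * n) = z := by simp
  rw [hz] at h
  rw [refl, h]
  simp only [vadd_eq_add, hk]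
  push_cast
  ring

/-- The set `U⁺ = U ∩ {a x + b y + c > 0}`. -/
def posSide (Δ : PlaneLine) (U : Set ℂ) : Set ℂ := U ∩ {z | 0 < Δ.form z}

/-- The set `U⁻ = U ∩ {a x + b y + c < 0}`. -/
def negSide (Δ : PlaneLine) (U : Set ℂ) : Set ℂ := U ∩ {z | Δ.form z < 0}

/-- `Δ` is a partial symmetry axis for `U`: one of `U⁺`, `U⁻` is mapped into `U` by `σ_Δ`. -/
def IsPartialSymmetryAxis (Δ : PlaneLine) (U : Set ℂ) : Prop :=
  Δ.refl '' Δ.posSide U ⊆ U ∨ Δ.refl '' Δ.negSide U ⊆ U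

/-- `S` is a symmetric side of `U` over `Δ`: it is one of the two sets `U⁺`, `U⁻`, and `σ_Δ`
maps it into `U`. -/
def IsSymmetricSide (Δ : PlaneLine) (U S : Set ℂ) : Prop :=
  (S = Δ.posSide U ∨ S = Δ.negSide U) ∧ Δ.refl '' S ⊆ U

end PlaneLine

/-- A planar Brownian motion `Z = X + i Y` started at `z`: the processes `X - Re z` and `Y - Im z`
are independent standard real Brownian motions (started at `0`, with a.s. continuous paths). -/
structure IsPlanarBrownian {Ω : Type*} [MeasurableSpace Ω] (Z : ℝ≥0 → Ω → ℂ) (z : ℂ)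
    (P : Measure Ω) : Prop where
  measurable : ∀ t, Measurable (Z t)
  re : IsBrownianReal (fun t ω ↦ (Z t ω).re - z.re) P
  im : IsBrownianReal (fun t ω ↦ (Z t ω).im - z.im) P
  indep : IndepFun (fun ω (t : ℝ≥0) ↦ (Z t ω).re) (fun ω (t : ℝ≥0) ↦ (Z t ω).im) P

/-- The exit time `inf {t ≥ 0 : Z_t ∉ U}`, with value `∞` if `Z` never leaves `U`. -/
def exitTime {Ω : Type*} (U : Set ℂ) (Z : ℝ≥0 → Ω → ℂ) (ω : Ω) : ℝ≥0∞ :=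
  hittingAfter Z Uᶜ 0 ω

theorem exitTime_eq_iInf {Ω : Type*} (U : Set ℂ) (Z : ℝ≥0 → Ω → ℂ) (ω : Ω) :
    exitTime U Z ω = ⨅ (t : ℝ≥0) (_ : Z t ω ∉ U), (t : ℝ≥0∞) := by
  unfold exitTime
  rw [hittingAfter]
  split_ifs with h
  · simp only [zero_le, true_and, Set.mem_compl_iff] at h ⊢
    exact (ENNReal.coe_sInf h).trans (by rfl)
  · push Not at h
    simp only [Set.mem_compl_iff, not_not] at h
    change (∞ : ℝ≥0∞) = _
    simp [fun t ↦ h t zero_le]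

/-- The positive part of the logarithmic kernel `log (1 / |z - w|)`, with value `∞` on the
diagonal. -/
def logKernel (z w : ℂ) : ℝ≥0∞ :=
  if z = w then ∞ else ENNReal.ofReal (-Real.log (dist z w))

/-- A set in the plane is non-polar (of positive logarithmic capacity) if some compact subset of it
carries a Borel probability measure of finite logarithmic energy. Since `log (1 / |z - w|)` is
bounded below on compact sets, the energy is finite if and only if its positive part is. -/
def IsNonpolar (K : Set ℂ) : Prop :=
  ∃ (C : Set ℂ) (μ : Measure ℂ), IsCompact C ∧ C ⊆ K ∧ IsProbabilityMeasure μ ∧ μ Cᶜ = 0 ∧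
    ∫⁻ z, ∫⁻ w, logKernel z w ∂μ ∂μ < ∞

end

open Filter Topology Set
open scoped RealInnerProductSpace

/-! The proof is a reflection coupling. Let `Z` start at `a`, and let `Z'` be its mirror image until
the time `T` at which `Z` reaches the line, and equal to `Z` from then on. Applying a linear
isometry to the increments after a stopping time does not change the law of Brownian motion
(`IsPlanarPreBrownian.map_reflectAt`), so `Z'` is a Brownian motion started at the reflected point
(`PlaneLine.exists_coupling`). Whenever `Z'` is outside `U`, so is `Z`: before `T` because the
reflection maps `S` into `U`, after `T` because the two paths agree. Hence the exit times are
ordered on every path.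

For strictness, let `N` be the side of `U` opposite to `S` and let `C` be a compact subset of `N`,
disjoint from the reflection of `S`, carrying a probability measure of finite logarithmic energy. If
`Z'` hits `C` before leaving `N`, this happens before `T`. At that moment `Z` is at the mirror image
of a point of `C`, which is not in `U`, while `Z'` has not yet left `U`. So it suffices that `Z'`
hits `C` inside `N` with positive probability (`IsPlanarPreBrownian.hitProb_ne_zero`). This has
three ingredients. The set `N` is connected, because folding `U` along the line maps it onto the
closed half (`PlaneLine.isPreconnected_negSide`). Finite energy gives hitting from a set of starting
points of positive area, by comparing first and second moments of the time spent near `C`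
(`IsPlanarPreBrownian.not_ae_avoid`). Positivity then spreads from such points over all of `N` by
the Markov property and connectedness.

The moments of the exit time depend only on the law of the motion (`lintegral_exitTime_eq`,
`IsPlanarBrownian.map_eq`), so the coupling yields the statement for arbitrary Brownian motions.
Existence of Brownian motion is proved by Lévy's series (`exists_isPlanarPreBrownian`). -/

/-- A centred Gaussian process in the plane with the covariance of planar Brownian motion. -/
structure IsPlanarPreBrownian {Ω : Type*} [MeasurableSpace Ω] (W : ℝ≥0 → Ω → ℂ)
    (P : Measure Ω) : Prop where
  measurable : ∀ t, Measurable (W t)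
  gaussian : IsGaussianProcess W P
  mean : ∀ t (x : ℂ), ∫ ω, ⟪x, W t ω⟫ ∂P = 0
  cov : ∀ s t (x y : ℂ),
    cov[fun ω ↦ ⟪x, W s ω⟫, fun ω ↦ ⟪y, W t ω⟫; P] = ⟪x, y⟫ * ((min s t : ℝ≥0) : ℝ)

/-! ### Planar Brownian motion as a Gaussian process: invariances, independence, uniqueness in law.
-/

section Gaussian

variable {Ω : Type*} [MeasurableSpace Ω] {P : Measure Ω} {W : ℝ≥0 → Ω → ℂ}

theorem ProbabilityTheory.IsGaussianProcess.memLp_inner {T : Type*} {X : T → Ω → ℂ}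
    (h : IsGaussianProcess X P) (t : T) (x : ℂ) : MemLp (fun ω ↦ ⟪x, X t ω⟫) 2 P :=
  ((h.hasGaussianLaw_eval t).map_fun (innerSL ℝ x)).memLp_two

theorem complex_inner_eq (x w : ℂ) : ⟪x, w⟫ = x.re * w.re + x.im * w.im := by
  rw [Complex.inner]; simp; ring

namespace IsPlanarPreBrownian

theorem isProbabilityMeasure (h : IsPlanarPreBrownian W P) : IsProbabilityMeasure P :=
  h.gaussian.isProbabilityMeasure

theorem of_indep (hm : ∀ t, Measurable (W t))
    (hre : IsPreBrownianReal (fun t ω ↦ (W t ω).re) P)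
    (him : IsPreBrownianReal (fun t ω ↦ (W t ω).im) P)
    (hi : IndepFun (fun ω (t : ℝ≥0) ↦ (W t ω).re) (fun ω (t : ℝ≥0) ↦ (W t ω).im) P) :
    IsPlanarPreBrownian W P where
  measurable := hm
  gaussian := ⟨fun I ↦ by
    have h1 := hre.isGaussianProcess.hasGaussianLaw I
    have h2 := him.isGaussianProcess.hasGaussianLaw I
    have h3 : IndepFun (fun ω ↦ I.restrict (fun t ↦ (W t ω).re))
        (fun ω ↦ I.restrict (fun t ↦ (W t ω).im)) P :=
      hi.comp (φ := I.restrict) (ψ := I.restrict) (Finset.measurable_restrict _)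
        (Finset.measurable_restrict _)
    have h4 := h3.hasGaussianLaw h1 h2
    let L : ((I → ℝ) × (I → ℝ)) →L[ℝ] (I → ℂ) :=
      LinearMap.toContinuousLinearMap
      { toFun := fun x i ↦ ⟨x.1 i, x.2 i⟩
        map_add' := fun x y ↦ by ext i; apply Complex.ext <;> simp
        map_smul' := fun c x ↦ by ext i; apply Complex.ext <;> simp }
    exact h4.map L⟩
  mean t x := by
    simp_rw [complex_inner_eq]
    rw [integral_add, integral_const_mul, integral_const_mul]
    · rw [hre.integral_eval t, him.integral_eval t]; simp
    · exact (hre.integrable_eval t).const_mul _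
    · exact (him.integrable_eval t).const_mul _
  cov s t x y := by
    have := hre.isGaussianProcess.isProbabilityMeasure
    simp_rw [complex_inner_eq]
    have m1 : ∀ t, MemLp (fun ω ↦ (W t ω).re) 2 P := fun t ↦
      (hre.isGaussianProcess.hasGaussianLaw_eval t).memLp_two
    have m2 : ∀ t, MemLp (fun ω ↦ (W t ω).im) 2 P := fun t ↦
      (him.isGaussianProcess.hasGaussianLaw_eval t).memLp_two
    have hind : ∀ s t, IndepFun (fun ω ↦ (W s ω).re) (fun ω ↦ (W t ω).im) P := fun s t ↦
      hi.comp (φ := fun f : ℝ≥0 → ℝ ↦ f s) (ψ := fun f : ℝ≥0 → ℝ ↦ f t) (measurable_pi_apply _)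
        (measurable_pi_apply _)
    have addL : ∀ {f g k : Ω → ℝ}, MemLp f 2 P → MemLp g 2 P → MemLp k 2 P →
      cov[fun ω ↦ f ω + g ω, k; P] = cov[f, k; P] + cov[g, k; P] := covariance_add_left
    have addR : ∀ {f g k : Ω → ℝ}, MemLp k 2 P → MemLp f 2 P → MemLp g 2 P →
      cov[k, fun ω ↦ f ω + g ω; P] = cov[k, f; P] + cov[k, g; P] := covariance_add_right
    have m3 : MemLp (fun ω ↦ y.re * (W t ω).re + y.im * (W t ω).im) 2 P :=
      MemLp.add ((m1 t).const_mul _) ((m2 t).const_mul _)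
    rw [addL ((m1 s).const_mul _) ((m2 s).const_mul _)
        m3,
      addR ((m1 s).const_mul _) ((m1 t).const_mul _) ((m2 t).const_mul _),
      addR ((m2 s).const_mul _) ((m1 t).const_mul _) ((m2 t).const_mul _)]
    simp only [covariance_const_mul_left, covariance_const_mul_right]
    rw [hre.covariance_fun_eval, him.covariance_fun_eval, (hind s t).covariance_eq_zero (m1 s) (m2 t),
      covariance_comm, (hind t s).covariance_eq_zero (m1 t) (m2 s)]
    push_cast
    ring

theorem cov_re (h : IsPlanarPreBrownian W P) (s t : ℝ≥0) :
    cov[fun ω ↦ (W s ω).re, fun ω ↦ (W t ω).re; P] = ((min s t : ℝ≥0) : ℝ) := by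
  have := h.cov s t 1 1
  simpa [complex_inner_eq] using this

theorem cov_im (h : IsPlanarPreBrownian W P) (s t : ℝ≥0) :
    cov[fun ω ↦ (W s ω).im, fun ω ↦ (W t ω).im; P] = ((min s t : ℝ≥0) : ℝ) := by
  have := h.cov s t Complex.I Complex.I
  simpa [complex_inner_eq] using this

theorem cov_re_im (h : IsPlanarPreBrownian W P) (s t : ℝ≥0) :
    cov[fun ω ↦ (W s ω).re, fun ω ↦ (W t ω).im; P] = 0 := by
  have := h.cov s t 1 Complex.I
  simpa [complex_inner_eq] using this

theorem isPreBrownianReal_re (h : IsPlanarPreBrownian W P) :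
    IsPreBrownianReal (fun t ω ↦ (W t ω).re) P := by
  refine IsGaussianProcess.isPreBrownianReal_of_covariance
    (h.gaussian.comp_left fun _ ↦ Complex.reCLM) (fun t ↦ ?_) (fun s t hst ↦ ?_)
  · simpa [complex_inner_eq] using h.mean t 1
  · rw [h.cov_re, min_eq_left hst]

theorem isPreBrownianReal_im (h : IsPlanarPreBrownian W P) :
    IsPreBrownianReal (fun t ω ↦ (W t ω).im) P := by
  refine IsGaussianProcess.isPreBrownianReal_of_covariance
    (h.gaussian.comp_left fun _ ↦ Complex.imCLM) (fun t ↦ ?_) (fun s t hst ↦ ?_)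
  · simpa [complex_inner_eq] using h.mean t Complex.I
  · rw [h.cov_im, min_eq_left hst]

theorem indepFun_re_im (h : IsPlanarPreBrownian W P) :
    IndepFun (fun ω (t : ℝ≥0) ↦ (W t ω).re) (fun ω (t : ℝ≥0) ↦ (W t ω).im) P := by
  refine IsGaussianProcess.indepFun_of_covariance_eq_zero ?_
    (fun t ↦ (Complex.measurable_re.comp (h.measurable t)).aemeasurable)
    (fun t ↦ (Complex.measurable_im.comp (h.measurable t)).aemeasurable) h.cov_re_im
  refine IsGaussianProcess.of_isGaussianProcess h.gaussian ?_
  rintro (t | t)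
  · exact ⟨{t}, Complex.reCLM.comp (ContinuousLinearMap.proj ⟨t, by simp⟩), fun ω ↦ by simp⟩
  · exact ⟨{t}, Complex.imCLM.comp (ContinuousLinearMap.proj ⟨t, by simp⟩), fun ω ↦ by simp⟩

theorem isPlanarBrownian (h : IsPlanarPreBrownian W P) (hc : ∀ᵐ ω ∂P, Continuous fun t ↦ W t ω)
    (z : ℂ) : IsPlanarBrownian (fun t ω ↦ z + W t ω) z P where
  measurable t := (h.measurable t).const_add z
  re := by
    refine ⟨by simpa using h.isPreBrownianReal_re, ?_⟩
    filter_upwards [hc] with ω hω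
    simpa [Function.comp_def] using Complex.continuous_re.comp hω
  im := by
    refine ⟨by simpa using h.isPreBrownianReal_im, ?_⟩
    filter_upwards [hc] with ω hω
    simpa [Function.comp_def] using Complex.continuous_im.comp hω
  indep := by
    have := h.indepFun_re_im.comp (φ := fun f (t : ℝ≥0) ↦ z.re + f t)
      (ψ := fun f (t : ℝ≥0) ↦ z.im + f t)
      (measurable_pi_lambda _ fun t ↦ (measurable_pi_apply t).const_add _)
      (measurable_pi_lambda _ fun t ↦ (measurable_pi_apply t).const_add _)
    simpa [Function.comp_def] using this

theorem shift (h : IsPlanarPreBrownian W P) (r : ℝ≥0) :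
    IsPlanarPreBrownian (fun t ω ↦ W (r + t) ω - W r ω) P where
  measurable t := (h.measurable _).sub (h.measurable _)
  gaussian := h.gaussian.shift r
  mean t x := by
    have := h.isProbabilityMeasure
    simp_rw [inner_sub_right]
    rw [integral_sub ((h.gaussian.memLp_inner _ _).integrable one_le_two)
      ((h.gaussian.memLp_inner _ _).integrable one_le_two), h.mean, h.mean, sub_zero]
  cov s t x y := by
    have := h.isProbabilityMeasure
    simp_rw [inner_sub_right]
    rw [covariance_fun_sub_fun_sub (h.gaussian.memLp_inner _ _) (h.gaussian.memLp_inner _ _)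
      (h.gaussian.memLp_inner _ _) (h.gaussian.memLp_inner _ _), h.cov, h.cov, h.cov, h.cov,
      ← add_min, min_eq_right (by simp : r ≤ r + s), min_eq_left (by simp : r ≤ r + t), min_self]
    push_cast
    ring

theorem isometry (h : IsPlanarPreBrownian W P) (L : ℂ ≃ₗᵢ[ℝ] ℂ) :
    IsPlanarPreBrownian (fun t ω ↦ L (W t ω)) P where
  measurable t := L.continuous.measurable.comp (h.measurable t)
  gaussian := h.gaussian.comp_left fun _ ↦ L.toContinuousLinearEquiv.toContinuousLinearMap
  mean t x := by
    have e : ∀ w, ⟪x, L w⟫ = ⟪L.symm x, w⟫ := fun w ↦ by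
      rw [← L.inner_map_map (L.symm x) w, L.apply_symm_apply]
    simp_rw [e]
    exact h.mean _ _
  cov s t x y := by
    have e : ∀ x w, ⟪x, L w⟫ = ⟪L.symm x, w⟫ := fun x w ↦ by
      rw [← L.inner_map_map (L.symm x) w, L.apply_symm_apply]
    simp_rw [e]
    rw [h.cov, L.symm.inner_map_map]

/-- This is the Markov property. The variables are jointly Gaussian, so it is enough that
covariances vanish, and `min (r + s) t - min r t = 0` for `t ≤ r`. -/
theorem indepFun_shift (h : IsPlanarPreBrownian W P) (r : ℝ≥0) :
    IndepFun (fun ω (t : ℝ≥0) ↦ W (r + t) ω - W r ω) (fun ω (t : Iic r) ↦ W t ω) P := by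
  have := h.isProbabilityMeasure
  refine IsGaussianProcess.indepFun_of_covariance_inner ?_
    (fun t ↦ ((h.measurable _).sub (h.measurable _)).aemeasurable)
    (fun t ↦ (h.measurable _).aemeasurable) ?_
  · refine IsGaussianProcess.of_isGaussianProcess h.gaussian ?_
    rintro (t | t)
    · exact ⟨{r, r + t}, ContinuousLinearMap.proj (R := ℝ) (φ := fun _ ↦ ℂ) ⟨r + t, by simp⟩ -
        ContinuousLinearMap.proj (R := ℝ) (φ := fun _ ↦ ℂ) ⟨r, by simp⟩, fun ω ↦ by simp⟩
    · exact ⟨{t.1}, ContinuousLinearMap.proj (R := ℝ) (φ := fun _ ↦ ℂ) ⟨t.1, by simp⟩,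
        fun ω ↦ by simp⟩
  · rintro s ⟨t, ht⟩ x y
    simp_rw [inner_sub_right]
    rw [covariance_fun_sub_left (h.gaussian.memLp_inner _ _) (h.gaussian.memLp_inner _ _)
      (h.gaussian.memLp_inner _ _), h.cov, h.cov, min_eq_right (le_add_right ht), min_eq_right ht,
      sub_self]

/-- The bridge up to time `r` is independent of the endpoint. -/
theorem indepFun_bridge (h : IsPlanarPreBrownian W P) {r : ℝ≥0} (hr : 0 < r) :
    IndepFun (fun ω (t : Iic r) ↦ W t ω - ((t / r : ℝ≥0) : ℝ) • W r ω) (W r) P := by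
  have := h.isProbabilityMeasure
  have hc : ∀ t : Iic r, ((t / r : ℝ≥0) : ℝ) * r = t := fun t ↦ by
    have : (r : ℝ) ≠ 0 := by exact_mod_cast hr.ne'
    push_cast
    field_simp
  let f : ℝ≥0 → ℝ := fun t ↦ ((t / r : ℝ≥0) : ℝ)
  change IndepFun (fun ω (t : Iic r) ↦ W t ω - f t • W r ω) (W r) P
  have hc : ∀ t : Iic r, f t * r = t := hc
  -- Only `c t * r = t` is needed: it makes the covariance of `W t - c t • W r` with `W r` vanish.
  generalize f = c at hc ⊢
  have key : IndepFun (fun ω (t : Iic r) ↦ W t ω - c t • W r ω) (fun ω (_ : Unit) ↦ W r ω) P := by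
    refine IsGaussianProcess.indepFun_of_covariance_inner ?_
      (fun t ↦ ((h.measurable t.1).sub ((h.measurable r).const_smul (c t.1))).aemeasurable)
      (fun t ↦ (h.measurable _).aemeasurable) ?_
    · refine IsGaussianProcess.of_isGaussianProcess h.gaussian ?_
      rintro (t | t)
      · let L : (({r, t.1} : Finset ℝ≥0) → ℂ) →L[ℝ] ℂ :=
          ContinuousLinearMap.proj (R := ℝ) (φ := fun _ ↦ ℂ) ⟨t.1, by simp⟩ -
          c t • ContinuousLinearMap.proj (R := ℝ) (φ := fun _ ↦ ℂ) ⟨r, by simp⟩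
        exact ⟨{r, t.1}, L, fun ω ↦ by simp [L]⟩
      · exact ⟨{r}, ContinuousLinearMap.proj (R := ℝ) (φ := fun _ ↦ ℂ) ⟨r, by simp⟩,
          fun ω ↦ by simp⟩
    · intro s _ x y
      simp_rw [inner_sub_right, inner_smul_right]
      rw [covariance_fun_sub_left (h.gaussian.memLp_inner _ _)
        ((h.gaussian.memLp_inner _ _).const_mul _)
        (h.gaussian.memLp_inner _ _), covariance_const_mul_left, h.cov, h.cov, min_self,
        min_eq_left s.2]
      linear_combination (-⟪x, y⟫) * hc s
  exact key.comp (φ := id) (ψ := fun f : Unit → ℂ ↦ f ()) measurable_id (measurable_pi_apply _)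

end IsPlanarPreBrownian

/-- Both path laws are projective limits of the same finite-dimensional Gaussian family, and
projective limits of finite measures are unique. -/
theorem IsPreBrownianReal.map_eq {Ω' : Type*} [MeasurableSpace Ω'] {P' : Measure Ω'}
    {X : ℝ≥0 → Ω → ℝ} {X' : ℝ≥0 → Ω' → ℝ} (h : IsPreBrownianReal X P)
    (h' : IsPreBrownianReal X' P') (hm : ∀ t, Measurable (X t)) (hm' : ∀ t, Measurable (X' t)) :
    P.map (fun ω t ↦ X t ω) = P'.map (fun ω t ↦ X' t ω) := by
  have := (IsPreBrownianReal.isGaussianProcess h).isProbabilityMeasure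
  have := (IsPreBrownianReal.isGaussianProcess h').isProbabilityMeasure
  have h1 := isProjectiveLimit_map (X := X) (P := P) (measurable_pi_lambda _ hm).aemeasurable
  have h2 := isProjectiveLimit_map (X := X') (P := P') (measurable_pi_lambda _ hm').aemeasurable
  simp_rw [fun I ↦ (h.hasLaw I).map_eq] at h1
  simp_rw [fun I ↦ (h'.hasLaw I).map_eq] at h2
  exact h1.unique h2

theorem IsPlanarPreBrownian.map_eq {Ω' : Type*} [MeasurableSpace Ω'] {P' : Measure Ω'}
    {W' : ℝ≥0 → Ω' → ℂ} (h : IsPlanarPreBrownian W P) (h' : IsPlanarPreBrownian W' P') :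
    P.map (fun ω t ↦ W t ω) = P'.map (fun ω t ↦ W' t ω) := by
  have := h.isProbabilityMeasure
  have := h'.isProbabilityMeasure
  let Φ : (ℝ≥0 → ℝ) × (ℝ≥0 → ℝ) → (ℝ≥0 → ℂ) := fun f t ↦ ⟨f.1 t, f.2 t⟩
  have hΦ : Measurable Φ := measurable_pi_lambda _ fun t ↦ by
    have : Measurable fun f : (ℝ≥0 → ℝ) × (ℝ≥0 → ℝ) ↦ Complex.measurableEquivRealProd.symm
        (f.1 t, f.2 t) := by fun_prop
    exact this
  have a1 : ∀ t, Measurable fun ω ↦ (W t ω).re := fun t ↦ Complex.measurable_re.comp (h.measurable t)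
  have a2 : ∀ t, Measurable fun ω ↦ (W t ω).im := fun t ↦ Complex.measurable_im.comp (h.measurable t)
  have b1 : ∀ t, Measurable fun ω ↦ (W' t ω).re :=
    fun t ↦ Complex.measurable_re.comp (h'.measurable t)
  have b2 : ∀ t, Measurable fun ω ↦ (W' t ω).im :=
    fun t ↦ Complex.measurable_im.comp (h'.measurable t)
  have e : P.map (fun ω t ↦ W t ω) =
      (P.map (fun ω ↦ ((fun t ↦ (W t ω).re : ℝ≥0 → ℝ), (fun t ↦ (W t ω).im : ℝ≥0 → ℝ)))).map Φ := by
    rw [Measure.map_map hΦ (by fun_prop)]; rfl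
  have e' : P'.map (fun ω t ↦ W' t ω) =
      (P'.map (fun ω ↦ ((fun t ↦ (W' t ω).re : ℝ≥0 → ℝ),
        (fun t ↦ (W' t ω).im : ℝ≥0 → ℝ)))).map Φ := by
    rw [Measure.map_map hΦ (by fun_prop)]; rfl
  rw [e, e', (indepFun_iff_map_prod_eq_prod_map_map (measurable_pi_lambda _ a1).aemeasurable
      (measurable_pi_lambda _ a2).aemeasurable).1 h.indepFun_re_im,
    (indepFun_iff_map_prod_eq_prod_map_map (measurable_pi_lambda _ b1).aemeasurable
      (measurable_pi_lambda _ b2).aemeasurable).1 h'.indepFun_re_im,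
    IsPreBrownianReal.map_eq h.isPreBrownianReal_re h'.isPreBrownianReal_re a1 b1,
    IsPreBrownianReal.map_eq h.isPreBrownianReal_im h'.isPreBrownianReal_im a2 b2]

theorem IsPlanarBrownian.isPlanarPreBrownian {Z : ℝ≥0 → Ω → ℂ} {z : ℂ}
    (h : IsPlanarBrownian Z z P) : IsPlanarPreBrownian (fun t ω ↦ Z t ω - z) P := by
  refine .of_indep (fun t ↦ (h.measurable t).sub_const z) (by simpa using h.re.toIsPreBrownianReal)
    (by simpa using h.im.toIsPreBrownianReal) ?_
  have := h.indep.comp (φ := fun f (t : ℝ≥0) ↦ f t - z.re)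
      (ψ := fun f (t : ℝ≥0) ↦ f t - z.im)
      (measurable_pi_lambda _ fun t ↦ (measurable_pi_apply t).sub_const _)
      (measurable_pi_lambda _ fun t ↦ (measurable_pi_apply t).sub_const _)
  simpa [Function.comp_def] using this

theorem IsPlanarBrownian.ae_continuous {Z : ℝ≥0 → Ω → ℂ} {z : ℂ}
    (h : IsPlanarBrownian Z z P) : ∀ᵐ ω ∂P, Continuous fun t ↦ Z t ω := by
  filter_upwards [h.re.cont, h.im.cont] with ω h1 h2
  have e : (fun t ↦ Z t ω) = fun t ↦
      ((((Z t ω).re - z.re : ℝ) : ℂ) + (((Z t ω).im - z.im : ℝ) : ℂ) * Complex.I) + z := by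
    ext t
    apply Complex.ext <;> simp
  rw [e]
  exact ((Complex.continuous_ofReal.comp h1).add
    ((Complex.continuous_ofReal.comp h2).mul continuous_const)).add continuous_const

/-- Two planar Brownian motions with the same starting point have the same law. -/
theorem IsPlanarBrownian.map_eq {Ω' : Type*} [MeasurableSpace Ω'] {P' : Measure Ω'}
    {Z : ℝ≥0 → Ω → ℂ} {Z' : ℝ≥0 → Ω' → ℂ} {z : ℂ} (h : IsPlanarBrownian Z z P)
    (h' : IsPlanarBrownian Z' z P') : P.map (fun ω t ↦ Z t ω) = P'.map (fun ω t ↦ Z' t ω) := by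
  have hm : Measurable fun (f : ℝ≥0 → ℂ) (t : ℝ≥0) ↦ f t + z := by fun_prop
  have k1 : Measurable (fun ω (t : ℝ≥0) ↦ Z t ω - z) :=
    measurable_pi_lambda _ h.isPlanarPreBrownian.measurable
  have k2 : Measurable (fun ω (t : ℝ≥0) ↦ Z' t ω - z) :=
    measurable_pi_lambda _ h'.isPlanarPreBrownian.measurable
  have := congrArg (Measure.map (fun f t ↦ f t + z))
    (h.isPlanarPreBrownian.map_eq h'.isPlanarPreBrownian)
  rw [Measure.map_map hm k1, Measure.map_map hm k2] at this
  simpa [Function.comp_def] using this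

/-- A measurable process with a.s. continuous paths and the law of a planar Brownian motion is a
planar Brownian motion. -/
theorem IsPlanarBrownian.of_map_eq {Ω' : Type*} [MeasurableSpace Ω'] {P' : Measure Ω'}
    {Z : ℝ≥0 → Ω → ℂ} {Z' : ℝ≥0 → Ω' → ℂ} {z : ℂ} (h : IsPlanarBrownian Z z P)
    (hm : ∀ t, Measurable (Z' t)) (hc : ∀ᵐ ω ∂P', Continuous fun t ↦ Z' t ω)
    (he : P'.map (fun ω t ↦ Z' t ω) = P.map (fun ω t ↦ Z t ω)) : IsPlanarBrownian Z' z P' := by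
  have := h.isPlanarPreBrownian.isProbabilityMeasure
  have k : Measurable (fun ω (t : ℝ≥0) ↦ Z t ω) := measurable_pi_lambda _ h.measurable
  have k' : Measurable (fun ω (t : ℝ≥0) ↦ Z' t ω) := measurable_pi_lambda _ hm
  have : IsProbabilityMeasure P' := by
    have : IsProbabilityMeasure (P'.map (fun ω t ↦ Z' t ω)) := by
      rw [he]; exact Measure.isProbabilityMeasure_map k.aemeasurable
    exact Measure.isProbabilityMeasure_of_map (fun ω (t : ℝ≥0) ↦ Z' t ω)
  have tr : ∀ {β : Type} [MeasurableSpace β] (F : (ℝ≥0 → ℂ) → β), Measurable F →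
      P'.map (fun ω ↦ F (fun t ↦ Z' t ω)) = P.map (fun ω ↦ F (fun t ↦ Z t ω)) := by
    intro β _ F hF
    have := congrArg (Measure.map F) he
    rwa [Measure.map_map hF k', Measure.map_map hF k] at this
  have hr : Measurable fun (f : ℝ≥0 → ℂ) (t : ℝ≥0) ↦ (f t).re := by fun_prop
  have hi : Measurable fun (f : ℝ≥0 → ℂ) (t : ℝ≥0) ↦ (f t).im := by fun_prop
  have hR : ∀ I : Finset ℝ≥0, Measurable fun f : ℝ≥0 → ℂ ↦ I.restrict fun t ↦ (f t).re - z.re :=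
    fun I ↦ measurable_pi_lambda _ fun t ↦ by
      simpa using (Complex.measurable_re.comp (measurable_pi_apply t.1)).sub_const _
  have hI : ∀ I : Finset ℝ≥0, Measurable fun f : ℝ≥0 → ℂ ↦ I.restrict fun t ↦ (f t).im - z.im :=
    fun I ↦ measurable_pi_lambda _ fun t ↦ by
      simpa using (Complex.measurable_im.comp (measurable_pi_apply t.1)).sub_const _
  refine ⟨hm, ⟨⟨fun I ↦ ⟨?_, ?_⟩⟩, ?_⟩, ⟨⟨fun I ↦ ⟨?_, ?_⟩⟩, ?_⟩, ?_⟩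
  · exact ((hR I).comp k').aemeasurable
  · rw [← (h.re.hasLaw I).map_eq]
    exact tr (fun f ↦ I.restrict fun t ↦ (f t).re - z.re) (hR I)
  · filter_upwards [hc] with ω hω
    exact (Complex.continuous_re.comp hω).sub continuous_const
  · exact ((hI I).comp k').aemeasurable
  · rw [← (h.im.hasLaw I).map_eq]
    exact tr (fun f ↦ I.restrict fun t ↦ (f t).im - z.im) (hI I)
  · filter_upwards [hc] with ω hω
    exact (Complex.continuous_im.comp hω).sub continuous_const
  · have hi' := h.indep
    rw [indepFun_iff_map_prod_eq_prod_map_map (f := fun ω t ↦ (Z t ω).re)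
      (g := fun ω t ↦ (Z t ω).im) (hr.comp k).aemeasurable (hi.comp k).aemeasurable] at hi'
    rw [indepFun_iff_map_prod_eq_prod_map_map (f := fun ω t ↦ (Z' t ω).re)
      (g := fun ω t ↦ (Z' t ω).im) (hr.comp k').aemeasurable (hi.comp k').aemeasurable]
    rw [tr (fun f (t : ℝ≥0) ↦ (f t).re) hr, tr (fun f (t : ℝ≥0) ↦ (f t).im) hi, ← hi']
    exact tr (fun f ↦ ((fun t ↦ (f t).re : ℝ≥0 → ℝ), (fun t ↦ (f t).im : ℝ≥0 → ℝ)))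
      (by fun_prop)

end Gaussian

/-! ### The planar heat kernel and its comparison with the logarithmic kernel. -/

section HeatKernel

/-- The heat kernel of the plane: the density of planar Brownian motion at time `u`. -/
noncomputable def heatKernel (u : ℝ) (z : ℂ) : ℝ≥0∞ :=
  ENNReal.ofReal ((2 * Real.pi * u)⁻¹ * Real.exp (-‖z‖ ^ 2 / (2 * u)))

theorem measurable_heatKernel : Measurable fun p : ℝ × ℂ ↦ heatKernel p.1 p.2 := by
  unfold heatKernel; fun_prop

@[fun_prop]
theorem Measurable.heatKernel {α : Type*} [MeasurableSpace α] {f : α → ℝ} {g : α → ℂ}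
    (hf : Measurable f) (hg : Measurable g) : Measurable fun x ↦ heatKernel (f x) (g x) :=
  measurable_heatKernel.comp (hf.prodMk hg)

theorem heatKernel_neg (u : ℝ) (z : ℂ) : heatKernel u (-z) = heatKernel u z := by
  simp [heatKernel]

theorem heatKernel_sub_comm (u : ℝ) (z w : ℂ) : heatKernel u (z - w) = heatKernel u (w - z) := by
  rw [← heatKernel_neg, neg_sub]

theorem heatKernel_eq_gaussianPDF {u : ℝ≥0} (z : ℂ) :
    heatKernel u z = gaussianPDF 0 u z.re * gaussianPDF 0 u z.im := by
  rw [gaussianPDF, gaussianPDF, ← ENNReal.ofReal_mul (gaussianPDFReal_nonneg _ _ _), heatKernel]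
  congr 1
  simp only [gaussianPDFReal, sub_zero]
  rw [mul_mul_mul_comm, ← Real.exp_add, ← mul_inv, Real.mul_self_sqrt (by positivity),
    Complex.sq_norm, Complex.normSq_apply]
  congr 2
  ring

theorem lintegral_heatKernel {u : ℝ} (hu : 0 < u) : ∫⁻ z, heatKernel u z = 1 := by
  lift u to ℝ≥0 using hu.le
  have hu' : u ≠ 0 := by rintro rfl; simp at hu
  simp_rw [heatKernel_eq_gaussianPDF]
  rw [← (Complex.volume_preserving_equiv_real_prod.symm).lintegral_comp_emb
    (MeasurableEquiv.measurableEmbedding _), Measure.volume_eq_prod]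
  simp only [Complex.measurableEquivRealProd_symm_apply]
  rw [lintegral_prod_mul (by fun_prop) (by fun_prop), lintegral_gaussianPDF_eq_one _ hu', one_mul]

theorem IsPlanarPreBrownian.map_eq_withDensity {Ω : Type*} [MeasurableSpace Ω] {P : Measure Ω}
    {W : ℝ≥0 → Ω → ℂ} (h : IsPlanarPreBrownian W P) {u : ℝ≥0} (hu : u ≠ 0) :
    P.map (W u) = volume.withDensity (heatKernel u) := by
  have := h.isProbabilityMeasure
  have hi : IndepFun (fun ω ↦ (W u ω).re) (fun ω ↦ (W u ω).im) P :=
    h.indepFun_re_im.comp (φ := fun f : ℝ≥0 → ℝ ↦ f u) (ψ := fun f : ℝ≥0 → ℝ ↦ f u)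
      (measurable_pi_apply _) (measurable_pi_apply _)
  have mr : Measurable fun ω ↦ (W u ω).re := Complex.measurable_re.comp (h.measurable u)
  have mi : Measurable fun ω ↦ (W u ω).im := Complex.measurable_im.comp (h.measurable u)
  have e := (indepFun_iff_map_prod_eq_prod_map_map mr.aemeasurable mi.aemeasurable).1 hi
  rw [(h.isPreBrownianReal_re.hasLaw_eval u).map_eq, (h.isPreBrownianReal_im.hasLaw_eval u).map_eq]
    at e
  have e2 : P.map (W u) = (P.map fun ω ↦ ((W u ω).re, (W u ω).im)).map
      Complex.measurableEquivRealProd.symm := by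
    rw [Measure.map_map (MeasurableEquiv.measurable _) (mr.prodMk mi)]
    rfl
  rw [e2]
  erw [e]
  ext s hs
  rw [Measure.map_apply (MeasurableEquiv.measurable _) hs, withDensity_apply _ hs,
    gaussianReal_of_var_ne_zero _ hu, prod_withDensity (by fun_prop) (by fun_prop),
    withDensity_apply _ (MeasurableEquiv.measurable _ hs),
    ← (Complex.volume_preserving_equiv_real_prod.symm).setLIntegral_comp_preimage_emb
    (MeasurableEquiv.measurableEmbedding _), Measure.volume_eq_prod]
  simp_rw [heatKernel_eq_gaussianPDF]
  rfl

theorem IsPlanarPreBrownian.lintegral_comp {Ω : Type*} [MeasurableSpace Ω] {P : Measure Ω}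
    {W : ℝ≥0 → Ω → ℂ} (h : IsPlanarPreBrownian W P) {u : ℝ≥0} (hu : u ≠ 0) {f : ℂ → ℝ≥0∞}
    (hf : Measurable f) : ∫⁻ ω, f (W u ω) ∂P = ∫⁻ z, f z * heatKernel u z := by
  rw [← lintegral_map hf (h.measurable u), h.map_eq_withDensity hu,
    lintegral_withDensity_eq_lintegral_mul _ (by fun_prop) hf]
  simp_rw [Pi.mul_apply, mul_comm]

/-- Completing the square: the joint density of a path through `y` is the end-to-end density times
the density of the Brownian bridge from `a` to `b` at time `s`. Integrating out `y` gives the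
semigroup identity. -/
theorem heatKernel_mul_heatKernel {s t : ℝ} (hs : 0 < s) (ht : 0 < t) (a b y : ℂ) :
    heatKernel s (y - a) * heatKernel t (b - y) = heatKernel (s + t) (b - a) *
      heatKernel (s * t / (s + t)) (y - (t / (s + t) : ℝ) • a - (s / (s + t) : ℝ) • b) := by
  simp only [heatKernel]
  rw [← ENNReal.ofReal_mul (by positivity), ← ENNReal.ofReal_mul (by positivity),
    mul_mul_mul_comm, ← Real.exp_add, mul_mul_mul_comm, ← Real.exp_add]
  congr 1
  congr 1
  · field_simp
  · congr 1
    simp only [Complex.sq_norm, Complex.normSq_apply, Complex.sub_re, Complex.sub_im,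
      Complex.real_smul,
      Complex.re_ofReal_mul, Complex.im_ofReal_mul]
    field_simp
    ring

theorem lintegral_heatKernel_mul_heatKernel {s t : ℝ} (hs : 0 < s) (ht : 0 < t) (a b : ℂ) :
    ∫⁻ y, heatKernel s (y - a) * heatKernel t (b - y) = heatKernel (s + t) (b - a) := by
  simp_rw [heatKernel_mul_heatKernel hs ht, sub_sub]
  rw [lintegral_const_mul _ (by fun_prop),
    lintegral_sub_right_eq_self (fun y ↦ heatKernel (s * t / (s + t)) y),
    lintegral_heatKernel (by positivity), mul_one]

theorem heatKernel_le_inv {u v : ℝ} (hu : 0 < u) (huv : u ≤ v) (z : ℂ) :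
    heatKernel v z ≤ ENNReal.ofReal u⁻¹ := by
  have hv : 0 < v := hu.trans_le huv
  refine ENNReal.ofReal_le_ofReal ?_
  have h1 : Real.exp (-‖z‖ ^ 2 / (2 * v)) ≤ 1 := by
    rw [Real.exp_le_one_iff]
    exact div_nonpos_of_nonpos_of_nonneg (by simp) (by positivity)
  have h2 : (2 * Real.pi * v)⁻¹ ≤ u⁻¹ := by
    apply inv_anti₀ hu
    nlinarith [Real.pi_gt_three]
  calc _ ≤ u⁻¹ * 1 := by gcongr
    _ = _ := mul_one _

/-- From `x ≤ exp x` at `x = ‖z‖ ^ 2 / (2 * v)`. The bound is uniform in `v`, which handles times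
shorter than `‖z‖ ^ 2`. -/
theorem heatKernel_le_inv_norm_sq {v : ℝ} (hv : 0 < v) {z : ℂ} (hz : z ≠ 0) :
    heatKernel v z ≤ ENNReal.ofReal (‖z‖ ^ 2)⁻¹ := by
  refine ENNReal.ofReal_le_ofReal ?_
  have hz' : 0 < ‖z‖ := norm_pos_iff.2 hz
  have h1 := Real.add_one_le_exp (‖z‖ ^ 2 / (2 * v))
  rw [neg_div, Real.exp_neg, ← mul_inv]
  apply inv_anti₀ (by positivity)
  have h2 : ‖z‖ ^ 2 / (2 * v) ≤ Real.exp (‖z‖ ^ 2 / (2 * v)) := by linarith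
  calc ‖z‖ ^ 2 = 2 * 1 * v * (‖z‖ ^ 2 / (2 * v)) := by field_simp
    _ ≤ 2 * Real.pi * v * Real.exp (‖z‖ ^ 2 / (2 * v)) := by
      gcongr
      linarith [Real.pi_gt_three]

/-- Away from the origin the heat kernel is of the order of the time. -/
theorem heatKernel_le_of_le_norm {v η : ℝ} (hv : 0 < v) (hη : 0 < η) {z : ℂ} (hz : η ≤ ‖z‖) :
    heatKernel v z ≤ ENNReal.ofReal (v * (4 / η ^ 4)) := by
  refine ENNReal.ofReal_le_ofReal ?_
  set x := η ^ 2 / (2 * v) with hx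
  have hx0 : 0 < x := by positivity
  -- The quadratic term of the exponential gains `v ^ 2`, which beats the prefactor of order `1 / v`
  -- and leaves `4 * v / η ^ 4`.
  have h1 : Real.exp (-‖z‖ ^ 2 / (2 * v)) ≤ (x ^ 2 / 2)⁻¹ := by
    have h2 : x ^ 2 / 2 ≤ Real.exp x := by
      have := Real.quadratic_le_exp_of_nonneg hx0.le
      linarith
    calc Real.exp (-‖z‖ ^ 2 / (2 * v)) ≤ Real.exp (-x) := by
          rw [hx, ← neg_div]; gcongr
      _ = (Real.exp x)⁻¹ := Real.exp_neg x
      _ ≤ _ := by gcongr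
  calc _ ≤ (2 * 1 * v)⁻¹ * (x ^ 2 / 2)⁻¹ := by
        gcongr
        linarith [Real.pi_gt_three]
    _ = _ := by rw [hx]; field_simp; ring

theorem lintegral_Ioo_abs_le (F : ℝ → ℝ≥0∞) :
    ∫⁻ u in Ioo (-1 : ℝ) 1, F |u| ≤ 2 * ∫⁻ u in Ioo (0 : ℝ) 1, F u := by
  have h0 : ∫⁻ u in Ioo (0 : ℝ) 1, F |u| = ∫⁻ u in Ioo (0 : ℝ) 1, F u :=
    setLIntegral_congr_fun measurableSet_Ioo fun u hu ↦ by rw [abs_of_pos hu.1]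
  have h1 : ∫⁻ u in Ioo (-1 : ℝ) 0, F |u| = ∫⁻ u in Ioo (0 : ℝ) 1, F |u| := by
    have := (Measure.measurePreserving_neg (volume : Measure ℝ)).setLIntegral_comp_preimage_emb
      (MeasurableEquiv.neg ℝ).measurableEmbedding (fun u ↦ F |u|) (Ioo (0 : ℝ) 1)
    rw [← this]
    simp
  have hs : Ioo (-1 : ℝ) 1 ⊆ Ioo (-1 : ℝ) 0 ∪ ({0} ∪ Ioo (0 : ℝ) 1) := by
    intro u hu
    rcases lt_trichotomy u 0 with h | h | h
    · exact Or.inl ⟨hu.1, h⟩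
    · exact Or.inr (Or.inl h)
    · exact Or.inr (Or.inr ⟨h, hu.2⟩)
  calc _ ≤ ∫⁻ u in Ioo (-1 : ℝ) 0 ∪ ({0} ∪ Ioo (0 : ℝ) 1), F |u| := lintegral_mono_set hs
    _ ≤ (∫⁻ u in Ioo (-1 : ℝ) 0, F |u|) + ((∫⁻ u in {(0 : ℝ)}, F |u|) + ∫⁻ u in Ioo (0 : ℝ) 1, F |u|) :=
      (lintegral_union_le _ _ _).trans (by gcongr; exact lintegral_union_le _ _ _)
    _ = _ := by
      rw [h1, h0, setLIntegral_measure_zero {(0 : ℝ)} _ Real.volume_singleton, zero_add, two_mul]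

/-- The time integral of the heat kernel is dominated by the logarithmic kernel. -/
theorem lintegral_heatKernel_time_le {η : ℝ} (hη : 0 < η) (z w : ℂ) :
    ∫⁻ u in Ioo (-1 : ℝ) 1, heatKernel (η + |u|) (z - w) ≤ 2 * (1 + 2 * logKernel z w) := by
  rcases eq_or_ne z w with rfl | hzw
  · simp [logKernel, ENNReal.mul_top]
  refine (lintegral_Ioo_abs_le fun u ↦ heatKernel (η + u) (z - w)).trans ?_
  gcongr
  have hd : z - w ≠ 0 := sub_ne_zero.2 hzw
  have hr : 0 < ‖z - w‖ := norm_pos_iff.2 hd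
  set d := ‖z - w‖ with hd'
  -- Split at the diffusive time `d ^ 2`. Earlier times contribute at most `d ^ 2 * (d ^ 2)⁻¹ = 1`;
  -- later ones at most `∫ du / u = log (1 / d ^ 2)`, twice the logarithmic kernel.
  have hs : Ioo (0 : ℝ) 1 ⊆ Ioo (0 : ℝ) (d ^ 2) ∪ Ico (d ^ 2) 1 := by
    intro u hu
    rcases lt_or_ge u (d ^ 2) with h | h
    · exact Or.inl ⟨hu.1, h⟩
    · exact Or.inr ⟨h, hu.2⟩
  calc _ ≤ ∫⁻ u in Ioo (0 : ℝ) (d ^ 2) ∪ Ico (d ^ 2) 1, heatKernel (η + u) (z - w) :=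
        lintegral_mono_set hs
    _ ≤ _ := lintegral_union_le _ _ _
    _ ≤ 1 + 2 * logKernel z w := by
      gcongr
      · calc _ ≤ ∫⁻ u in Ioo (0 : ℝ) (d ^ 2), ENNReal.ofReal (d ^ 2)⁻¹ :=
              setLIntegral_mono measurable_const fun u hu ↦
                heatKernel_le_inv_norm_sq (by linarith [hu.1]) hd
          _ = 1 := by
            rw [setLIntegral_const, Real.volume_Ioo, ← ENNReal.ofReal_mul (by positivity)]
            simp [hr.ne']
      · rcases lt_or_ge (d ^ 2) 1 with h1 | h1
        · calc _ ≤ ∫⁻ u in Ico (d ^ 2) 1, ENNReal.ofReal u⁻¹ :=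
                setLIntegral_mono (by fun_prop) fun u hu ↦
                  heatKernel_le_inv (lt_of_lt_of_le (by positivity) hu.1) (by linarith) _
            _ = ∫⁻ u in Ioc (d ^ 2) 1, ENNReal.ofReal u⁻¹ := by
                rw [restrict_Ico_eq_restrict_Ioc]
            _ = ENNReal.ofReal (∫ u in Ioc (d ^ 2) 1, u⁻¹) := by
                rw [ofReal_integral_eq_lintegral_ofReal]
                · rw [← IntegrableOn, ← intervalIntegrable_iff_integrableOn_Ioc_of_le h1.le]
                  refine intervalIntegral.intervalIntegrable_inv (fun x hx ↦ ?_) continuousOn_id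
                  rw [uIcc_of_le h1.le] at hx
                  exact (lt_of_lt_of_le (by positivity) hx.1).ne'
                · refine (ae_restrict_iff' measurableSet_Ioc).2 (ae_of_all _ fun u hu ↦ ?_)
                  have : 0 < u := lt_trans (by positivity) hu.1
                  simpa using this.le
            _ = 2 * logKernel z w := by
                rw [← intervalIntegral.integral_of_le h1.le, integral_inv_of_pos (by positivity)
                  one_pos, logKernel, if_neg hzw, one_div, Real.log_inv, Real.log_pow, dist_eq_norm,
                  ← hd']
                rw [show -(((2 : ℕ) : ℝ) * Real.log d) = 2 * -Real.log d by push_cast; ring,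
                  ENNReal.ofReal_mul zero_le_two]
                simp
        · rw [Ico_eq_empty (not_lt.2 h1)]
          simp

end HeatKernel

/-! ### Occupation functionals and the second moment method for hitting a set of finite energy. -/

section Occupation

/-- The convolution of a measure with the heat kernel. -/
noncomputable def heatPotential (ν : Measure ℂ) (ε : ℝ) (y : ℂ) : ℝ≥0∞ :=
  ∫⁻ z, heatKernel ε (y - z) ∂ν

/-- The correlation of the potential at lag `v`. -/
noncomputable def heatCorrelation (ν : Measure ℂ) (ε : ℝ) (v : ℂ) : ℝ≥0∞ :=
  ∫⁻ y, heatPotential ν ε y * heatPotential ν ε (y + v)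

theorem lintegral_heatPotential_add_mul {ν : Measure ℂ} (ε : ℝ) (v w : ℂ) :
    ∫⁻ x, heatPotential ν ε (x + v) * heatPotential ν ε (x + w) = heatCorrelation ν ε (w - v) := by
  rw [heatCorrelation, ← lintegral_add_right_eq_self (fun y ↦ heatPotential ν ε y * _) v]
  refine lintegral_congr fun x ↦ ?_
  congr 2; ring

theorem heatCorrelation_neg {ν : Measure ℂ} (ε : ℝ) (v : ℂ) :
    heatCorrelation ν ε (-v) = heatCorrelation ν ε v := by
  have h := lintegral_heatPotential_add_mul (ν := ν) ε v 0
  rw [zero_sub] at h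
  rw [← h, heatCorrelation]
  simp_rw [add_zero, mul_comm]

variable {ν : Measure ℂ} [IsFiniteMeasure ν]

theorem measurable_heatPotential (ε : ℝ) : Measurable (heatPotential ν ε) :=
  Measurable.lintegral_prod_right' (f := fun p : ℂ × ℂ ↦ heatKernel ε (p.1 - p.2)) (by fun_prop)

@[fun_prop]
theorem Measurable.heatPotential {α : Type*} [MeasurableSpace α] {ε : ℝ} {g : α → ℂ}
    (hg : Measurable g) : Measurable fun x ↦ heatPotential ν ε (g x) :=
  (measurable_heatPotential ε).comp hg

theorem lintegral_heatPotential_mul_heatKernel {ε u : ℝ} (hε : 0 < ε) (hu : 0 < u) (y : ℂ) :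
    ∫⁻ z, heatPotential ν ε (y + z) * heatKernel u z = heatPotential ν (u + ε) y := by
  simp only [heatPotential]
  have e : ∀ z, (∫⁻ w, heatKernel ε (y + z - w) ∂ν) * heatKernel u z =
      ∫⁻ w, heatKernel ε (y + z - w) * heatKernel u z ∂ν :=
    fun z ↦ (lintegral_mul_const _ (by fun_prop)).symm
  simp_rw [e]
  rw [lintegral_lintegral_swap (by fun_prop)]
  refine lintegral_congr fun b ↦ ?_
  rw [heatKernel_sub_comm (u + ε), ← lintegral_heatKernel_mul_heatKernel hu hε y b,
    ← lintegral_add_left_eq_self (fun z ↦ heatKernel u (z - y) * heatKernel ε (b - z)) y]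
  refine lintegral_congr fun z ↦ ?_
  rw [mul_comm, add_sub_cancel_left, heatKernel_sub_comm ε]

theorem lintegral_heatPotential_mul_heatPotential {ε η : ℝ} (hε : 0 < ε) (hη : 0 < η) :
    ∫⁻ y, heatPotential ν ε y * heatPotential ν η y =
      ∫⁻ a, ∫⁻ b, heatKernel (ε + η) (a - b) ∂ν ∂ν := by
  simp only [heatPotential]
  have e : ∀ y, (∫⁻ a, heatKernel ε (y - a) ∂ν) * (∫⁻ b, heatKernel η (y - b) ∂ν) =
      ∫⁻ a, ∫⁻ b, heatKernel ε (y - a) * heatKernel η (y - b) ∂ν ∂ν := fun y ↦ by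
    rw [← lintegral_mul_const _ (by fun_prop)]
    exact lintegral_congr fun a ↦ (lintegral_const_mul _ (by fun_prop)).symm
  simp_rw [e]
  rw [lintegral_lintegral_swap]
  · refine lintegral_congr fun a ↦ ?_
    rw [lintegral_lintegral_swap (by fun_prop)]
    refine lintegral_congr fun b ↦ ?_
    rw [heatKernel_sub_comm (ε + η), ← lintegral_heatKernel_mul_heatKernel hε hη a b]
    simp_rw [heatKernel_sub_comm η b]
  · refine Measurable.aemeasurable ?_
    exact Measurable.lintegral_prod_right' (f := fun p : (ℂ × ℂ) × ℂ ↦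
      heatKernel ε (p.1.1 - p.1.2) * heatKernel η (p.1.1 - p.2)) (by fun_prop)

theorem measurable_heatCorrelation (ε : ℝ) : Measurable (heatCorrelation ν ε) :=
  Measurable.lintegral_prod_right' (f := fun p : ℂ × ℂ ↦
    heatPotential ν ε p.2 * heatPotential ν ε (p.2 + p.1)) (by fun_prop)

/-- The semigroup property adds the times: `ε` from each of the two potentials and `u` from the lag
between them. -/
theorem lintegral_heatCorrelation_mul {ε u : ℝ} (hε : 0 < ε) (hu : 0 < u) :
    ∫⁻ z, heatCorrelation ν ε z * heatKernel u z =
      ∫⁻ a, ∫⁻ b, heatKernel (2 * ε + u) (a - b) ∂ν ∂ν := by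
  simp only [heatCorrelation]
  have e : ∀ z, (∫⁻ y, heatPotential ν ε y * heatPotential ν ε (y + z)) * heatKernel u z =
      ∫⁻ y, heatPotential ν ε y * (heatPotential ν ε (y + z) * heatKernel u z) := fun z ↦ by
    rw [← lintegral_mul_const _ (by fun_prop)]
    simp_rw [mul_assoc]
  have e' : ∀ y, ∫⁻ z, heatPotential ν ε y * (heatPotential ν ε (y + z) * heatKernel u z) =
      heatPotential ν ε y * ∫⁻ z, heatPotential ν ε (y + z) * heatKernel u z :=
    fun y ↦ lintegral_const_mul _ (by fun_prop)
  simp_rw [e]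
  rw [lintegral_lintegral_swap (by fun_prop)]
  simp_rw [e', lintegral_heatPotential_mul_heatKernel hε hu]
  rw [lintegral_heatPotential_mul_heatPotential hε (by positivity)]
  simp_rw [show ε + (u + ε) = 2 * ε + u by ring]

variable {Ω : Type*} {W : ℝ≥0 → Ω → ℂ}

/-- The occupation functional of the heat potential along the translated path. -/
noncomputable def occupation (ν : Measure ℂ) (W : ℝ≥0 → Ω → ℂ) (δ ε : ℝ) (x : ℂ) (ω : Ω) : ℝ≥0∞ :=
  ∫⁻ t in Ioc 0 δ, heatPotential ν ε (x + W t.toNNReal ω)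

/-- A compact piece of path that misses the closed set `C` stays at a distance `η > 0` from it, and
there the heat kernel at time `ε` is of order `ε`. -/
theorem tendsto_occupation_zero (hW : ∀ ω, Continuous fun t ↦ W t ω) {C : Set ℂ} (hC : IsClosed C)
    (hν : ν Cᶜ = 0) {δ : ℝ} {x : ℂ} {ω : Ω} (hx : ∀ t ∈ Icc 0 δ, x + W t.toNNReal ω ∉ C)
    {ε : ℕ → ℝ} (hε : ∀ n, 0 < ε n) (hlim : Tendsto ε atTop (𝓝 0)) :
    Tendsto (fun n ↦ occupation ν W δ (ε n) x ω) atTop (𝓝 0) := by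
  have hcont : Continuous fun t : ℝ ↦ x + W t.toNNReal ω :=
    continuous_const.add ((hW ω).comp continuous_real_toNNReal)
  obtain ⟨η, hη, hd⟩ : ∃ η > 0, ∀ t ∈ Icc 0 δ, ∀ z ∈ C, η ≤ dist (x + W t.toNNReal ω) z := by
    have hdis : Disjoint ((fun t : ℝ ↦ x + W t.toNNReal ω) '' Icc 0 δ) C := by
      rw [Set.disjoint_left]
      rintro _ ⟨t, ht, rfl⟩
      exact hx t ht
    obtain ⟨η, hη, h'⟩ := Metric.exists_pos_forall_lt_edist (isCompact_Icc.image hcont) hC hdis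
    refine ⟨η, hη, fun t ht z hz ↦ ?_⟩
    have := h' _ ⟨t, ht, rfl⟩ z hz
    rw [edist_nndist] at this
    exact_mod_cast this.le
  have hb : ∀ n, occupation ν W δ (ε n) x ω ≤
      ENNReal.ofReal (ε n * (4 / η ^ 4)) * (ν univ * volume (Ioc 0 δ)) := by
    intro n
    calc _ ≤ ∫⁻ t in Ioc 0 δ, ENNReal.ofReal (ε n * (4 / η ^ 4)) * ν univ := by
          refine setLIntegral_mono measurable_const fun t ht ↦ ?_
          rw [← lintegral_const]
          refine lintegral_mono_ae ?_
          filter_upwards [measure_eq_zero_iff_ae_notMem.1 hν] with z hz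
          refine heatKernel_le_of_le_norm (hε n) hη ?_
          rw [← dist_eq_norm]
          exact hd t ⟨ht.1.le, ht.2⟩ z (by simpa using hz)
      _ = _ := by rw [setLIntegral_const, mul_assoc]
  refine tendsto_of_tendsto_of_tendsto_of_le_of_le tendsto_const_nhds ?_ (fun _ ↦ zero_le) hb
  have h1 : Tendsto (fun n ↦ ENNReal.ofReal (ε n * (4 / η ^ 4))) atTop (𝓝 0) := by
    have := ENNReal.tendsto_ofReal (hlim.mul_const (4 / η ^ 4))
    simpa using this
  have h2 := ENNReal.Tendsto.mul_const (b := ν univ * volume (Ioc 0 δ)) h1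
    (Or.inr (ENNReal.mul_ne_top (measure_ne_top _ _) (by simp)))
  simpa using h2

variable [MeasurableSpace Ω] {P : Measure Ω}

theorem IsPlanarPreBrownian.lintegral_heatCorrelation (h : IsPlanarPreBrownian W P) {ε : ℝ}
    (hε : 0 < ε) {s t : ℝ≥0} (hst : s ≠ t) :
    ∫⁻ ω, heatCorrelation ν ε (W t ω - W s ω) ∂P =
      ∫⁻ a, ∫⁻ b, heatKernel (2 * ε + |(t : ℝ) - s|) (a - b) ∂ν ∂ν := by
  wlog hlt : s < t generalizing s t
  · have hlt' : t < s := lt_of_le_of_ne (not_lt.1 hlt) hst.symm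
    rw [abs_sub_comm, ← this hst.symm hlt']
    refine lintegral_congr fun ω ↦ ?_
    rw [← heatCorrelation_neg, neg_sub]
  obtain ⟨u, rfl⟩ : ∃ u, t = s + u := ⟨t - s, (add_tsub_cancel_of_le hlt.le).symm⟩
  have hu : 0 < u := by simpa using hlt
  have e : |((s + u : ℝ≥0) : ℝ) - s| = u := by simp
  rw [(h.shift s).lintegral_comp hu.ne' (measurable_heatCorrelation ε), e,
    lintegral_heatCorrelation_mul hε (by exact_mod_cast hu)]

theorem IsPlanarPreBrownian.measurable_uncurry (h : IsPlanarPreBrownian W P)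
    (hc : ∀ ω, Continuous fun t ↦ W t ω) :
    Measurable fun p : ℝ × Ω ↦ W p.1.toNNReal p.2 :=
  measurable_uncurry_of_continuous_of_measurable (u := fun (t : ℝ) ω ↦ W t.toNNReal ω)
    (fun ω ↦ (hc ω).comp continuous_real_toNNReal) fun _ ↦ h.measurable _

theorem measurable_occupation (hm : Measurable fun p : ℝ × Ω ↦ W p.1.toNNReal p.2) (δ ε : ℝ) :
    Measurable fun p : ℂ × Ω ↦ occupation ν W δ ε p.1 p.2 := by
  refine Measurable.lintegral_prod_right' (ν := volume.restrict (Ioc 0 δ))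
    (f := fun q : (ℂ × Ω) × ℝ ↦ heatPotential ν ε (q.1.1 + W q.2.toNNReal q.1.2)) ?_
  have : Measurable fun q : (ℂ × Ω) × ℝ ↦ q.1.1 + W q.2.toNNReal q.1.2 :=
    (measurable_fst.comp measurable_fst).add
      (hm.comp (measurable_snd.prodMk (measurable_snd.comp measurable_fst)))
  exact this.heatPotential

/-- The second moment of the occupation functional is controlled by the energy. -/
theorem IsPlanarPreBrownian.lintegral_occupation_sq_le (h : IsPlanarPreBrownian W P)
    (hc : ∀ ω, Continuous fun t ↦ W t ω) {δ ε : ℝ} (hδ : δ ≤ 1) (hε : 0 < ε) :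
    ∫⁻ ω, ∫⁻ x, occupation ν W δ ε x ω ^ 2 ∂volume ∂P ≤
      ENNReal.ofReal δ * ∫⁻ a, ∫⁻ b, 2 * (1 + 2 * logKernel a b) ∂ν ∂ν := by
  have := h.isProbabilityMeasure
  have hm := h.measurable_uncurry hc
  have hW : ∀ ω, Measurable fun t : ℝ ↦ W t.toNNReal ω := fun ω ↦
    hm.comp (measurable_id.prodMk measurable_const)
  have hW' : ∀ t, Measurable (W t) := h.measurable
  -- The square is a double time integral. Integrating over the starting point `x` first,
  -- translation invariance leaves a correlation that depends only on the increment between the two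
  -- times.
  have e : ∀ ω, ∫⁻ x, occupation ν W δ ε x ω ^ 2 = ∫⁻ s in Ioc 0 δ, ∫⁻ t in Ioc 0 δ,
      heatCorrelation ν ε (W t.toNNReal ω - W s.toNNReal ω) := by
    intro ω
    have hWω := hW ω
    calc _ = ∫⁻ x, ∫⁻ s in Ioc 0 δ, ∫⁻ t in Ioc 0 δ,
          heatPotential ν ε (x + W s.toNNReal ω) * heatPotential ν ε (x + W t.toNNReal ω) := by
          refine lintegral_congr fun x ↦ ?_
          rw [sq, occupation, ← lintegral_mul_const _ (by fun_prop)]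
          refine lintegral_congr fun s ↦ ?_
          rw [lintegral_const_mul _ (by fun_prop)]
      _ = ∫⁻ s in Ioc 0 δ, ∫⁻ x, ∫⁻ t in Ioc 0 δ,
          heatPotential ν ε (x + W s.toNNReal ω) * heatPotential ν ε (x + W t.toNNReal ω) := by
          refine lintegral_lintegral_swap (Measurable.aemeasurable ?_)
          exact Measurable.lintegral_prod_right' (ν := volume.restrict (Ioc 0 δ))
            (f := fun q : (ℂ × ℝ) × ℝ ↦ heatPotential ν ε (q.1.1 + W q.1.2.toNNReal ω) *
              heatPotential ν ε (q.1.1 + W q.2.toNNReal ω)) (by fun_prop)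
      _ = _ := by
          refine lintegral_congr fun s ↦ ?_
          rw [lintegral_lintegral_swap (by fun_prop)]
          exact lintegral_congr fun t ↦ lintegral_heatPotential_add_mul _ _ _
  have mC : Measurable fun q : (Ω × ℝ) × ℝ ↦
      heatCorrelation ν ε (W q.2.toNNReal q.1.1 - W q.1.2.toNNReal q.1.1) :=
    (measurable_heatCorrelation ε).comp
      ((hm.comp (measurable_snd.prodMk (measurable_fst.comp measurable_fst))).sub
      (hm.comp ((measurable_snd.comp measurable_fst).prodMk (measurable_fst.comp measurable_fst))))
  have key : ∀ s ∈ Ioc 0 δ, ∫⁻ t in Ioc 0 δ, ∫⁻ ω,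
      heatCorrelation ν ε (W t.toNNReal ω - W s.toNNReal ω) ∂P ≤
      ∫⁻ a, ∫⁻ b, 2 * (1 + 2 * logKernel a b) ∂ν ∂ν := by
    intro s hs
    set R : ℝ → ℝ≥0∞ := fun u ↦ ∫⁻ a, ∫⁻ b, heatKernel (2 * ε + |u|) (a - b) ∂ν ∂ν with hR
    -- The diagonal `t = s`, where the increment has no density, is a null set of times.
    calc _ ≤ ∫⁻ t in Ioc 0 δ, R (t - s) := by
          refine lintegral_mono_ae ?_
          filter_upwards [ae_restrict_mem measurableSet_Ioc,
            ae_restrict_of_ae (Measure.ae_ne volume s)] with t ht hts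
          have hne : s.toNNReal ≠ t.toNNReal := fun h' ↦ hts
            ((Real.toNNReal_eq_toNNReal_iff hs.1.le ht.1.le).1 h').symm
          rw [h.lintegral_heatCorrelation hε hne, Real.coe_toNNReal _ hs.1.le,
            Real.coe_toNNReal _ ht.1.le]
      _ ≤ ∫⁻ t in (fun t ↦ t - s) ⁻¹' Ioo (-1) 1, R (t - s) := by
          refine lintegral_mono_set fun t ht ↦ ?_
          simp only [mem_preimage, mem_Ioo]
          constructor <;> linarith [ht.1, ht.2, hs.1, hs.2]
      _ = ∫⁻ u in Ioo (-1 : ℝ) 1, R u :=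
          (measurePreserving_sub_right volume s).setLIntegral_comp_preimage_emb
            (MeasurableEquiv.subRight s).measurableEmbedding R _
      _ = ∫⁻ a, ∫⁻ b, ∫⁻ u in Ioo (-1 : ℝ) 1, heatKernel (2 * ε + |u|) (a - b) ∂volume ∂ν ∂ν := by
          rw [hR, lintegral_lintegral_swap]
          · refine lintegral_congr fun a ↦ ?_
            rw [lintegral_lintegral_swap (by fun_prop)]
          · refine Measurable.aemeasurable ?_
            exact Measurable.lintegral_prod_right' (f := fun q : (ℝ × ℂ) × ℂ ↦
              heatKernel (2 * ε + |q.1.1|) (q.1.2 - q.2)) (by fun_prop)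
      _ ≤ _ := by
          gcongr with a b
          exact lintegral_heatKernel_time_le (by positivity) a b
  calc _ = ∫⁻ ω, ∫⁻ s in Ioc 0 δ, ∫⁻ t in Ioc 0 δ,
      heatCorrelation ν ε (W t.toNNReal ω - W s.toNNReal ω) ∂volume ∂volume ∂P :=
        lintegral_congr e
    _ = ∫⁻ s in Ioc 0 δ, ∫⁻ t in Ioc 0 δ, ∫⁻ ω,
      heatCorrelation ν ε (W t.toNNReal ω - W s.toNNReal ω) ∂P := by
        rw [lintegral_lintegral_swap]
        · refine lintegral_congr fun s ↦ ?_
          have mCs : Measurable fun q : Ω × ℝ ↦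
              heatCorrelation ν ε (W q.2.toNNReal q.1 - W s.toNNReal q.1) :=
            (measurable_heatCorrelation ε).comp ((hm.comp (measurable_snd.prodMk measurable_fst)).sub
              ((hW' _).comp measurable_fst))
          exact lintegral_lintegral_swap mCs.aemeasurable
        · have mC' : Measurable fun q : Ω × ℝ ↦ ∫⁻ t in Ioc 0 δ,
              heatCorrelation ν ε (W t.toNNReal q.1 - W q.2.toNNReal q.1) :=
            Measurable.lintegral_prod_right' (ν := volume.restrict (Ioc 0 δ)) mC
          exact mC'.aemeasurable
    _ ≤ ∫⁻ s in Ioc 0 δ, ∫⁻ a, ∫⁻ b, 2 * (1 + 2 * logKernel a b) ∂ν ∂ν :=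
        setLIntegral_mono measurable_const key
    _ = _ := by rw [setLIntegral_const, Real.volume_Ioc, sub_zero, mul_comm]

/-- For `z` in the ball of radius `r`, the closed ball of radius `r` about `z` lies in the ball of
radius `2 * r`, so the potential of each point mass keeps there at least its share near the centre.
-/
theorem lintegral_ball_heatPotential_ge {ε r : ℝ} {c : ℂ} (hν : ν (Metric.ball c r)ᶜ = 0) :
    ν univ * ∫⁻ w in Metric.closedBall 0 r, heatKernel ε w ≤
      ∫⁻ y in Metric.ball c (2 * r), heatPotential ν ε y := by
  simp only [heatPotential]
  rw [lintegral_lintegral_swap (by fun_prop), mul_comm, ← lintegral_const]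
  refine lintegral_mono_ae ?_
  filter_upwards [measure_eq_zero_iff_ae_notMem.1 hν] with z hz
  have hz' : dist z c < r := by simpa using hz
  calc _ = ∫⁻ y in (fun y ↦ y - z) ⁻¹' Metric.closedBall 0 r, heatKernel ε (y - z) :=
        ((measurePreserving_sub_right volume z).setLIntegral_comp_preimage_emb
          (MeasurableEquiv.subRight z).measurableEmbedding _ _).symm
    _ ≤ _ := by
        refine lintegral_mono_set fun y hy ↦ ?_
        have hy' : dist y z ≤ r := by simpa [dist_eq_norm] using hy
        rw [Metric.mem_ball]
        linarith [dist_triangle y z c]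

/-- The first moment of the occupation functional, over paths that stay near their start. -/
theorem IsPlanarPreBrownian.le_lintegral_occupation (h : IsPlanarPreBrownian W P)
    (hc : ∀ ω, Continuous fun t ↦ W t ω) {δ ε r : ℝ} (hε : 0 < ε) (hεδ : ε ≤ δ) {c : ℂ}
    (hν : ν (Metric.ball c r)ᶜ = 0) {E : Set Ω} (hE : MeasurableSet E)
    (hEr : ∀ ω ∈ E, ∀ t ∈ Icc 0 δ, ‖W t.toNNReal ω‖ ≤ r) :
    P E * (ENNReal.ofReal δ * (ν univ * P E)) ≤
      ∫⁻ ω in E, ∫⁻ x in Metric.ball c (3 * r), occupation ν W δ ε x ω ∂volume ∂P := by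
  have hm := h.measurable_uncurry hc
  -- Since `ε ≤ δ`, the paths in `E` are within `r` of the origin at time `ε`, and `heatKernel ε` is
  -- the density at that time.
  have hk : P E ≤ ∫⁻ w in Metric.closedBall 0 r, heatKernel ε w := by
    have hne : ε.toNNReal ≠ 0 := by simpa using hε
    have := h.map_eq_withDensity hne
    rw [Real.coe_toNNReal _ hε.le] at this
    rw [← withDensity_apply _ measurableSet_closedBall, ← this,
      Measure.map_apply (h.measurable _) measurableSet_closedBall]
    exact measure_mono fun ω hω ↦ by simpa using hEr ω hω ε ⟨hε.le, hεδ⟩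
  rw [mul_comm (P E), ← setLIntegral_const]
  refine setLIntegral_mono' hE fun ω hω ↦ ?_
  have hW : Measurable fun t : ℝ ↦ W t.toNNReal ω := hm.comp (measurable_id.prodMk measurable_const)
  calc _ = ∫⁻ t in Ioc 0 δ, ν univ * P E := by
        rw [setLIntegral_const, Real.volume_Ioc, sub_zero, mul_comm]
    _ ≤ ∫⁻ t in Ioc 0 δ, ∫⁻ x in Metric.ball c (3 * r),
        heatPotential ν ε (x + W t.toNNReal ω) := by
        refine setLIntegral_mono' measurableSet_Ioc fun t ht ↦ ?_
        calc _ ≤ ν univ * ∫⁻ w in Metric.closedBall 0 r, heatKernel ε w := by gcongr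
          _ ≤ _ := lintegral_ball_heatPotential_ge hν
          _ = ∫⁻ x in (fun x ↦ x + W t.toNNReal ω) ⁻¹' Metric.ball c (2 * r),
              heatPotential ν ε (x + W t.toNNReal ω) :=
            ((measurePreserving_add_right volume _).setLIntegral_comp_preimage_emb
              (MeasurableEquiv.addRight _).measurableEmbedding _ _).symm
          _ ≤ _ := by
            refine lintegral_mono_set fun x hx ↦ ?_
            have h1 : dist (x + W t.toNNReal ω) c < 2 * r := hx
            have h2 := hEr ω hω t ⟨ht.1.le, ht.2⟩
            have h3 : dist x (x + W t.toNNReal ω) = ‖W t.toNNReal ω‖ := by simp [dist_eq_norm]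
            rw [Metric.mem_ball]
            linarith [dist_triangle x (x + W t.toNNReal ω) c]
    _ = _ := by
        simp only [occupation]
        rw [lintegral_lintegral_swap (by fun_prop)]

/-- Brownian paths started near a measure of finite logarithmic energy hit its carrier with positive
probability, already within a short time and without moving far. -/
theorem IsPlanarPreBrownian.not_ae_avoid (h : IsPlanarPreBrownian W P)
    (hc : ∀ ω, Continuous fun t ↦ W t ω) {C : Set ℂ} (hC : IsClosed C) (hνC : ν Cᶜ = 0)
    (hν0 : ν univ ≠ 0) (hfin : ∫⁻ a, ∫⁻ b, logKernel a b ∂ν ∂ν < ∞)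
    {δ r : ℝ} (hδ0 : 0 < δ) (hδ : δ ≤ 1) {c : ℂ} (hν : ν (Metric.ball c r)ᶜ = 0)
    {E : Set Ω} (hE : MeasurableSet E) (hEr : ∀ ω ∈ E, ∀ t ∈ Icc 0 δ, ‖W t.toNNReal ω‖ ≤ r)
    (hPE : P E ≠ 0) :
    ¬ ∀ᵐ p ∂((volume.restrict (Metric.ball c (3 * r))).prod (P.restrict E)),
      ∀ t ∈ Icc 0 δ, p.1 + W t.toNNReal p.2 ∉ C := by
  intro hae
  have := h.isProbabilityMeasure
  have hm := h.measurable_uncurry hc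
  have : IsFiniteMeasure (volume.restrict (Metric.ball c (3 * r))) :=
    ⟨by rw [Measure.restrict_apply_univ]; exact measure_ball_lt_top⟩
  set m := (volume.restrict (Metric.ball c (3 * r))).prod (P.restrict E) with hmdef
  set K : ℝ≥0∞ := ENNReal.ofReal δ * ∫⁻ a, ∫⁻ b, 2 * (1 + 2 * logKernel a b) ∂ν ∂ν with hK
  have hKfin : K ≠ ∞ := by
    refine ENNReal.mul_ne_top ENNReal.ofReal_ne_top ?_
    have e : ∀ a, ∫⁻ b, 2 * (1 + 2 * logKernel a b) ∂ν = 2 * (ν univ + 2 * ∫⁻ b, logKernel a b ∂ν) := by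
      intro a
      rw [lintegral_const_mul' _ _ (by simp), lintegral_add_left measurable_const,
        lintegral_const_mul' _ _ (by simp), lintegral_const, one_mul]
    simp_rw [e]
    rw [lintegral_const_mul' _ _ (by simp), lintegral_add_left measurable_const,
        lintegral_const_mul' _ _ (by simp), lintegral_const]
    have h1 : ν univ ≠ ∞ := measure_ne_top _ _
    have h2 := hfin.ne
    finiteness
  set c₀ := P E * (ENNReal.ofReal δ * (ν univ * P E)) with hc₀
  have hc₀0 : c₀ ≠ 0 := by
    have : ENNReal.ofReal δ ≠ 0 := by simpa using hδ0
    positivity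
  let ε : ℕ → ℝ := fun n ↦ δ / (n + 1)
  have hε : ∀ n, 0 < ε n := fun n ↦ by positivity
  have hεδ : ∀ n, ε n ≤ δ := fun n ↦ div_le_self hδ0.le (by linarith [n.cast_nonneg (α := ℝ)])
  have hlim : Tendsto ε atTop (𝓝 0) := tendsto_const_nhds.div_atTop
    (tendsto_natCast_atTop_atTop.atTop_add tendsto_const_nhds)
  let A : ℕ → ℂ × Ω → ℝ≥0∞ := fun n p ↦ occupation ν W δ (ε n) p.1 p.2
  have hA : ∀ n, Measurable (A n) := fun n ↦ measurable_occupation hm _ _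
  -- The first moments stay above `c₀ > 0` and the second moments below `K < ∞`, so the `A n` are
  -- uniformly integrable. They would tend to `0` almost everywhere if `C` were avoided, a
  -- contradiction.
  have first : ∀ n, c₀ ≤ ∫⁻ p, A n p ∂m := fun n ↦ by
    rw [hmdef, lintegral_prod_symm _ (hA n).aemeasurable]
    exact h.le_lintegral_occupation hc (hε n) (hεδ n) hν hE hEr
  have second : ∀ n, ∫⁻ p, A n p ^ 2 ∂m ≤ K := fun n ↦ by
    rw [hmdef, lintegral_prod_symm _ ((hA n).pow_const 2).aemeasurable]
    refine le_trans ?_ (h.lintegral_occupation_sq_le hc hδ (hε n))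
    refine (setLIntegral_le_lintegral _ _).trans ?_
    gcongr with ω
    exact Measure.restrict_le_self
  -- Truncate with `A ≤ min A M + A ^ 2 / M`. Dominated convergence removes the first term as `n →
  -- ∞`; letting `M → ∞` afterwards removes the second.
  have main : ∀ M : ℕ, M ≠ 0 → c₀ ≤ (M : ℝ≥0∞)⁻¹ * K := by
    intro M hM
    have hb : ∀ n, c₀ ≤ ∫⁻ p, min (A n p) M ∂m + (M : ℝ≥0∞)⁻¹ * K := by
      intro n
      calc c₀ ≤ ∫⁻ p, A n p ∂m := first n
        _ ≤ ∫⁻ p, (min (A n p) M + (M : ℝ≥0∞)⁻¹ * A n p ^ 2) ∂m := by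
          gcongr with p
          rcases le_total (A n p) M with hle | hle
          · rw [min_eq_left hle]; exact le_self_add
          · refine le_trans ?_ le_add_self
            calc A n p = 1 * A n p := (one_mul _).symm
              _ = (M : ℝ≥0∞)⁻¹ * M * A n p := by
                rw [ENNReal.inv_mul_cancel (by exact_mod_cast hM) (by simp)]
              _ ≤ (M : ℝ≥0∞)⁻¹ * A n p * A n p := by gcongr
              _ = _ := by rw [sq, mul_assoc]
        _ = ∫⁻ p, min (A n p) M ∂m + (M : ℝ≥0∞)⁻¹ * ∫⁻ p, A n p ^ 2 ∂m := by
          rw [lintegral_add_left ((hA n).min measurable_const),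
            lintegral_const_mul _ ((hA n).pow_const 2)]
        _ ≤ _ := by gcongr; exact second n
    have hlim0 : Tendsto (fun n ↦ ∫⁻ p, min (A n p) M ∂m) atTop (𝓝 (∫⁻ _, 0 ∂m)) := by
      refine tendsto_lintegral_of_dominated_convergence (fun _ ↦ (M : ℝ≥0∞))
        (fun n ↦ (hA n).min measurable_const) (fun n ↦ ae_of_all _ fun p ↦ min_le_right _ _) ?_ ?_
      · rw [lintegral_const]
        exact ENNReal.mul_ne_top (by simp) (measure_ne_top _ _)
      · filter_upwards [hae] with p hp
        have := (tendsto_occupation_zero hc hC hνC hp hε hlim).min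
          (tendsto_const_nhds (x := (M : ℝ≥0∞)))
        simpa using this
    rw [lintegral_zero] at hlim0
    have := ge_of_tendsto' (hlim0.add_const ((M : ℝ≥0∞)⁻¹ * K)) hb
    simpa using this
  have hlimM : Tendsto (fun M : ℕ ↦ (M : ℝ≥0∞)⁻¹ * K) atTop (𝓝 (0 * K)) :=
    ENNReal.Tendsto.mul_const ENNReal.tendsto_inv_nat_nhds_zero (Or.inr hKfin)
  rw [zero_mul] at hlimM
  have := ge_of_tendsto hlimM ((eventually_ne_atTop 0).mono main)
  exact hc₀0 (le_zero_iff.1 this)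

end Occupation

/-! ### Hitting probabilities: measurability, and positivity throughout a domain. -/

section Hitting

/-- The clamped times `min q t` are countably many, dense in `[0, t]`, and include `t`. This makes
conditions on a whole time interval measurable. -/
theorem forall_rat_min_iff {E : Type*} [TopologicalSpace E] {w : ℝ≥0 → E} (hw : Continuous w)
    {F : Set E} (hF : IsClosed F) (t : ℝ≥0) :
    (∀ q : ℚ, w (min (q : ℝ).toNNReal t) ∈ F) ↔ ∀ s ≤ t, w s ∈ F := by
  refine ⟨fun h s hs ↦ ?_, fun h q ↦ h _ (min_le_right _ _)⟩
  have hc : Continuous fun u : ℝ ↦ w (min u.toNNReal t) :=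
    hw.comp (continuous_real_toNNReal.min continuous_const)
  have h1 : ∀ u : ℝ, w (min u.toNNReal t) ∈ F := fun u ↦
    closure_minimal (t := (fun u : ℝ ↦ w (min u.toNNReal t)) ⁻¹' F)
      (range_subset_iff.2 h) (hF.preimage hc) (Rat.denseRange_cast u)
  simpa [min_eq_left hs] using h1 s

/-- The points whose distance to the complement of `N` is at least `1 / (m + 1)`. -/
def innerPart (N : Set ℂ) (m : ℕ) : Set ℂ := {z | ((m : ℝ≥0∞) + 1)⁻¹ ≤ Metric.infEDist z Nᶜ}

theorem isClosed_innerPart (N : Set ℂ) (m : ℕ) : IsClosed (innerPart N m) :=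
  isClosed_le continuous_const Metric.continuous_infEDist

theorem innerPart_subset (N : Set ℂ) (m : ℕ) : innerPart N m ⊆ N := by
  intro z hz
  by_contra h
  have h0 := Metric.infEDist_zero_of_mem (show z ∈ Nᶜ from h)
  rw [innerPart, mem_ofPred_eq, h0, nonpos_iff_eq_zero, ENNReal.inv_eq_zero] at hz
  exact (by finiteness : (m : ℝ≥0∞) + 1 ≠ ∞) hz

theorem exists_subset_innerPart {N : Set ℂ} (hN : IsOpen N) {K : Set ℂ} (hK : IsCompact K)
    (hKN : K ⊆ N) : ∃ m, K ⊆ innerPart N m := by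
  obtain ⟨η, hη, h⟩ := Metric.exists_pos_forall_lt_edist hK hN.isClosed_compl
    (disjoint_compl_right_iff_subset.2 hKN)
  obtain ⟨m, hm⟩ := ENNReal.exists_inv_nat_lt (a := (η : ℝ≥0∞)) (by simpa using hη.ne')
  refine ⟨m, fun z hz ↦ ?_⟩
  rw [innerPart, mem_ofPred_eq, Metric.le_infEDist]
  intro y hy
  refine le_trans ?_ (h z hz y hy).le
  refine le_trans ?_ hm.le
  gcongr
  exact le_self_add

/-- The paths that hit `C` before leaving `N`, described through countably many times. -/
def hitEvent (C N : Set ℂ) : Set (ℝ≥0 → ℂ) :=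
  {w | ∃ m T : ℕ, ∀ n : ℕ, ∃ q : ℚ, (q : ℝ).toNNReal ≤ T ∧
    Metric.infEDist (w (q : ℝ).toNNReal) C < ((n : ℝ≥0∞) + 1)⁻¹ ∧
    ∀ s : ℚ, w (min (s : ℝ).toNNReal (q : ℝ).toNNReal) ∈ innerPart N m}

theorem measurableSet_hitEvent (C N : Set ℂ) : MeasurableSet (hitEvent C N) := by
  refine measurableSet_setOfPred.2 <| .exists fun m ↦ .exists fun T ↦ .forall fun n ↦ .exists fun q ↦
    measurable_const.and (.and ?_ (.forall fun s ↦ ?_))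
  · exact measurableSet_setOfPred.1 (measurableSet_lt
      (Metric.continuous_infEDist.measurable.comp (measurable_pi_apply _)) measurable_const)
  · exact measurableSet_setOfPred.1 (measurable_pi_apply _ (isClosed_innerPart N m).measurableSet)

theorem mem_hitEvent_iff {C N : Set ℂ} (hC : IsClosed C) (hN : IsOpen N) {w : ℝ≥0 → ℂ}
    (hw : Continuous w) : w ∈ hitEvent C N ↔ ∃ t, w t ∈ C ∧ ∀ s ≤ t, w s ∈ N := by
  constructor
  · rintro ⟨m, T, h⟩
    choose q hqT hqC hqN using h
    simp_rw [forall_rat_min_iff hw (isClosed_innerPart N m)] at hqN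
    set t : ℕ → ℝ≥0 := fun n ↦ (q n : ℝ).toNNReal with ht
    -- The bound `T` gives a convergent subsequence of approach times; its limit is a time at which
    -- `C` is hit. The uniform distance `1 / (m + 1)` to the complement of `N` survives the limit.
    obtain ⟨a, -, φ, hφ, hlim⟩ := (isCompact_Icc (a := (0 : ℝ≥0)) (b := T)).tendsto_subseq
      (x := t) fun n ↦ ⟨zero_le, hqT n⟩
    have hwlim : Tendsto (fun n ↦ w (t (φ n))) atTop (𝓝 (w a)) := (hw.tendsto a).comp hlim
    refine ⟨a, ?_, fun s hs ↦ innerPart_subset N m ?_⟩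
    · have hne : C.Nonempty := by
        by_contra hne
        rw [not_nonempty_iff_eq_empty] at hne
        have := hqC 0
        simp [hne] at this
      · rw [Metric.mem_iff_infEDist_zero_of_closed hC]
        refine tendsto_nhds_unique ((Metric.continuous_infEDist.tendsto _).comp hwlim) ?_
        refine tendsto_of_tendsto_of_tendsto_of_le_of_le tendsto_const_nhds
          ?_ (fun _ ↦ zero_le) fun n ↦ (hqC (φ n)).le
        have : Tendsto (fun n : ℕ ↦ ((n : ℝ≥0∞) + 1)⁻¹) atTop (𝓝 0) := by
          have := (tendsto_add_atTop_iff_nat 1).2 ENNReal.tendsto_inv_nat_nhds_zero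
          simpa using this
        exact this.comp hφ.tendsto_atTop
    · rcases hs.lt_or_eq with hs | rfl
      · obtain ⟨n, hn⟩ := (hlim.eventually (lt_mem_nhds hs)).exists
        exact hqN _ s hn.le
      · exact (isClosed_innerPart N m).mem_of_tendsto hwlim
          (Eventually.of_forall fun n ↦ hqN _ _ le_rfl)
  · rintro ⟨t, htC, htN⟩
    obtain ⟨m, hm⟩ := exists_subset_innerPart hN
      ((isCompact_Icc (a := (0 : ℝ≥0)) (b := t)).image hw) (image_subset_iff.2 fun s hs ↦ htN s hs.2)
    obtain ⟨T, hT⟩ := exists_nat_ge t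
    refine ⟨m, T, fun n ↦ ?_⟩
    have hst : ∀ q : ℚ, (q : ℝ).toNNReal ≤ t →
        ∀ s : ℚ, w (min (s : ℝ).toNNReal (q : ℝ).toNNReal) ∈ innerPart N m := fun q hq s ↦
      hm ⟨_, ⟨zero_le, (min_le_right _ _).trans hq⟩, rfl⟩
    suffices ∃ q : ℚ, (q : ℝ).toNNReal ≤ t ∧
        Metric.infEDist (w (q : ℝ).toNNReal) C < ((n : ℝ≥0∞) + 1)⁻¹ by
      obtain ⟨q, hq, hqC⟩ := this
      exact ⟨q, hq.trans hT, hqC, hst q hq⟩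
    have h0 : Metric.infEDist (w t) C = 0 := Metric.infEDist_zero_of_mem htC
    -- The rational time must not exceed the hitting time, so it is taken just below `t`; at `t = 0`
    -- there is room only for `0` itself.
    rcases eq_or_ne t 0 with rfl | ht
    · exact ⟨0, by simp, by simp [h0]⟩
    have hcont : Continuous fun u : ℝ ↦ Metric.infEDist (w u.toNNReal) C :=
      Metric.continuous_infEDist.comp (hw.comp continuous_real_toNNReal)
    have hev : ∀ᶠ u in 𝓝[<] (t : ℝ), Metric.infEDist (w u.toNNReal) C < ((n : ℝ≥0∞) + 1)⁻¹ := by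
      refine (hcont.tendsto _).mono_left nhdsWithin_le_nhds |>.eventually_lt_const ?_
      simp [h0]
    obtain ⟨l, hl, hl'⟩ := (mem_nhdsLT_iff_exists_Ioo_subset.1 hev)
    obtain ⟨q, hq1, hq2⟩ := exists_rat_btwn (show l < t from hl)
    exact ⟨q, Real.toNNReal_le_iff_le_coe.2 hq2.le, hl' ⟨hq1, hq2⟩⟩

variable {Ω : Type*} {W : ℝ≥0 → Ω → ℂ}

theorem setOf_norm_le_eq (hc : ∀ ω, Continuous fun t ↦ W t ω) (δ : ℝ≥0) (r : ℝ) :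
    {ω | ∀ s ≤ δ, ‖W s ω‖ ≤ r} = {ω | ∀ q : ℚ, ‖W (min (q : ℝ).toNNReal δ) ω‖ ≤ r} := by
  ext ω
  have := forall_rat_min_iff (hc ω) (Metric.isClosed_closedBall (x := (0 : ℂ)) (ε := r)) δ
  simpa using this.symm

variable [MeasurableSpace Ω] {P : Measure Ω}

theorem measurableSet_norm_le (hm : ∀ t, Measurable (W t)) (hc : ∀ ω, Continuous fun t ↦ W t ω)
    (δ : ℝ≥0) (r : ℝ) : MeasurableSet {ω | ∀ s ≤ δ, ‖W s ω‖ ≤ r} := by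
  rw [setOf_norm_le_eq hc]
  exact measurableSet_setOfPred.2 <| .forall fun q ↦
    measurableSet_setOfPred.1 (measurableSet_le (hm _).norm measurable_const)

theorem exists_measure_norm_le_ne_zero [IsProbabilityMeasure P]
    (hc : ∀ ω, Continuous fun t ↦ W t ω) (h0 : ∀ ω, W 0 ω = 0) {r : ℝ} (hr : 0 < r) :
    ∃ δ : ℝ≥0, 0 < δ ∧ δ ≤ 1 ∧ P {ω | ∀ s ≤ δ, ‖W s ω‖ ≤ r} ≠ 0 := by
  by_contra! hcon
  have hU : (⋃ n : ℕ, {ω | ∀ s ≤ ((n : ℝ≥0) + 1)⁻¹, ‖W s ω‖ ≤ r}) = univ := by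
    refine eq_univ_of_forall fun ω ↦ mem_iUnion.2 ?_
    have hev : ∀ᶠ s in 𝓝 (0 : ℝ≥0), ‖W s ω‖ < r := by
      refine ((hc ω).norm.tendsto 0).eventually_lt_const ?_
      simpa [h0] using hr
    obtain ⟨η, hη, hs⟩ := NNReal.nhds_zero_basis.mem_iff.1 hev
    obtain ⟨n, hn⟩ := exists_nat_one_div_lt hη
    refine ⟨n, fun s hsn ↦ le_of_lt (hs (lt_of_le_of_lt hsn ?_))⟩
    simpa using hn
  have : P univ = 0 := by
    rw [← hU]
    refine measure_iUnion_null fun n ↦ hcon _ (by positivity) ?_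
    exact inv_le_one_of_one_le₀ le_add_self
  simp at this

/-- The probability that Brownian motion from `x` hits `C` before leaving `N`. -/
noncomputable def hitProb (W : ℝ≥0 → Ω → ℂ) (P : Measure Ω) (C N : Set ℂ) (x : ℂ) : ℝ≥0∞ :=
  P {ω | (fun t ↦ x + W t ω) ∈ hitEvent C N}

theorem measurableSet_hit (hm : ∀ t, Measurable (W t)) (C N : Set ℂ) :
    MeasurableSet {p : ℂ × Ω | (fun t ↦ p.1 + W t p.2) ∈ hitEvent C N} := by
  have : Measurable fun (p : ℂ × Ω) (t : ℝ≥0) ↦ p.1 + W t p.2 :=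
    measurable_pi_lambda _ fun t ↦ measurable_fst.add ((hm t).comp measurable_snd)
  exact this (measurableSet_hitEvent C N)

theorem measurable_hitProb [SFinite P] (hm : ∀ t, Measurable (W t)) (C N : Set ℂ) :
    Measurable (hitProb W P C N) :=
  measurable_measure_prodMk_left (measurableSet_hit hm C N)

theorem mem_of_hitProb_ne_zero (hc : ∀ ω, Continuous fun t ↦ W t ω) (h0 : ∀ ω, W 0 ω = 0)
    {C N : Set ℂ} (hC : IsClosed C) (hN : IsOpen N) {x : ℂ} (hx : hitProb W P C N x ≠ 0) :
    x ∈ N := by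
  obtain ⟨ω, hω⟩ := nonempty_of_measure_ne_zero hx
  obtain ⟨t, -, ht⟩ := (mem_hitEvent_iff hC hN (continuous_const.add (hc ω))).1 hω
  simpa [h0] using ht 0 zero_le

/-- Localise the measure near a point of `C` all of whose relative neighbourhoods it charges; the
restricted measure still has finite energy. Paths that start nearby and move little cannot leave
`N`, so `not_ae_avoid` applies. -/
theorem IsPlanarPreBrownian.volume_hitProb_ne_zero (h : IsPlanarPreBrownian W P)
    (hc : ∀ ω, Continuous fun t ↦ W t ω) (h0 : ∀ ω, W 0 ω = 0) {C N : Set ℂ} (hC : IsCompact C)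
    (hN : IsOpen N) (hCN : C ⊆ N) {μ : Measure ℂ} [IsProbabilityMeasure μ] (hμ : μ Cᶜ = 0)
    (hfin : ∫⁻ a, ∫⁻ b, logKernel a b ∂μ ∂μ < ∞) :
    volume {x | hitProb W P C N x ≠ 0} ≠ 0 := by
  have := h.isProbabilityMeasure
  have hμC : μ C ≠ 0 := by
    rw [(prob_compl_eq_zero_iff hC.measurableSet).1 hμ]; exact one_ne_zero
  obtain ⟨c, hcC, hcpos⟩ := exists_mem_forall_mem_nhdsWithin_pos_measure hμC
  obtain ⟨ρ, hρ, hρN⟩ := Metric.isOpen_iff.1 hN c (hCN hcC)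
  -- Starting within `3 * r` of `c` and moving by at most `r` keeps the path within `4 * r < ρ`.
  set r := ρ / 5 with hr
  have hr0 : 0 < r := by positivity
  obtain ⟨δ, hδ0, hδ1, hPE⟩ := exists_measure_norm_le_ne_zero (P := P) hc h0 hr0
  set E := {ω | ∀ s ≤ δ, ‖W s ω‖ ≤ r} with hEdef
  have hE : MeasurableSet E := measurableSet_norm_le h.measurable hc δ r
  have hEr : ∀ ω ∈ E, ∀ t ∈ Icc 0 (δ : ℝ), ‖W t.toNNReal ω‖ ≤ r := fun ω hω t ht ↦
    hω _ (Real.toNNReal_le_iff_le_coe.2 ht.2)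
  set ν := μ.restrict (Metric.ball c r) with hν
  intro hvol
  refine h.not_ae_avoid (ν := ν) hc hC.isClosed ?_ ?_ ?_ (δ := δ) (by exact_mod_cast hδ0)
    (by exact_mod_cast hδ1) (c := c) (r := r) ?_ hE hEr hPE ?_
  · exact Measure.restrict_le_self.absolutelyContinuous hμ
  · rw [hν, Measure.restrict_apply_univ]
    exact (hcpos _ (mem_nhdsWithin_of_mem_nhds (Metric.ball_mem_nhds c hr0))).ne'
  · refine lt_of_le_of_lt ?_ hfin
    exact lintegral_mono' Measure.restrict_le_self fun a ↦ lintegral_mono' Measure.restrict_le_self le_rfl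
  · rw [hν, Measure.restrict_apply measurableSet_ball.compl]
    simp
  · have hnull : (volume.prod P) {p : ℂ × Ω | (fun t ↦ p.1 + W t p.2) ∈ hitEvent C N} = 0 := by
      rw [Measure.measure_prod_null (measurableSet_hit h.measurable C N)]
      exact hvol
    have hae : ∀ᵐ p ∂(volume.prod P).restrict (Metric.ball c (3 * r) ×ˢ E),
        (fun t ↦ p.1 + W t p.2) ∉ hitEvent C N :=
      ae_restrict_of_ae (measure_eq_zero_iff_ae_notMem.1 hnull)
    rw [Measure.prod_restrict]
    filter_upwards [hae, ae_restrict_mem (measurableSet_ball.prod hE)] with p hp hpE t ht hpC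
    refine hp ((mem_hitEvent_iff hC.isClosed hN (continuous_const.add (hc p.2))).2
      ⟨t.toNNReal, hpC, fun s hs ↦ hρN ?_⟩)
    have h1 : dist p.1 c < 3 * r := hpE.1
    have h2 : ‖W s p.2‖ ≤ r := hpE.2 s (hs.trans (Real.toNNReal_le_iff_le_coe.2 ht.2))
    have h3 : dist (p.1 + W s p.2) p.1 = ‖W s p.2‖ := by simp [dist_eq_norm]
    change dist (p.1 + W s p.2) c < ρ
    linarith [dist_triangle (p.1 + W s p.2) p.1 c]

theorem heatKernel_pos {u : ℝ} (hu : 0 < u) (z : ℂ) : 0 < heatKernel u z := by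
  rw [heatKernel, ENNReal.ofReal_pos]
  positivity

theorem IsPlanarPreBrownian.measure_mem_ne_zero (h : IsPlanarPreBrownian W P) {t : ℝ≥0}
    (ht : 0 < t) (x : ℂ) {A : Set ℂ} (hA : MeasurableSet A) (hvol : volume A ≠ 0) :
    P {ω | x + W t ω ∈ A} ≠ 0 := by
  have e : {ω | x + W t ω ∈ A} = W t ⁻¹' ((fun z ↦ x + z) ⁻¹' A) := rfl
  have hA' : MeasurableSet ((fun z ↦ x + z) ⁻¹' A) := hA.preimage (by fun_prop)
  rw [e, ← Measure.map_apply (h.measurable t) hA', h.map_eq_withDensity ht.ne',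
    withDensity_apply _ hA']
  rw [← pos_iff_ne_zero, setLIntegral_pos_iff (by fun_prop),
    Function.support_eq_univ fun z ↦ (heatKernel_pos (by exact_mod_cast ht) z).ne', univ_inter,
    measure_preimage_add]
  exact pos_iff_ne_zero.2 hvol

/-- The probability of hitting is positive wherever one can first reach points where it is. -/
theorem IsPlanarPreBrownian.hitProb_ne_zero_of_ball (h : IsPlanarPreBrownian W P)
    (hc : ∀ ω, Continuous fun t ↦ W t ω) (h0 : ∀ ω, W 0 ω = 0) {C N : Set ℂ} (hC : IsClosed C)
    (hN : IsOpen N) {x : ℂ} {r : ℝ} (hr : 0 < r) (hxN : Metric.ball x (3 * r) ⊆ N)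
    (hvol : volume ({y | hitProb W P C N y ≠ 0} ∩ Metric.ball x r) ≠ 0) :
    hitProb W P C N x ≠ 0 := by
  have := h.isProbabilityMeasure
  obtain ⟨t, ht0, -, hPt⟩ := exists_measure_norm_le_ne_zero (P := P) hc h0 (half_pos hr)
  set G := {y | hitProb W P C N y ≠ 0} with hG
  have hGm : MeasurableSet G := measurable_hitProb h.measurable C N (measurableSet_singleton 0).compl
  -- the bridge stays small
  have hmin : ∀ q : ℚ, min (q : ℝ).toNNReal t ∈ Iic t := fun q ↦ mem_Iic.2 (min_le_right _ _)
  set B : Set (Iic t → ℂ) := {f | ∀ q : ℚ, ‖f ⟨min (q : ℝ).toNNReal t, hmin q⟩‖ ≤ r} with hB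
  have hBm : MeasurableSet B := measurableSet_setOfPred.2 <| .forall fun q ↦
    measurableSet_setOfPred.1 (measurableSet_le (measurable_pi_apply _).norm measurable_const)
  let br : Ω → Iic t → ℂ := fun ω s ↦ W s ω - ((s / t : ℝ≥0) : ℝ) • W t ω
  have hbr : ∀ ω, br ω ∈ B → ∀ s ≤ t, ‖W s ω - ((s / t : ℝ≥0) : ℝ) • W t ω‖ ≤ r := by
    intro ω hω
    have hcont : Continuous fun s : ℝ≥0 ↦ W s ω - ((s / t : ℝ≥0) : ℝ) • W t ω := by
      have := hc ω
      fun_prop (disch := exact ht0.ne')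
    have := forall_rat_min_iff hcont (Metric.isClosed_closedBall (x := (0 : ℂ)) (ε := r)) t
    simp only [mem_closedBall_zero_iff] at this
    exact this.1 hω
  -- If the path stays within `r / 2` up to time `t`, its bridge stays within `r`.
  have hPB : P (br ⁻¹' B) ≠ 0 := by
    have hsub : {ω | ∀ s ≤ t, ‖W s ω‖ ≤ r / 2} ⊆ br ⁻¹' B := ?_
    · exact fun h0 ↦ hPt (measure_mono_null hsub h0)
    intro ω hω q
    have h1 := hω _ (min_le_right (q : ℝ).toNNReal t)
    have h2 := hω t le_rfl
    refine (norm_sub_le _ _).trans ?_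
    rw [norm_smul, Real.norm_of_nonneg (NNReal.coe_nonneg _)]
    have h3 : ((min (q : ℝ).toNNReal t / t : ℝ≥0) : ℝ) ≤ 1 := by
      exact_mod_cast div_le_one_of_le₀ (min_le_right _ _) zero_le
    nlinarith [norm_nonneg (W t ω)]
  set A := {z | x + z ∈ G ∩ Metric.ball x r} with hA
  have hAm : MeasurableSet A := (hGm.inter measurableSet_ball).preimage (by fun_prop)
  have hPA : P (W t ⁻¹' A) ≠ 0 :=
    h.measure_mem_ne_zero ht0 x (hGm.inter measurableSet_ball) hvol
  -- Independence of bridge and endpoint lets the path land in a prescribed set of positive area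
  -- while remaining within `2 * r` of `x`, hence inside `N`.
  have hPBA : P (br ⁻¹' B ∩ W t ⁻¹' A) ≠ 0 := by
    rw [(h.indepFun_bridge ht0).measure_inter_preimage_eq_mul _ _ hBm hAm]
    exact mul_ne_zero hPB hPA
  -- the Markov property at time `t`
  let past : Ω → Iic t → ℂ := fun ω s ↦ W s ω
  let fut : Ω → ℝ≥0 → ℂ := fun ω s ↦ W (t + s) ω - W t ω
  have hpast : Measurable past := measurable_pi_lambda _ fun s ↦ h.measurable _
  have hfut : Measurable fut := measurable_pi_lambda _ fun s ↦ (h.shift t).measurable _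
  let tt : Iic t := ⟨t, mem_Iic.2 le_rfl⟩
  let brp : (Iic t → ℂ) → Iic t → ℂ := fun f s ↦ f s - ((s / t : ℝ≥0) : ℝ) • f tt
  have hbrp : Measurable brp := measurable_pi_lambda _ fun s ↦ by fun_prop
  set F : Set (Iic t → ℂ) := brp ⁻¹' B ∩ (fun f ↦ f tt) ⁻¹' A with hF
  have hFm : MeasurableSet F := (hbrp hBm).inter (measurable_pi_apply tt hAm)
  set S : Set ((Iic t → ℂ) × (ℝ≥0 → ℂ)) :=
    {p | p.1 ∈ F ∧ (fun s ↦ (x + p.1 tt) + p.2 s) ∈ hitEvent C N} with hS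
  have hSm : MeasurableSet S := by
    refine (measurable_fst hFm).inter ?_
    have : Measurable fun (p : (Iic t → ℂ) × (ℝ≥0 → ℂ)) (s : ℝ≥0) ↦ (x + p.1 tt) + p.2 s := by
      fun_prop
    exact this (measurableSet_hitEvent C N)
  have hsub : (fun ω ↦ (past ω, fut ω)) ⁻¹' S ⊆ {ω | (fun s ↦ x + W s ω) ∈ hitEvent C N} := by
    rintro ω ⟨⟨hωB, hωA⟩, hω⟩
    have hcω := hc ω
    have hωB' := hbr ω hωB
    have hωA' : dist (x + W t ω) x < r := hωA.2
    rw [dist_eq_norm, add_sub_cancel_left] at hωA'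
    have e : (fun s ↦ x + past ω tt + fut ω s) = fun s ↦ x + W (t + s) ω := by
      ext s; simp only [past, fut, tt]; ring
    change (fun s ↦ x + past ω tt + fut ω s) ∈ hitEvent C N at hω
    rw [e, mem_hitEvent_iff hC hN (by fun_prop)] at hω
    obtain ⟨u, huC, huN⟩ := hω
    change (fun s ↦ x + W s ω) ∈ hitEvent C N
    rw [mem_hitEvent_iff hC hN (by fun_prop)]
    refine ⟨t + u, huC, fun s hs ↦ ?_⟩
    rcases le_total s t with hst | hst
    · refine hxN ?_
      rw [Metric.mem_ball, dist_eq_norm, add_sub_cancel_left]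
      have h1 := hωB' s hst
      have h2 : ‖((s / t : ℝ≥0) : ℝ) • W t ω‖ ≤ ‖W t ω‖ := by
        rw [norm_smul, Real.norm_of_nonneg (NNReal.coe_nonneg _)]
        refine mul_le_of_le_one_left (norm_nonneg _) ?_
        exact_mod_cast div_le_one_of_le₀ hst zero_le
      linarith [norm_sub_norm_le (W s ω) (((s / t : ℝ≥0) : ℝ) • W t ω)]
    · obtain ⟨v, rfl⟩ := exists_add_of_le hst
      exact huN v (le_of_add_le_add_left hs)
  intro hx0
  have hnull := measure_mono_null hsub hx0
  rw [← Measure.map_apply (hpast.prodMk hfut) hSm,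
    (indepFun_iff_map_prod_eq_prod_map_map hpast.aemeasurable hfut.aemeasurable).1
      (h.indepFun_shift t).symm, (h.shift t).map_eq h, Measure.measure_prod_null hSm] at hnull
  have hnull' : (P.map past) F = 0 := by
    rw [measure_eq_zero_iff_ae_notMem]
    filter_upwards [hnull] with f hf hfF
    refine hfF.2.1 ?_
    have e : Prod.mk f ⁻¹' S = (fun (g : ℝ≥0 → ℂ) (s : ℝ≥0) ↦ (x + f tt) + g s) ⁻¹' hitEvent C N := by
      ext g
      exact ⟨fun hg ↦ hg.2, fun hg ↦ ⟨hfF, hg⟩⟩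
    rw [e, Measure.map_apply (measurable_pi_lambda _ h.measurable)
      ((by fun_prop : Measurable fun (g : ℝ≥0 → ℂ) (s : ℝ≥0) ↦ (x + f tt) + g s)
        (measurableSet_hitEvent C N))] at hf
    exact hf
  rw [Measure.map_apply hpast hFm] at hnull'
  exact hPBA hnull'

/-- Started anywhere in a domain, planar Brownian motion hits a compact set carrying a measure of
finite logarithmic energy before leaving the domain, with positive probability. -/
theorem IsPlanarPreBrownian.hitProb_ne_zero (h : IsPlanarPreBrownian W P)
    (hc : ∀ ω, Continuous fun t ↦ W t ω) (h0 : ∀ ω, W 0 ω = 0) {C N : Set ℂ} (hC : IsCompact C)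
    (hN : IsOpen N) (hNc : IsPreconnected N) (hCN : C ⊆ N) {μ : Measure ℂ} [IsProbabilityMeasure μ]
    (hμ : μ Cᶜ = 0) (hfin : ∫⁻ a, ∫⁻ b, logKernel a b ∂μ ∂μ < ∞) {x : ℂ} (hx : x ∈ N) :
    hitProb W P C N x ≠ 0 := by
  set G := {y | hitProb W P C N y ≠ 0} with hG
  have hvol : volume G ≠ 0 := h.volume_hitProb_ne_zero hc h0 hC hN hCN hμ hfin
  have hGN : G ⊆ N := fun y hy ↦ mem_of_hitProb_ne_zero hc h0 hC.isClosed hN hy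
  obtain ⟨c, hcG, hcpos⟩ := exists_mem_forall_mem_nhdsWithin_pos_measure hvol
  -- `H` is the set of points near which `G` has positive area. By `hitProb_ne_zero_of_ball`, points
  -- of `N ∩ H` are interior to `G`. So `N` is covered by the disjoint open sets `interior G` and
  -- `Hᶜ`, and connectedness leaves only the first.
  let H := {y | ∀ ρ > 0, volume (G ∩ Metric.ball y ρ) ≠ 0}
  have hHint : ∀ y ∈ N, y ∈ H → y ∈ interior G := by
    intro y hyN hyH
    obtain ⟨ρ, hρ, hρN⟩ := Metric.isOpen_iff.1 hN y hyN
    refine mem_interior_iff_mem_nhds.2 (Filter.mem_of_superset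
      (Metric.ball_mem_nhds y (by positivity : 0 < ρ / 8)) fun z hz ↦ ?_)
    rw [Metric.mem_ball] at hz
    refine h.hitProb_ne_zero_of_ball hc h0 hC.isClosed hN (r := ρ / 4) (by positivity)
      (fun w hw ↦ hρN ?_) ?_
    · rw [Metric.mem_ball] at hw ⊢
      linarith [dist_triangle w z y]
    · refine fun h0 ↦ hyH (ρ / 8) (by positivity) (measure_mono_null (inter_subset_inter_right _
        fun w hw ↦ ?_) h0)
      rw [Metric.mem_ball] at hw ⊢
      linarith [dist_triangle w y z, dist_comm y z]
  have hopen : IsOpen Hᶜ := by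
    rw [Metric.isOpen_iff]
    intro y hy
    simp only [H, mem_compl_iff, mem_ofPred_eq, not_forall, not_not] at hy
    obtain ⟨ρ, hρ, hz⟩ := hy
    refine ⟨ρ / 2, half_pos hρ, fun w hw hwH ↦ hwH (ρ / 2) (half_pos hρ)
      (measure_mono_null (inter_subset_inter_right _ fun v hv ↦ ?_) hz)⟩
    rw [Metric.mem_ball] at hw hv ⊢
    linarith [dist_triangle v w y]
  have hintH : interior G ⊆ H := by
    intro y hy ρ hρ
    have : (interior G ∩ Metric.ball y ρ).Nonempty := ⟨y, hy, Metric.mem_ball_self hρ⟩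
    have hpos := (isOpen_interior.inter Metric.isOpen_ball).measure_pos volume this
    exact (hpos.trans_le (measure_mono (inter_subset_inter_left _ interior_subset))).ne'
  have hcH : c ∈ H := fun ρ hρ ↦ (hcpos _ (inter_mem self_mem_nhdsWithin
    (mem_nhdsWithin_of_mem_nhds (Metric.ball_mem_nhds c hρ)))).ne'
  have hsub : N ⊆ interior G := hNc.subset_left_of_subset_union isOpen_interior hopen
    (Set.disjoint_left.2 fun y hy hy' ↦ hy' (hintH hy))
    (fun y hy ↦ (em (y ∈ H)).imp (hHint y hy) id) ⟨c, hGN hcG, hHint c (hGN hcG) hcH⟩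
  exact interior_subset (hsub hx)

end Hitting

/-! ### Lévy's construction of Brownian motion from a Schauder series. -/

section Levy

/-- The tent function on the unit interval. -/
noncomputable def tent (x : ℝ) : ℝ := max 0 (min (2 * x) (2 - 2 * x))

/-- The covariance of the Brownian bridge, extended by zero. -/
noncomputable def bridgeCov (u v : ℝ) : ℝ := max 0 (min u v) * max 0 (1 - max u v)

theorem tent_nonneg (x : ℝ) : 0 ≤ tent x := le_max_left _ _

theorem continuous_tent : Continuous tent := by unfold tent; fun_prop

theorem tent_le_one (x : ℝ) : tent x ≤ 1 := by
  refine max_le zero_le_one ?_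
  rcases le_total (2 * x) (2 - 2 * x) with h | h
  · rw [min_eq_left h]; linarith
  · rw [min_eq_right h]; linarith

theorem tent_eq_zero_of_le {x : ℝ} (h : x ≤ 0) : tent x = 0 :=
  max_eq_left ((min_le_left _ _).trans (by linarith))

theorem tent_eq_zero_of_ge {x : ℝ} (h : 1 ≤ x) : tent x = 0 :=
  max_eq_left ((min_le_right _ _).trans (by linarith))

theorem tent_of_le_half {x : ℝ} (h0 : 0 ≤ x) (h : x ≤ 1 / 2) : tent x = 2 * x := by
  rw [tent, min_eq_left (by linarith), max_eq_right (by linarith)]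

theorem tent_of_half_le {x : ℝ} (h : 1 / 2 ≤ x) (h1 : x ≤ 1) : tent x = 2 - 2 * x := by
  rw [tent, min_eq_right (by linarith), max_eq_right (by linarith)]

theorem bridgeCov_comm (u v : ℝ) : bridgeCov u v = bridgeCov v u := by
  rw [bridgeCov, bridgeCov, min_comm u v, max_comm u v]

theorem bridgeCov_of_le_zero {u v : ℝ} (h : u ≤ v) (hu : u ≤ 0) : bridgeCov u v = 0 := by
  rw [bridgeCov, min_eq_left h, max_eq_left hu, zero_mul]

theorem bridgeCov_of_one_le {u v : ℝ} (h : u ≤ v) (hv : 1 ≤ v) : bridgeCov u v = 0 := by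
  rw [bridgeCov, max_eq_right h, max_eq_left (b := 1 - v) (by linarith), mul_zero]

theorem bridgeCov_of_mem {u v : ℝ} (h : u ≤ v) (hu : 0 ≤ u) (hv : v ≤ 1) :
    bridgeCov u v = u * (1 - v) := by
  rw [bridgeCov, min_eq_left h, max_eq_right h, max_eq_right hu, max_eq_right (by linarith)]

/-- The self-similarity of the covariance of the Brownian bridge. -/
theorem bridgeCov_eq (u v : ℝ) : bridgeCov u v = 1 / 4 * (tent u * tent v) +
    1 / 2 * (bridgeCov (2 * u) (2 * v) + bridgeCov (2 * u - 1) (2 * v - 1)) := by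
  wlog h : u ≤ v generalizing u v
  · rw [bridgeCov_comm, this v u (le_of_not_ge h), bridgeCov_comm (2 * v),
      bridgeCov_comm (2 * v - 1), mul_comm (tent v)]
  have h2 : 2 * u ≤ 2 * v := by linarith
  have h3 : 2 * u - 1 ≤ 2 * v - 1 := by linarith
  rcases le_total u 0 with hu | hu
  · rw [bridgeCov_of_le_zero h hu, tent_eq_zero_of_le hu, bridgeCov_of_le_zero h2 (by linarith),
      bridgeCov_of_le_zero h3 (by linarith)]
    ring
  rcases le_total 1 v with hv | hv
  · rw [bridgeCov_of_one_le h hv, tent_eq_zero_of_ge hv, bridgeCov_of_one_le h2 (by linarith),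
      bridgeCov_of_one_le h3 (by linarith)]
    ring
  rw [bridgeCov_of_mem h hu hv]
  rcases le_total v (1 / 2) with hv2 | hv2
  · rw [tent_of_le_half hu (h.trans hv2), tent_of_le_half (hu.trans h) hv2,
      bridgeCov_of_mem h2 (by linarith) (by linarith), bridgeCov_of_le_zero h3 (by linarith)]
    ring
  rcases le_total u (1 / 2) with hu2 | hu2
  · rw [tent_of_le_half hu hu2, tent_of_half_le hv2 hv,
      bridgeCov_of_one_le h2 (by linarith), bridgeCov_of_le_zero h3 (by linarith)]
    ring
  · rw [tent_of_half_le hu2 (h.trans hv), tent_of_half_le hv2 hv,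
      bridgeCov_of_one_le h2 (by linarith), bridgeCov_of_mem h3 (by linarith) (by linarith)]
    ring

theorem bridgeCov_nonneg (u v : ℝ) : 0 ≤ bridgeCov u v :=
  mul_nonneg (le_max_left _ _) (le_max_left _ _)

theorem bridgeCov_le_tent (u v : ℝ) : bridgeCov u v ≤ tent u := by
  rcases le_total u 0 with hu | hu
  · rw [tent_eq_zero_of_le hu, bridgeCov, max_eq_left ((min_le_left _ _).trans hu), zero_mul]
  rcases le_total 1 u with hu1 | hu1
  · rw [tent_eq_zero_of_ge hu1, bridgeCov,
      max_eq_left (a := 0) (b := 1 - max u v) (by linarith [le_max_left u v]), mul_zero]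
  have h1 : max 0 (min u v) ≤ u := max_le hu (min_le_left _ _)
  have h2 : max 0 (1 - max u v) ≤ 1 - u := max_le (by linarith) (by linarith [le_max_left u v])
  have h3 : bridgeCov u v ≤ u * (1 - u) := mul_le_mul h1 h2 (le_max_left _ _) hu
  rcases le_total u (1 / 2) with h | h
  · rw [tent_of_le_half hu h]; nlinarith
  · rw [tent_of_half_le h hu1]; nlinarith

/-- The integer translates of the tent live on disjoint open unit intervals, so at most one term is
nonzero. -/
theorem sum_tent_sub_le_one (K : ℕ) (x : ℝ) : ∑ k ∈ Finset.range K, tent (x - k) ≤ 1 := by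
  by_cases h : ∃ k ∈ Finset.range K, tent (x - k) ≠ 0
  · obtain ⟨k, hk, hne⟩ := h
    have hpos : ∀ j : ℕ, tent (x - j) ≠ 0 → (j : ℝ) < x ∧ x < j + 1 := fun j hj ↦
      ⟨by by_contra hc; exact hj (tent_eq_zero_of_le (by linarith)),
        by by_contra hc; exact hj (tent_eq_zero_of_ge (by linarith))⟩
    rw [Finset.sum_eq_single_of_mem k hk]
    · exact tent_le_one _
    · intro j _ hjk
      by_contra hj
      have h1 := hpos k hne
      have h2 := hpos j hj
      have h3 : (j : ℝ) < k + 1 := by linarith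
      have h4 : (k : ℝ) < j + 1 := by linarith
      norm_cast at h3 h4
      omega
  · push Not at h
    rw [Finset.sum_eq_zero h]
    exact zero_le_one

theorem sum_range_two_mul {M : Type*} [AddCommMonoid M] (f : ℕ → M) (K : ℕ) :
    ∑ j ∈ Finset.range (2 * K), f j = ∑ k ∈ Finset.range K, (f (2 * k) + f (2 * k + 1)) := by
  induction K with
  | zero => simp
  | succ K ih =>
    rw [Finset.sum_range_succ, ← ih, show 2 * (K + 1) = 2 * K + 1 + 1 by ring,
      Finset.sum_range_succ, Finset.sum_range_succ, add_assoc]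

/-- Iterates `bridgeCov_eq`: a bridge is its midpoint value (variance `1 / 4`) times a tent, plus
two independent bridges on the halves, each of half the variance. The remainder after `N` steps is
at most `(1 / 2) ^ N`. -/
theorem bridgeCov_eq_sum (N : ℕ) (u v : ℝ) : bridgeCov u v =
    ∑ n ∈ Finset.range N, ∑ k ∈ Finset.range (2 ^ n),
      1 / 4 * (1 / 2) ^ n * (tent (2 ^ n * u - k) * tent (2 ^ n * v - k)) +
    (1 / 2) ^ N * ∑ k ∈ Finset.range (2 ^ N), bridgeCov (2 ^ N * u - k) (2 ^ N * v - k) := by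
  induction N with
  | zero => simp
  | succ N ih =>
    rw [ih, Finset.sum_range_succ, add_assoc]
    congr 1
    rw [pow_succ' 2 N, sum_range_two_mul, Finset.mul_sum, Finset.mul_sum, ← Finset.sum_add_distrib]
    refine Finset.sum_congr rfl fun k _ ↦ ?_
    rw [bridgeCov_eq (2 ^ N * u - k)]
    push_cast
    rw [show 2 * (2 ^ N * u - k) = 2 * 2 ^ N * u - 2 * k by ring,
      show 2 * (2 ^ N * v - k) = 2 * 2 ^ N * v - 2 * k by ring, sub_sub, sub_sub]
    ring_nf

theorem tendsto_sum_tent (u v : ℝ) : Tendsto (fun N ↦ ∑ n ∈ Finset.range N,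
    ∑ k ∈ Finset.range (2 ^ n), 1 / 4 * (1 / 2 : ℝ) ^ n *
      (tent (2 ^ n * u - k) * tent (2 ^ n * v - k))) atTop (𝓝 (bridgeCov u v)) := by
  have h1 : Tendsto (fun N : ℕ ↦ (1 / 2 : ℝ) ^ N *
      ∑ k ∈ Finset.range (2 ^ N), bridgeCov (2 ^ N * u - k) (2 ^ N * v - k)) atTop (𝓝 0) := by
    refine squeeze_zero (fun N ↦ ?_) (fun N ↦ ?_)
      (tendsto_pow_atTop_nhds_zero_of_lt_one (r := (1 / 2 : ℝ)) (by norm_num) (by norm_num))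
    · exact mul_nonneg (by positivity) (Finset.sum_nonneg fun k _ ↦ bridgeCov_nonneg _ _)
    · refine mul_le_of_le_one_right (by positivity) ?_
      exact (Finset.sum_le_sum fun k _ ↦ bridgeCov_le_tent _ _).trans (sum_tent_sub_le_one _ _)
  have h2 := (tendsto_const_nhds (x := bridgeCov u v)).sub h1
  rw [sub_zero] at h2
  refine h2.congr fun N ↦ ?_
  rw [bridgeCov_eq_sum N u v]
  ring

variable {Ω : Type*} [MeasurableSpace Ω] {P : Measure Ω}

/-- A pointwise limit of centred Gaussian processes whose covariances converge to that of Brownian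
motion has the law of Brownian motion. -/
theorem isPreBrownianReal_of_tendsto {X : ℕ → ℝ≥0 → Ω → ℝ} {Y : ℝ≥0 → Ω → ℝ}
    (hX : ∀ n, IsGaussianProcess (X n) P) (hm : ∀ n t, Measurable (X n t))
    (h0 : ∀ n t, ∫ ω, X n t ω ∂P = 0)
    (hcov : ∀ s t, Tendsto (fun n ↦ cov[X n s, X n t; P]) atTop (𝓝 ((min s t : ℝ≥0) : ℝ)))
    (hlim : ∀ t, ∀ᵐ ω ∂P, Tendsto (fun n ↦ X n t ω) atTop (𝓝 (Y t ω))) :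
    IsPreBrownianReal Y P := by
  have := (hX 0).isProbabilityMeasure
  have hY : ∀ t, AEMeasurable (Y t) P := fun t ↦
    aemeasurable_of_tendsto_metrizable_ae atTop (fun n ↦ (hm n t).aemeasurable) (hlim t)
  refine ⟨fun I ↦ ⟨aemeasurable_pi_lambda _ fun t ↦ hY t, ?_⟩⟩
  have hYI : AEMeasurable (fun ω ↦ I.restrict (Y · ω)) P := aemeasurable_pi_lambda _ fun t ↦ hY t
  have hp : IsProbabilityMeasure (P.map fun ω ↦ I.restrict (Y · ω)) :=
    Measure.isProbabilityMeasure_map hYI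
  refine Measure.ext_of_charFunDual (funext fun L ↦ ?_)
  have hXI : ∀ n, Measurable (fun ω ↦ I.restrict (X n · ω)) := fun n ↦
    measurable_pi_lambda _ fun t ↦ hm n t
  obtain ⟨l, hL⟩ : ∃ l : I → ℝ, ∀ x : I → ℝ, L x = ∑ i, l i * x i := by
    refine ⟨fun i ↦ L (Pi.single i 1), fun x ↦ ?_⟩
    conv_lhs => rw [← Finset.univ_sum_single x]
    rw [map_sum]
    refine Finset.sum_congr rfl fun i _ ↦ ?_
    rw [mul_comm, ← smul_eq_mul, ← map_smul, ← Pi.single_smul, smul_eq_mul, mul_one]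
  -- The characteristic function of the limit is found in two ways: by dominated convergence here,
  -- and in `t2` from the Gaussian formula, where only the covariances depend on `n`.
  have t1 : Tendsto (fun n ↦ charFunDual (P.map fun ω ↦ I.restrict (X n · ω)) L) atTop
      (𝓝 (charFunDual (P.map fun ω ↦ I.restrict (Y · ω)) L)) := by
    simp_rw [charFunDual_apply]
    rw [integral_map hYI (by fun_prop)]
    have e : ∀ n, ∫ v, Complex.exp (L v * Complex.I) ∂(P.map fun ω ↦ I.restrict (X n · ω)) =
        ∫ ω, Complex.exp (L (I.restrict (X n · ω)) * Complex.I) ∂P := fun n ↦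
      integral_map (hXI n).aemeasurable (by fun_prop)
    simp_rw [e]
    refine tendsto_integral_of_dominated_convergence (fun _ ↦ 1) (fun n ↦ ?_) (integrable_const _)
      (fun n ↦ ae_of_all _ fun ω ↦ ?_) ?_
    · have := hXI n
      exact Measurable.aestronglyMeasurable (by fun_prop)
    · exact (Complex.norm_exp_ofReal_mul_I _).le
    · have : ∀ᵐ ω ∂P, ∀ i : I, Tendsto (fun n ↦ X n i ω) atTop (𝓝 (Y i ω)) :=
        ae_all_iff.2 fun i ↦ hlim i
      filter_upwards [this] with ω hω
      have h1 : Tendsto (fun n ↦ I.restrict (X n · ω)) atTop (𝓝 (I.restrict (Y · ω))) :=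
        tendsto_pi_nhds.2 hω
      have h2 : Continuous fun v ↦ Complex.exp (L v * Complex.I) := by fun_prop
      exact (h2.tendsto _).comp h1
  have hvarX : ∀ n, charFunDual (P.map fun ω ↦ I.restrict (X n · ω)) L =
      Complex.exp (-((∑ i : I, ∑ j : I, l i * (l j *
        cov[X n i, X n j; P]) : ℝ) : ℂ) / 2) := by
    intro n
    rw [((hX n).hasGaussianLaw I).charFunDual_map_eq_fun]
    simp_rw [hL]
    have hmem : ∀ i : I, MemLp (fun ω ↦ l i * X n i ω) 2 P := fun i ↦
      ((hX n).hasGaussianLaw_eval i).memLp_two.const_mul _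
    have e1 : ∫ ω, ∑ i : I, l i * X n i ω ∂P = 0 := by
      rw [integral_finsetSum _ fun i _ ↦ (hmem i).integrable one_le_two]
      refine Finset.sum_eq_zero fun i _ ↦ ?_
      rw [integral_const_mul, h0, mul_zero]
    have e2 : Var[fun ω ↦ ∑ i : I, l i * X n i ω; P] =
        ∑ i : I, ∑ j : I, l i * (l j * cov[X n i, X n j; P]) := by
      rw [← covariance_self (Finset.aemeasurable_fun_sum _ fun i _ ↦ (hmem i).aemeasurable)]
      rw [covariance_fun_sum_fun_sum hmem hmem]
      simp_rw [covariance_const_mul_left, covariance_const_mul_right]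
    simp only [Finset.restrict]
    rw [e1, e2]
    simp [neg_div]
  have t2 : Tendsto (fun n ↦ charFunDual (P.map fun ω ↦ I.restrict (X n · ω)) L) atTop
      (𝓝 (Complex.exp (-((∑ i : I, ∑ j : I, l i * (l j *
        ((min (i : ℝ≥0) j : ℝ≥0) : ℝ)) : ℝ) : ℂ) / 2))) := by
    simp_rw [hvarX]
    refine (Complex.continuous_exp.tendsto _).comp (Tendsto.div_const (Tendsto.neg ?_) 2)
    refine (Complex.continuous_ofReal.tendsto _).comp ?_
    exact tendsto_finsetSum _ fun i _ ↦ tendsto_finsetSum _ fun j _ ↦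
      ((hcov i j).const_mul _).const_mul _
  rw [tendsto_nhds_unique t1 t2]
  have hG : HasGaussianLaw (id : (I → ℝ) → I → ℝ) (BrownianReal.projectiveFamily I) :=
    IsGaussian.hasGaussianLaw_id
  have := hG.charFunDual_map_eq_fun L
  rw [Measure.map_id] at this
  rw [this]
  simp_rw [id, hL]
  have hmem : ∀ i : I, MemLp (fun x : I → ℝ ↦ l i * x i) 2
      (BrownianReal.projectiveFamily I) := fun i ↦ (hG.eval i).memLp_two.const_mul _
  rw [integral_finsetSum _ fun i _ ↦ (hmem i).integrable one_le_two]
  simp_rw [integral_const_mul, BrownianReal.integral_eval_projectiveFamily]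
  rw [← covariance_self (Finset.aemeasurable_fun_sum _ fun i _ ↦ (hmem i).aemeasurable),
    covariance_fun_sum_fun_sum hmem hmem]
  simp_rw [covariance_const_mul_left, covariance_const_mul_right,
    BrownianReal.covariance_eval_projectiveFamily]
  simp [neg_div]

/-- The index set of the Schauder functions: level and position. -/
abbrev SchauderIndex := (_ : ℕ) × ℕ

/-- Independent standard Gaussian coordinates. -/
noncomputable abbrev gaussianNoise : Measure (SchauderIndex → ℝ) :=
  Measure.infinitePi fun _ ↦ gaussianReal 0 1

/-- The Schauder functions, transported from the Brownian bridge on the unit interval. -/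
noncomputable def schauder (i : SchauderIndex) (t : ℝ≥0) : ℝ :=
  (1 + t) * (√(1 / 2) ^ i.1 / 2 * tent (2 ^ i.1 * (t / (1 + t)) - i.2))

/-- The Schauder indices of the first `N` levels. -/
def schauderLevels (N : ℕ) : Finset SchauderIndex :=
  (Finset.range N).sigma fun n ↦ Finset.range (2 ^ n)

noncomputable def levySum (N : ℕ) (t : ℝ≥0) (ω : SchauderIndex → ℝ) : ℝ :=
  ∑ i ∈ schauderLevels N, schauder i t * ω i

theorem isGaussianProcess_noise :
    IsGaussianProcess (fun i (ω : SchauderIndex → ℝ) ↦ ω i) gaussianNoise where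
  hasGaussianLaw I := by
    have h1 : iIndepFun (fun i (ω : SchauderIndex → ℝ) ↦ ω i) gaussianNoise :=
      iIndepFun_infinitePi (X := fun _ x ↦ x) fun _ ↦ measurable_id
    have h2 : iIndepFun (fun (i : I) (ω : SchauderIndex → ℝ) ↦ ω i) gaussianNoise :=
      h1.precomp Subtype.val_injective
    refine iIndepFun.hasGaussianLaw (fun i ↦ ?_) h2
    exact (measurePreserving_eval_infinitePi (fun _ ↦ gaussianReal 0 1) i.1).hasLaw.hasGaussianLaw

theorem memLp_noise (i : SchauderIndex) :
    MemLp (fun ω : SchauderIndex → ℝ ↦ ω i) 2 gaussianNoise :=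
  (isGaussianProcess_noise.hasGaussianLaw_eval i).memLp_two

theorem covariance_noise (i j : SchauderIndex) :
    cov[fun ω : SchauderIndex → ℝ ↦ ω i, fun ω ↦ ω j; gaussianNoise] = if i = j then 1 else 0 := by
  split_ifs with h
  · subst h
    rw [covariance_self (memLp_noise i).aemeasurable,
      (measurePreserving_eval_infinitePi (fun _ ↦ gaussianReal 0 1) i).hasLaw.variance_eq]
    simp
  · have h1 : iIndepFun (fun i (ω : SchauderIndex → ℝ) ↦ ω i) gaussianNoise :=
      iIndepFun_infinitePi (X := fun _ x ↦ x) fun _ ↦ measurable_id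
    exact (h1.indepFun h).covariance_eq_zero (memLp_noise i) (memLp_noise j)

theorem isGaussianProcess_levySum (N : ℕ) : IsGaussianProcess (levySum N) gaussianNoise := by
  refine isGaussianProcess_noise.of_isGaussianProcess fun t ↦ ⟨schauderLevels N,
    ∑ i : schauderLevels N, schauder i t • ContinuousLinearMap.proj (R := ℝ) (φ := fun _ ↦ ℝ) i,
    fun ω ↦ ?_⟩
  simp only [levySum, sum_apply, smul_apply,
    ContinuousLinearMap.proj_apply, smul_eq_mul, Finset.restrict]
  exact (Finset.sum_coe_sort (schauderLevels N) fun i ↦ schauder i t * ω i).symm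

theorem integral_levySum (N : ℕ) (t : ℝ≥0) : ∫ ω, levySum N t ω ∂gaussianNoise = 0 := by
  simp only [levySum]
  rw [integral_finsetSum _ fun i _ ↦ ((memLp_noise i).const_mul _).integrable one_le_two]
  refine Finset.sum_eq_zero fun i _ ↦ ?_
  rw [integral_const_mul,
    (measurePreserving_eval_infinitePi (fun _ ↦ gaussianReal 0 1) i).hasLaw.integral_eq]
  simp

theorem covariance_levySum (N : ℕ) (s t : ℝ≥0) :
    cov[levySum N s, levySum N t; gaussianNoise] = (1 + s) * (1 + t) * ∑ n ∈ Finset.range N,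
      ∑ k ∈ Finset.range (2 ^ n), 1 / 4 * (1 / 2 : ℝ) ^ n *
        (tent (2 ^ n * (s / (1 + s)) - k) * tent (2 ^ n * (t / (1 + t)) - k)) := by
  have h : cov[levySum N s, levySum N t; gaussianNoise] =
      ∑ i ∈ schauderLevels N, schauder i s * schauder i t := by
    unfold levySum
    rw [covariance_fun_sum_fun_sum' (fun i _ ↦ (memLp_noise i).const_mul _)
      (fun i _ ↦ (memLp_noise i).const_mul _)]
    refine Finset.sum_congr rfl fun i hi ↦ ?_
    simp_rw [covariance_const_mul_left, covariance_const_mul_right, covariance_noise]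
    simp [hi]
  rw [h, schauderLevels, Finset.sum_sigma, Finset.mul_sum]
  refine Finset.sum_congr rfl fun n _ ↦ ?_
  rw [Finset.mul_sum]
  refine Finset.sum_congr rfl fun k _ ↦ ?_
  have hs : √(1 / 2 : ℝ) ^ n * √(1 / 2 : ℝ) ^ n = (1 / 2) ^ n := by
    rw [← mul_pow, Real.mul_self_sqrt (by norm_num)]
  simp only [schauder]
  linear_combination (1 + (s : ℝ)) * (1 + t) * (1 / 4) * tent (2 ^ n * (s / (1 + s)) - k) *
    tent (2 ^ n * (t / (1 + t)) - k) * hs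

/-- If `B` is a bridge on the unit interval, then `(1 + t) * B (t / (1 + t))` is Brownian motion on
the whole half-line. This explains the time change in `schauder`. -/
theorem mul_bridgeCov_eq_min (s t : ℝ≥0) : (1 + s) * (1 + t) *
    bridgeCov (s / (1 + s)) (t / (1 + t)) = ((min s t : ℝ≥0) : ℝ) := by
  wlog h : s ≤ t generalizing s t
  · rw [bridgeCov_comm, mul_comm (1 + (s : ℝ)), this t s (le_of_not_ge h), min_comm]
  have hst : (s : ℝ) ≤ t := h
  have hs : (0 : ℝ) ≤ s := s.2
  rw [min_eq_left h, bridgeCov_of_mem]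
  · field_simp
    ring
  · rw [div_le_div_iff₀ (by positivity) (by positivity)]
    nlinarith
  · positivity
  · rw [div_le_one (by positivity)]
    linarith

theorem tendsto_covariance_levySum (s t : ℝ≥0) :
    Tendsto (fun N ↦ cov[levySum N s, levySum N t; gaussianNoise]) atTop
      (𝓝 ((min s t : ℝ≥0) : ℝ)) := by
  simp_rw [covariance_levySum]
  rw [← mul_bridgeCov_eq_min]
  exact (tendsto_sum_tent _ _).const_mul _

/-- A weighted fourth moment of the noise at level `n`, which controls the size of the level. -/
noncomputable def levelMoment (n : ℕ) (ω : SchauderIndex → ℝ) : ℝ :=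
  ∑ k ∈ Finset.range (2 ^ n), ((3 / 4) ^ n * ω ⟨n, k⟩) ^ 4

theorem levelMoment_nonneg (n : ℕ) (ω : SchauderIndex → ℝ) : 0 ≤ levelMoment n ω :=
  Finset.sum_nonneg fun _ _ ↦ by positivity

@[fun_prop]
theorem measurable_levelMoment (n : ℕ) : Measurable (levelMoment n) := by
  unfold levelMoment; fun_prop

/-- The noise for which the Lévy series converges. -/
def goodNoise : Set (SchauderIndex → ℝ) := {ω | ∑' n, ENNReal.ofReal (levelMoment n ω) < ∞}

theorem measurableSet_goodNoise : MeasurableSet goodNoise :=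
  measurableSet_lt (Measurable.tsum fun n ↦ by fun_prop) measurable_const

/-- The expected level moments are geometric of ratio `2 * (3 / 4) ^ 4 < 1`. The weight `3 / 4` must
lie below `2 ^ (-1 / 4)` for this, and above `√(1 / 2)` for the convergence of the series in
`exists_summable_bound`. -/
theorem ae_goodNoise : ∀ᵐ ω ∂gaussianNoise, ω ∈ goodNoise := by
  refine ae_lt_top (Measurable.tsum fun n ↦ by fun_prop) ?_
  rw [lintegral_tsum fun n ↦ by fun_prop]
  have hint : Integrable (fun x : ℝ ↦ x ^ 4) (gaussianReal 0 1) := by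
    have := (memLp_id_gaussianReal (μ := 0) (v := 1) 4).integrable_norm_pow (by norm_num)
    refine this.congr (ae_of_all _ fun x ↦ ?_)
    simp [Even.pow_abs (by decide : Even 4)]
  set M := ∫ x : ℝ, x ^ 4 ∂gaussianReal 0 1 with hM
  have hM0 : 0 ≤ M := integral_nonneg fun x ↦ by positivity
  have hmp := fun i : SchauderIndex ↦
    measurePreserving_eval_infinitePi (fun _ : SchauderIndex ↦ gaussianReal 0 1) i
  have hint' : ∀ i : SchauderIndex, Integrable (fun ω : SchauderIndex → ℝ ↦ ω i ^ 4)
      gaussianNoise := fun i ↦ (hmp i).integrable_comp_of_integrable hint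
  have hterm : ∀ n, ∫⁻ ω, ENNReal.ofReal (levelMoment n ω) ∂gaussianNoise =
      ENNReal.ofReal (M * (2 * (3 / 4) ^ 4) ^ n) := by
    intro n
    have hi : Integrable (levelMoment n) gaussianNoise := by
      unfold levelMoment
      simp_rw [mul_pow]
      exact integrable_finsetSum _ fun k _ ↦ (hint' _).const_mul _
    rw [← ofReal_integral_eq_lintegral_ofReal hi (ae_of_all _ fun ω ↦ levelMoment_nonneg n ω)]
    congr 1
    unfold levelMoment
    simp_rw [mul_pow]
    rw [integral_finsetSum _ fun k _ ↦ (hint' _).const_mul _]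
    have e : ∀ k : ℕ, ∫ ω : SchauderIndex → ℝ, ω ⟨n, k⟩ ^ 4 ∂gaussianNoise = M := fun k ↦
      (hmp ⟨n, k⟩).hasLaw.integral_comp (f := fun x ↦ x ^ 4) (by fun_prop)
    simp_rw [integral_const_mul, e]
    rw [Finset.sum_const, Finset.card_range, nsmul_eq_mul]
    push_cast
    rw [← pow_mul, ← pow_mul]
    ring
  simp_rw [hterm]
  have hs : Summable fun n : ℕ ↦ M * (2 * (3 / 4 : ℝ) ^ 4) ^ n :=
    (summable_geometric_of_lt_one (by norm_num) (by norm_num)).mul_left M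
  rw [← ENNReal.ofReal_tsum_of_nonneg (fun n ↦ by positivity) hs]
  exact ENNReal.ofReal_ne_top

/-- The contribution of level `n`, as a function on the unit interval. -/
noncomputable def levyTerm (n : ℕ) (ω : SchauderIndex → ℝ) (u : ℝ) : ℝ :=
  ∑ k ∈ Finset.range (2 ^ n), √(1 / 2) ^ n / 2 * tent (2 ^ n * u - k) * ω ⟨n, k⟩

theorem levySum_eq (N : ℕ) (t : ℝ≥0) (ω : SchauderIndex → ℝ) :
    levySum N t ω = (1 + t) * ∑ n ∈ Finset.range N, levyTerm n ω (t / (1 + t)) := by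
  rw [levySum, schauderLevels, Finset.sum_sigma, Finset.mul_sum]
  refine Finset.sum_congr rfl fun n _ ↦ ?_
  rw [levyTerm, Finset.mul_sum]
  refine Finset.sum_congr rfl fun k _ ↦ ?_
  simp only [schauder]
  ring

/-- At most one tent of the level is nonzero at `u`, so the level is bounded by its largest
coefficient. That coefficient is controlled through `|x| ≤ 1 + x ^ 4` by the fourth moment of the
level. -/
theorem abs_levyTerm_le (n : ℕ) (ω : SchauderIndex → ℝ) (u : ℝ) :
    |levyTerm n ω u| ≤ (√(1 / 2) / (3 / 4)) ^ n * (1 + levelMoment n ω) := by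
  have hk : ∀ k ∈ Finset.range (2 ^ n), √(1 / 2) ^ n * |ω ⟨n, k⟩| ≤
      (√(1 / 2) / (3 / 4)) ^ n * (1 + levelMoment n ω) := by
    intro k hk
    set x := (3 / 4 : ℝ) ^ n * ω ⟨n, k⟩ with hx
    have h1 : |x| ≤ 1 + x ^ 4 := by
      rw [← Even.pow_abs (by decide : Even 4) x]
      nlinarith [sq_nonneg (|x| ^ 2 - 1), sq_nonneg (|x| - 1), abs_nonneg x]
    have h2 : x ^ 4 ≤ levelMoment n ω :=
      Finset.single_le_sum (f := fun k ↦ ((3 / 4 : ℝ) ^ n * ω ⟨n, k⟩) ^ 4)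
        (fun _ _ ↦ by positivity) hk
    have h3 : √(1 / 2) ^ n * |ω ⟨n, k⟩| = (√(1 / 2) / (3 / 4)) ^ n * |x| := by
      rw [hx, abs_mul, abs_of_pos (by positivity : (0 : ℝ) < (3 / 4) ^ n), div_pow]
      field_simp
    rw [h3]
    gcongr
    linarith
  calc |levyTerm n ω u| ≤ ∑ k ∈ Finset.range (2 ^ n),
        |√(1 / 2) ^ n / 2 * tent (2 ^ n * u - k) * ω ⟨n, k⟩| := Finset.abs_sum_le_sum_abs _ _
    _ ≤ ∑ k ∈ Finset.range (2 ^ n), tent (2 ^ n * u - k) *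
        ((√(1 / 2) / (3 / 4)) ^ n * (1 + levelMoment n ω)) := by
      refine Finset.sum_le_sum fun k hk' ↦ ?_
      rw [abs_mul, abs_mul, abs_of_nonneg (tent_nonneg _),
        abs_of_nonneg (by positivity : 0 ≤ √(1 / 2 : ℝ) ^ n / 2)]
      have h := hk k hk'
      have h0 := tent_nonneg (2 ^ n * u - k)
      have h1 : 0 ≤ √(1 / 2 : ℝ) ^ n * |ω ⟨n, k⟩| := by positivity
      calc _ = tent (2 ^ n * u - k) * (√(1 / 2) ^ n * |ω ⟨n, k⟩| / 2) := by ring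
        _ ≤ _ := by gcongr; linarith
    _ = (∑ k ∈ Finset.range (2 ^ n), tent (2 ^ n * u - k)) *
        ((√(1 / 2) / (3 / 4)) ^ n * (1 + levelMoment n ω)) := by rw [Finset.sum_mul]
    _ ≤ 1 * ((√(1 / 2) / (3 / 4)) ^ n * (1 + levelMoment n ω)) := by
      have := levelMoment_nonneg n ω
      gcongr
      exact sum_tent_sub_le_one _ _
    _ = _ := one_mul _

theorem exists_summable_bound {ω : SchauderIndex → ℝ} (hω : ω ∈ goodNoise) :
    ∃ b : ℕ → ℝ, Summable b ∧ ∀ n u, ‖levyTerm n ω u‖ ≤ b n := by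
  set S := ∑' n, ENNReal.ofReal (levelMoment n ω) with hS
  have hS' : S ≠ ∞ := ne_of_lt hω
  have hle : ∀ n, levelMoment n ω ≤ S.toReal := fun n ↦ by
    rw [← ENNReal.toReal_ofReal (levelMoment_nonneg n ω)]
    exact ENNReal.toReal_mono hS' (ENNReal.le_tsum n)
  have hlt : √(1 / 2 : ℝ) / (3 / 4) < 1 := by
    rw [div_lt_one (by norm_num), Real.sqrt_lt' (by norm_num)]
    norm_num
  refine ⟨fun n ↦ (√(1 / 2) / (3 / 4)) ^ n * (1 + S.toReal),
    (summable_geometric_of_lt_one (by positivity) hlt).mul_right _, fun n u ↦ ?_⟩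
  refine (abs_levyTerm_le n ω u).trans ?_
  exact mul_le_mul_of_nonneg_left (by linarith [hle n]) (by positivity)

open Classical in
/-- Lévy's construction of Brownian motion. -/
noncomputable def levyProcess (t : ℝ≥0) (ω : SchauderIndex → ℝ) : ℝ :=
  if ω ∈ goodNoise then (1 + t) * ∑' n, levyTerm n ω (t / (1 + t)) else 0

theorem continuous_levyProcess (ω : SchauderIndex → ℝ) : Continuous fun t ↦ levyProcess t ω := by
  unfold levyProcess
  split_ifs with hω
  · obtain ⟨b, hb, hle⟩ := exists_summable_bound hω
    have h1 : Continuous fun u ↦ ∑' n, levyTerm n ω u := by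
      refine continuous_tsum (fun n ↦ ?_) hb hle
      unfold levyTerm
      have := continuous_tent
      fun_prop
    have h2 : Continuous fun t : ℝ≥0 ↦ (t / (1 + t) : ℝ) := by
      refine Continuous.div (by fun_prop) (by fun_prop) fun t ↦ ?_
      positivity
    have h3 : Continuous fun t : ℝ≥0 ↦ (1 + t : ℝ) := by fun_prop
    exact h3.mul (h1.comp h2)
  · exact continuous_const

theorem levyProcess_zero (ω : SchauderIndex → ℝ) : levyProcess 0 ω = 0 := by
  unfold levyProcess
  split_ifs
  · have : ∀ n, levyTerm n ω 0 = 0 := fun n ↦ Finset.sum_eq_zero fun k _ ↦ by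
      rw [mul_zero, zero_sub, tent_eq_zero_of_le (by simp)]
      ring
    simp [this]
  · rfl

theorem tendsto_levySum {ω : SchauderIndex → ℝ} (hω : ω ∈ goodNoise) (t : ℝ≥0) :
    Tendsto (fun N ↦ levySum N t ω) atTop (𝓝 (levyProcess t ω)) := by
  obtain ⟨b, hb, hle⟩ := exists_summable_bound hω
  simp_rw [levySum_eq]
  rw [levyProcess, if_pos hω]
  exact (Summable.of_norm_bounded hb fun n ↦ hle n _).hasSum.tendsto_sum_nat.const_mul _

theorem measurable_levySum (N : ℕ) (t : ℝ≥0) : Measurable (levySum N t) := by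
  unfold levySum; fun_prop

theorem measurable_levyProcess (t : ℝ≥0) : Measurable (levyProcess t) := by
  classical
  refine measurable_of_tendsto_metrizable
    (f := fun N ω ↦ if ω ∈ goodNoise then levySum N t ω else 0)
    (fun N ↦ (measurable_levySum N t).ite measurableSet_goodNoise measurable_const) ?_
  refine tendsto_pi_nhds.2 fun ω ↦ ?_
  by_cases hω : ω ∈ goodNoise
  · simpa [hω] using tendsto_levySum hω t
  · simp [hω, levyProcess]

theorem isPreBrownianReal_levyProcess : IsPreBrownianReal levyProcess gaussianNoise :=
  isPreBrownianReal_of_tendsto isGaussianProcess_levySum measurable_levySum integral_levySum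
    tendsto_covariance_levySum fun t ↦ by
      filter_upwards [ae_goodNoise] with ω hω using tendsto_levySum hω t

/-- Existence of planar Brownian motion, with all paths continuous and started at the origin. -/
theorem exists_isPlanarPreBrownian : ∃ (Ω : Type) (_ : MeasurableSpace Ω) (P : Measure Ω)
    (W : ℝ≥0 → Ω → ℂ), IsPlanarPreBrownian W P ∧ (∀ ω, Continuous fun t ↦ W t ω) ∧
      ∀ ω, W 0 ω = 0 := by
  refine ⟨(SchauderIndex → ℝ) × (SchauderIndex → ℝ), Prod.instMeasurableSpace,
    gaussianNoise.prod gaussianNoise,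
    fun t ω ↦ levyProcess t ω.1 + levyProcess t ω.2 * Complex.I, ?_, fun ω ↦ ?_, fun ω ↦ ?_⟩
  · have hm := measurable_levyProcess
    refine .of_indep (fun t ↦ ?_) ⟨fun I ↦ ?_⟩ ⟨fun I ↦ ?_⟩ ?_
    · have := hm t
      fun_prop
    · simpa [Function.comp_def] using
        (isPreBrownianReal_levyProcess.hasLaw I).comp measurePreserving_fst.hasLaw
    · simpa [Function.comp_def] using
        (isPreBrownianReal_levyProcess.hasLaw I).comp measurePreserving_snd.hasLaw
    · have hm' : Measurable fun (ω : SchauderIndex → ℝ) (t : ℝ≥0) ↦ levyProcess t ω :=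
        measurable_pi_lambda _ hm
      simpa using indepFun_prod (μ := gaussianNoise) (ν := gaussianNoise) hm' hm'
  · have := continuous_levyProcess ω.1
    have := continuous_levyProcess ω.2
    fun_prop
  · simp [levyProcess_zero]

end Levy

/-! ### Invariance of the law when increments after a stopping time are transformed by an isometry.
-/

section Reflection

variable {Ω : Type*}

/-- The path `w`, with its increments after time `r` transformed by `L`. -/
noncomputable def reflectAt (L : ℂ ≃ₗᵢ[ℝ] ℂ) (w : ℝ≥0 → ℂ) (r : ℝ≥0∞) (t : ℝ≥0) : ℂ :=
  w (min r t).toNNReal + L (w t - w (min r t).toNNReal)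

theorem reflectAt_of_le (L : ℂ ≃ₗᵢ[ℝ] ℂ) (w : ℝ≥0 → ℂ) {r : ℝ≥0∞} {t : ℝ≥0} (h : t ≤ r) :
    reflectAt L w r t = w t := by
  simp [reflectAt, min_eq_right h]

theorem reflectAt_of_ge (L : ℂ ≃ₗᵢ[ℝ] ℂ) (w : ℝ≥0 → ℂ) {r t : ℝ≥0} (h : r ≤ t) :
    reflectAt L w r t = w r + L (w t - w r) := by
  simp [reflectAt, min_eq_left (ENNReal.coe_le_coe.2 h)]

theorem continuous_min_toNNReal :
    Continuous fun x : ℝ≥0∞ × ℝ≥0 ↦ (min x.1 x.2).toNNReal := by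
  have h : Continuous fun x : ℝ≥0∞ × ℝ≥0 ↦ min x.1 (x.2 : ℝ≥0∞) :=
    continuous_fst.min (ENNReal.continuous_coe.comp continuous_snd)
  refine continuous_iff_continuousAt.2 fun x ↦ ?_
  exact ContinuousAt.comp (f := fun x : ℝ≥0∞ × ℝ≥0 ↦ min x.1 (x.2 : ℝ≥0∞))
    (ENNReal.tendsto_toNNReal (by simp)) h.continuousAt

theorem continuous_reflectAt (L : ℂ ≃ₗᵢ[ℝ] ℂ) {w : ℝ≥0 → ℂ} (hw : Continuous w) :
    Continuous fun x : ℝ≥0∞ × ℝ≥0 ↦ reflectAt L w x.1 x.2 := by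
  have h := hw.comp continuous_min_toNNReal
  exact h.add (L.continuous.comp ((hw.comp continuous_snd).sub h))

theorem continuous_reflectAt_right (L : ℂ ≃ₗᵢ[ℝ] ℂ) {w : ℝ≥0 → ℂ} (hw : Continuous w) (r : ℝ≥0∞) :
    Continuous (reflectAt L w r) := by
  have h1 : Continuous fun t : ℝ≥0 ↦ (r, t) := by fun_prop
  exact (continuous_reflectAt L hw).comp h1

theorem tendsto_reflectAt (L : ℂ ≃ₗᵢ[ℝ] ℂ) {w : ℝ≥0 → ℂ} (hw : Continuous w) {u : ℕ → ℝ≥0∞}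
    {r : ℝ≥0∞} (hu : Tendsto u atTop (𝓝 r)) (t : ℝ≥0) :
    Tendsto (fun n ↦ reflectAt L w (u n) t) atTop (𝓝 (reflectAt L w r t)) := by
  have h1 : Tendsto (fun n ↦ (u n, t)) atTop (𝓝 (r, t)) := hu.prodMk_nhds tendsto_const_nhds
  exact ((continuous_reflectAt L hw).tendsto (r, t)).comp h1

/-- The σ-algebra generated by the process `W` up to time `r`. -/
@[reducible]
noncomputable def past (W : ℝ≥0 → Ω → ℂ) (r : ℝ≥0) : MeasurableSpace Ω :=
  MeasurableSpace.comap (fun ω (t : Iic r) ↦ W t ω) MeasurableSpace.pi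

theorem measurable_past (W : ℝ≥0 → Ω → ℂ) {r t : ℝ≥0} (h : t ≤ r) : Measurable[past W r] (W t) := by
  have h1 : Measurable[past W r] (fun ω (t : Iic r) ↦ W t ω) := comap_measurable _
  exact (measurable_pi_apply (⟨t, h⟩ : Iic r)).comp h1

theorem past_mono (W : ℝ≥0 → Ω → ℂ) {r t : ℝ≥0} (h : t ≤ r) : past W t ≤ past W r :=
  Measurable.comap_le (m₁ := past W r) <| @measurable_pi_lambda _ _ _ (past W r) _ _
    fun s ↦ measurable_past W (s.2.trans h)

/-- The index of the first time `≥ T` in the grid of width `1 / (n + 1)`, see `gridTime`. -/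
noncomputable def gridIndex (n : ℕ) (T : ℝ≥0∞) : ℕ :=
  if T = ∞ then 0 else ⌈(n + 1) * T.toNNReal⌉₊ + 1

/-- The time of index `k` in the grid of width `1 / (n + 1)`. -/
noncomputable def gridTime (n : ℕ) : ℕ → ℝ≥0∞
  | 0 => ∞
  | k + 1 => ((k / (n + 1) : ℝ≥0) : ℝ≥0∞)

/-- The grid time exceeds a finite `T` by at most `1 / (n + 1)`. Index `0` is reserved for `T = ∞`,
so finite times have indices shifted by one. -/
theorem tendsto_gridTime (T : ℝ≥0∞) :
    Tendsto (fun n ↦ gridTime n (gridIndex n T)) atTop (𝓝 T) := by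
  induction T with
  | top => simp [gridIndex, gridTime]
  | coe T =>
    simp only [gridIndex, gridTime, ENNReal.coe_ne_top, if_false, ENNReal.toNNReal_coe,
      ENNReal.tendsto_coe]
    have h1 : Tendsto (fun n : ℕ ↦ T + 1 / ((n : ℝ≥0) + 1)) atTop (𝓝 (T + 0)) :=
      tendsto_const_nhds.add (tendsto_one_div_add_atTop_nhds_zero_nat (𝕜 := ℝ≥0))
    rw [add_zero] at h1
    refine tendsto_of_tendsto_of_tendsto_of_le_of_le tendsto_const_nhds h1 (fun n ↦ ?_) fun n ↦ ?_
    · show T ≤ _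
      rw [le_div_iff₀ (by positivity), mul_comm]
      exact Nat.le_ceil _
    · show _ ≤ T + 1 / ((n : ℝ≥0) + 1)
      rw [div_le_iff₀ (by positivity), add_mul T, one_div,
        inv_mul_cancel₀ (by positivity : (n : ℝ≥0) + 1 ≠ 0), mul_comm T]
      exact (Nat.ceil_lt_add_one zero_le).le

/-- Rounding up is what keeps the discretised time a stopping time: the event is `T` being at most
the current grid point but above all earlier ones. -/
theorem measurableSet_gridIndex {T : Ω → ℝ≥0∞} {m : ℝ≥0 → MeasurableSpace Ω} (hm : Monotone m)
    (hT : ∀ r : ℝ≥0, MeasurableSet[m r] {ω | T ω ≤ r}) (n k : ℕ) :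
    MeasurableSet[m (k / (n + 1))] ((fun ω ↦ gridIndex n (T ω)) ⁻¹' {k + 1}) := by
  have key : ∀ j : ℕ, {ω | T ω ≤ ((j / (n + 1) : ℝ≥0) : ℝ≥0∞)} =
      {ω | T ω ≠ ∞ ∧ ⌈(n + 1) * (T ω).toNNReal⌉₊ ≤ j} := fun j ↦ by
    ext ω
    simp only [mem_ofPred_eq]
    induction T ω with
    | top => exact iff_of_false (by rw [top_le_iff]; exact ENNReal.coe_ne_top) (by simp)
    | coe t =>
      simp only [ENNReal.coe_le_coe, ne_eq, ENNReal.coe_ne_top, not_false_eq_true, true_and,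
        ENNReal.toNNReal_coe, Nat.ceil_le]
      rw [le_div_iff₀ (by positivity), mul_comm]
  have e : (fun ω ↦ gridIndex n (T ω)) ⁻¹' {k + 1} =
      {ω | T ω ≤ ((k / (n + 1) : ℝ≥0) : ℝ≥0∞)} \
        ⋃ j ∈ {j : ℕ | j < k}, {ω | T ω ≤ ((j / (n + 1) : ℝ≥0) : ℝ≥0∞)} := by
    simp_rw [key]
    ext ω
    simp only [gridIndex, mem_preimage, mem_singleton_iff, Set.mem_sdiff, mem_ofPred_eq, mem_iUnion,
      exists_prop, not_exists, not_and, not_le]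
    by_cases h : T ω = ∞
    · simp [h]
    · simp only [h, if_false, Nat.add_right_cancel_iff, ne_eq, not_false_eq_true, true_and,
        forall_const]
      constructor
      · rintro rfl
        exact ⟨le_rfl, fun j hj ↦ hj⟩
      · rintro ⟨h1, h2⟩
        by_contra hne
        exact lt_irrefl _ (h2 _ (lt_of_le_of_ne h1 hne))
  rw [e]
  refine (hT _).diff (MeasurableSet.biUnion (to_countable _) fun j hj ↦ hm ?_ _ (hT _))
  have : (j : ℝ≥0) ≤ k := by exact_mod_cast (le_of_lt hj)
  gcongr

variable [MeasurableSpace Ω] {P : Measure Ω} {W : ℝ≥0 → Ω → ℂ}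

theorem past_le (hW : ∀ t, Measurable (W t)) (r : ℝ≥0) : past W r ≤ ‹MeasurableSpace Ω› :=
  Measurable.comap_le <| measurable_pi_lambda _ fun s ↦ hW s

/-- The increments after the fixed time `r` are independent of the past and their law is invariant
under `L`, so replacing them by their `L`-images does not change their joint law with the past. The
map `G` glues past and increments back into a path. -/
theorem IsPlanarPreBrownian.measure_reflectAt_inter (h : IsPlanarPreBrownian W P)
    (L : ℂ ≃ₗᵢ[ℝ] ℂ) (r : ℝ≥0) {A : Set Ω} (hA : MeasurableSet[past W r] A) {B : Set (ℝ≥0 → ℂ)}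
    (hB : MeasurableSet B) :
    P ((fun ω ↦ reflectAt L (fun t ↦ W t ω) r) ⁻¹' B ∩ A) =
      P ((fun ω t ↦ W t ω) ⁻¹' B ∩ A) := by
  have := h.isProbabilityMeasure
  obtain ⟨A', hA', rfl⟩ := hA
  let V : Ω → ℝ≥0 → ℂ := fun ω t ↦ W (r + t) ω - W r ω
  let X : Ω → Iic r → ℂ := fun ω t ↦ W t ω
  let G : (ℝ≥0 → ℂ) × (Iic r → ℂ) → ℝ≥0 → ℂ := fun x t ↦
    if ht : t ≤ r then x.2 ⟨t, ht⟩ else x.2 ⟨r, mem_Iic.2 le_rfl⟩ + x.1 (t - r)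
  have hG : Measurable G := measurable_pi_lambda _ fun t ↦ by
    by_cases ht : t ≤ r
    · simp only [G, ht, dite_true]
      fun_prop
    · simp only [G, ht, dite_false]
      fun_prop
  have hV : Measurable V := measurable_pi_lambda _ (h.shift r).measurable
  have hX : Measurable X := measurable_pi_lambda _ fun t ↦ h.measurable t
  let V' : Ω → ℝ≥0 → ℂ := fun ω t ↦ L (V ω t)
  have hL : Measurable fun (v : ℝ≥0 → ℂ) t ↦ L (v t) := measurable_pi_lambda _ fun t ↦
    L.continuous.measurable.comp (measurable_pi_apply t)
  have hV' : Measurable V' := hL.comp hV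
  have hind : IndepFun V X P := h.indepFun_shift r
  have hind' : IndepFun V' X P := hind.comp hL measurable_id
  have e : P.map (fun ω ↦ (V' ω, X ω)) = P.map (fun ω ↦ (V ω, X ω)) := by
    rw [(indepFun_iff_map_prod_eq_prod_map_map hV.aemeasurable hX.aemeasurable).1 hind,
      (indepFun_iff_map_prod_eq_prod_map_map hV'.aemeasurable hX.aemeasurable).1 hind']
    congr 1
    exact ((h.shift r).isometry L).map_eq (h.shift r)
  have hS : MeasurableSet (G ⁻¹' B ∩ Prod.snd ⁻¹' A') := (hG hB).inter (measurable_snd hA')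
  have e1 : ∀ ω, G (V ω, X ω) = fun t ↦ W t ω := fun ω ↦ by
    funext t
    by_cases ht : t ≤ r
    · simp [G, X, ht]
    · simp [G, X, V, ht, add_tsub_cancel_of_le (le_of_not_ge ht)]
  have e2 : ∀ ω, G (V' ω, X ω) = reflectAt L (fun t ↦ W t ω) r := fun ω ↦ by
    funext t
    by_cases ht : t ≤ r
    · simp [G, X, ht, reflectAt_of_le L _ (ENNReal.coe_le_coe.2 ht)]
    · simp [G, X, V', V, ht, add_tsub_cancel_of_le (le_of_not_ge ht),
        reflectAt_of_ge L _ (le_of_not_ge ht)]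
  have := congrArg (fun μ ↦ μ (G ⁻¹' B ∩ Prod.snd ⁻¹' A')) e
  simp only [Measure.map_apply (hV.prodMk hX) hS, Measure.map_apply (hV'.prodMk hX) hS] at this
  convert this using 2
  · ext ω; simp [e2, X]
  · ext ω; simp [e1, X]

theorem measure_eq_of_forall_inter_fiber {κ : Ω → ℕ} (hκ : Measurable κ) {s t : Set Ω}
    (h : ∀ k, P (s ∩ κ ⁻¹' {k}) = P (t ∩ κ ⁻¹' {k})) : P s = P t := by
  have key : ∀ s, P s = ∑' k : (univ : Set ℕ), P (s ∩ κ ⁻¹' {(k : ℕ)}) := fun s ↦ by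
    have h1 := tsum_measure_preimage_singleton (μ := P.restrict s) (f := κ) countable_univ
      fun y _ ↦ hκ (measurableSet_singleton y)
    rw [preimage_univ, Measure.restrict_apply_univ] at h1
    rw [← h1]
    refine tsum_congr fun k ↦ ?_
    rw [Measure.restrict_apply (hκ (measurableSet_singleton _)), inter_comm]
  rw [key s, key t]
  exact tsum_congr fun k ↦ h k

/-- Pointwise convergence passes integrals of bounded continuous functions of finitely many
coordinates to the limit, and finite-dimensional laws determine the path law. -/
theorem map_eq_of_tendsto [IsProbabilityMeasure P] {X : ℕ → ℝ≥0 → Ω → ℂ} {Y : ℝ≥0 → Ω → ℂ}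
    {ν : Measure (ℝ≥0 → ℂ)} (hX : ∀ n t, Measurable (X n t)) (hY : ∀ t, Measurable (Y t))
    (hlim : ∀ t ω, Tendsto (fun n ↦ X n t ω) atTop (𝓝 (Y t ω)))
    (hν : ∀ n, P.map (fun ω t ↦ X n t ω) = ν) : P.map (fun ω t ↦ Y t ω) = ν := by
  have hXm : ∀ n, Measurable fun ω t ↦ X n t ω := fun n ↦ measurable_pi_lambda _ (hX n)
  have hYm : Measurable fun ω t ↦ Y t ω := measurable_pi_lambda _ hY
  rw [← hν 0, map_eq_iff_forall_finset_map_restrict_eq hYm.aemeasurable (hXm 0).aemeasurable]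
  intro I
  have hXI : ∀ n, Measurable fun ω ↦ I.restrict (X n · ω) := fun n ↦
    (Finset.measurable_restrict I).comp (hXm n)
  have hYI : Measurable fun ω ↦ I.restrict (Y · ω) := (Finset.measurable_restrict I).comp hYm
  have := Measure.isProbabilityMeasure_map (μ := P) hYI.aemeasurable
  have := Measure.isProbabilityMeasure_map (μ := P) (hXI 0).aemeasurable
  refine ext_of_forall_integral_eq_of_IsFiniteMeasure fun f ↦ ?_
  have hf := f.continuous.measurable
  have e : ∀ n, ∫ x, f x ∂(P.map fun ω ↦ I.restrict (X n · ω)) =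
      ∫ ω, f (I.restrict (X n · ω)) ∂P := fun n ↦
    integral_map (hXI n).aemeasurable hf.aestronglyMeasurable
  have e0 : ∀ n, P.map (fun ω ↦ I.restrict (X n · ω)) = P.map (fun ω ↦ I.restrict (X 0 · ω)) :=
    fun n ↦ (map_eq_iff_forall_finset_map_restrict_eq (hXm n).aemeasurable
      (hXm 0).aemeasurable).1 ((hν n).trans (hν 0).symm) I
  rw [integral_map hYI.aemeasurable hf.aestronglyMeasurable]
  have ht : Tendsto (fun n ↦ ∫ ω, f (I.restrict (X n · ω)) ∂P) atTop
      (𝓝 (∫ ω, f (I.restrict (Y · ω)) ∂P)) := by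
    refine tendsto_integral_of_dominated_convergence (fun _ ↦ ‖f‖)
      (fun n ↦ (hf.comp (hXI n)).aestronglyMeasurable) (integrable_const _)
      (fun n ↦ ae_of_all _ fun ω ↦ f.norm_coe_le_norm _) (ae_of_all _ fun ω ↦ ?_)
    exact (f.continuous.tendsto _).comp (tendsto_pi_nhds.2 fun i ↦ hlim i ω)
  refine tendsto_nhds_unique ht ?_
  simp_rw [← e, e0]
  exact tendsto_const_nhds

theorem measurable_gridIndex {T : Ω → ℝ≥0∞} {m : ℝ≥0 → MeasurableSpace Ω} (hm : Monotone m)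
    (hle : ∀ r, m r ≤ ‹MeasurableSpace Ω›) (hT : ∀ r : ℝ≥0, MeasurableSet[m r] {ω | T ω ≤ r})
    (n : ℕ) : Measurable fun ω ↦ gridIndex n (T ω) := by
  have h1 : ∀ k, MeasurableSet ((fun ω ↦ gridIndex n (T ω)) ⁻¹' {k + 1}) := fun k ↦
    hle _ _ (measurableSet_gridIndex hm hT n k)
  refine measurable_to_countable' fun k ↦ ?_
  cases k with
  | succ k => exact h1 k
  | zero =>
    have : (fun ω ↦ gridIndex n (T ω)) ⁻¹' {0} =
        (⋃ k, (fun ω ↦ gridIndex n (T ω)) ⁻¹' {k + 1})ᶜ := by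
      ext ω
      simp only [mem_preimage, mem_singleton_iff, mem_compl_iff, mem_iUnion, not_exists]
      exact ⟨fun h ↦ by simp [h], fun h ↦ by
        by_contra h0
        exact h _ (Nat.succ_pred_eq_of_ne_zero h0).symm⟩
    rw [this]
    exact (MeasurableSet.iUnion h1).compl

/-- Transforming the increments of a planar Brownian motion after a stopping time by a linear
isometry does not change its law. -/
theorem IsPlanarPreBrownian.map_reflectAt (h : IsPlanarPreBrownian W P)
    (hc : ∀ ω, Continuous fun t ↦ W t ω) (L : ℂ ≃ₗᵢ[ℝ] ℂ) {T : Ω → ℝ≥0∞}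
    (hT : ∀ r : ℝ≥0, MeasurableSet[past W r] {ω | T ω ≤ r}) :
    (∀ t, Measurable fun ω ↦ reflectAt L (fun t ↦ W t ω) (T ω) t) ∧
      P.map (fun ω ↦ reflectAt L (fun t ↦ W t ω) (T ω)) = P.map (fun ω t ↦ W t ω) := by
  have := h.isProbabilityMeasure
  -- Reflecting at the discretised times gives the right law for every `n`, by splitting over the
  -- countably many values. Path continuity lets `n → ∞`.
  let X : ℕ → ℝ≥0 → Ω → ℂ := fun n t ω ↦
    reflectAt L (fun t ↦ W t ω) (gridTime n (gridIndex n (T ω))) t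
  have hκ := measurable_gridIndex (fun _ _ ↦ past_mono W) (past_le h.measurable) hT
  have hr : ∀ (r : ℝ≥0∞) t, Measurable fun ω ↦ reflectAt L (fun t ↦ W t ω) r t := fun r t ↦ by
    have := h.measurable
    exact (this _).add (L.continuous.measurable.comp ((this _).sub (this _)))
  have hX : ∀ n t, Measurable (X n t) := fun n t ↦ by
    have h1 : Measurable fun x : Ω × ℕ ↦ reflectAt L (fun t ↦ W t x.1) (gridTime n x.2) t :=
      measurable_from_prod_countable_left fun k ↦ hr (gridTime n k) t
    exact h1.comp (measurable_id.prodMk (hκ n))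
  have hlim : ∀ t ω, Tendsto (fun n ↦ X n t ω) atTop
      (𝓝 (reflectAt L (fun t ↦ W t ω) (T ω) t)) := fun t ω ↦
    tendsto_reflectAt L (hc ω) (tendsto_gridTime (T ω)) t
  have hY : ∀ t, Measurable fun ω ↦ reflectAt L (fun t ↦ W t ω) (T ω) t := fun t ↦
    measurable_of_tendsto_metrizable (fun n ↦ hX n t) (tendsto_pi_nhds.2 (hlim t))
  refine ⟨hY, map_eq_of_tendsto hX hY hlim fun n ↦ ?_⟩
  refine Measure.ext fun B hB ↦ ?_
  rw [Measure.map_apply (measurable_pi_lambda _ (hX n)) hB,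
    Measure.map_apply (measurable_pi_lambda _ h.measurable) hB]
  refine measure_eq_of_forall_inter_fiber (hκ n) fun k ↦ ?_
  have e : (fun ω t ↦ X n t ω) ⁻¹' B ∩ (fun ω ↦ gridIndex n (T ω)) ⁻¹' {k} =
      (fun ω ↦ reflectAt L (fun t ↦ W t ω) (gridTime n k)) ⁻¹' B ∩
        (fun ω ↦ gridIndex n (T ω)) ⁻¹' {k} := by
    ext ω
    refine and_congr_left fun hk ↦ ?_
    rw [mem_preimage, mem_singleton_iff] at hk
    simp only [X, hk, mem_preimage]
  rw [e]
  cases k with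
  | zero =>
    congr 2
    ext ω
    have : reflectAt L (fun t ↦ W t ω) ∞ = fun t ↦ W t ω := funext fun t ↦
      reflectAt_of_le L _ le_top
    simp [gridTime, this]
  | succ k =>
    exact h.measure_reflectAt_inter L _
      (measurableSet_gridIndex (fun _ _ ↦ past_mono W) hT n k) hB

end Reflection

/-! ### Exit times as measurable functionals of the path. -/

section ExitTime

variable {Ω : Type*} {U : Set ℂ} {Z : ℝ≥0 → Ω → ℂ} {ω : Ω}

theorem exitTime_le_of_notMem {t : ℝ≥0} (h : Z t ω ∉ U) : exitTime U Z ω ≤ t := by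
  rw [exitTime_eq_iInf]
  exact iInf₂_le t h

theorem mem_of_lt_exitTime {t : ℝ≥0} (h : t < exitTime U Z ω) : Z t ω ∈ U := by
  by_contra h1
  exact h.not_ge (exitTime_le_of_notMem h1)

/-- Openness of `U` yields the strict inequality: a path in `U` up to and including time `t` remains
there a little longer. -/
theorem lt_exitTime_iff (hU : IsOpen U) (hZ : Continuous fun t ↦ Z t ω) {t : ℝ≥0} :
    t < exitTime U Z ω ↔ ∀ s ≤ t, Z s ω ∈ U := by
  refine ⟨fun h s hs ↦ mem_of_lt_exitTime ((ENNReal.coe_le_coe.2 hs).trans_lt h), fun h ↦ ?_⟩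
  have h1 : ∀ᶠ s in 𝓝 t, Z s ω ∈ U := hZ.continuousAt (hU.mem_nhds (h t le_rfl))
  obtain ⟨u, hu, hus⟩ := exists_Ico_subset_of_mem_nhds h1 ⟨t + 1, lt_add_one t⟩
  refine (ENNReal.coe_lt_coe.2 hu).trans_le ?_
  rw [exitTime_eq_iInf]
  refine le_iInf₂ fun s hs ↦ ENNReal.coe_le_coe.2 ?_
  by_contra! hsu
  rcases le_or_gt s t with hst | hst
  · exact hs (h s hst)
  · exact hs (hus ⟨hst.le, hsu⟩)

theorem forall_le_mem_iff (hU : IsOpen U) {w : ℝ≥0 → ℂ} (hw : Continuous w) (t : ℝ≥0) :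
    (∀ s ≤ t, w s ∈ U) ↔ ∃ m, ∀ q : ℚ, w (min (q : ℝ).toNNReal t) ∈ innerPart U m := by
  simp_rw [forall_rat_min_iff hw (isClosed_innerPart U _)]
  refine ⟨fun h ↦ ?_, fun ⟨m, h⟩ s hs ↦ innerPart_subset U m (h s hs)⟩
  obtain ⟨m, hm⟩ := exists_subset_innerPart hU
    ((isCompact_Icc (a := (0 : ℝ≥0)) (b := t)).image hw) (image_subset_iff.2 fun s hs ↦ h s hs.2)
  exact ⟨m, fun s hs ↦ hm (mem_image_of_mem w ⟨zero_le, hs⟩)⟩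

theorem measurableSet_exitTime_le {m : MeasurableSpace Ω} (hU : IsOpen U)
    (hZ : ∀ ω, Continuous fun t ↦ Z t ω) {r : ℝ≥0} (hm : ∀ s ≤ r, Measurable[m] (Z s)) :
    MeasurableSet[m] {ω | exitTime U Z ω ≤ r} := by
  have e : {ω | exitTime U Z ω ≤ r} =
      {ω | ∃ k, ∀ q : ℚ, Z (min (q : ℝ).toNNReal r) ω ∈ innerPart U k}ᶜ := by
    ext ω
    rw [mem_compl_iff, mem_ofPred_eq, mem_ofPred_eq, ← not_lt, lt_exitTime_iff hU (hZ ω),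
      forall_le_mem_iff hU (hZ ω)]
  rw [e]
  refine MeasurableSet.compl (measurableSet_setOfPred.2 <| .exists fun k ↦ .forall fun q ↦ ?_)
  exact measurableSet_setOfPred.1
    (hm _ (min_le_right _ _) (isClosed_innerPart U k).measurableSet)

/-- A measurable function of the path that agrees with the exit time on continuous paths. -/
noncomputable def exitFunctional (U : Set ℂ) (w : ℝ≥0 → ℂ) : ℝ≥0∞ :=
  ⨆ r : ℚ, {w : ℝ≥0 → ℂ | ∃ m, ∀ q : ℚ,
    w (min (q : ℝ).toNNReal (r : ℝ).toNNReal) ∈ innerPart U m}.indicator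
      (fun _ ↦ ((r : ℝ).toNNReal : ℝ≥0∞)) w

theorem measurable_exitFunctional (U : Set ℂ) : Measurable (exitFunctional U) := by
  refine Measurable.iSup fun r ↦ measurable_const.indicator ?_
  refine measurableSet_setOfPred.2 <| .exists fun k ↦ .forall fun q ↦ ?_
  exact measurableSet_setOfPred.1 (measurable_pi_apply _ (isClosed_innerPart U k).measurableSet)

theorem exitFunctional_eq (hU : IsOpen U) (hZ : Continuous fun t ↦ Z t ω) :
    exitFunctional U (fun t ↦ Z t ω) = exitTime U Z ω := by
  have key : ∀ r : ℚ, (fun t ↦ Z t ω) ∈ {w : ℝ≥0 → ℂ | ∃ m, ∀ q : ℚ,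
      w (min (q : ℝ).toNNReal (r : ℝ).toNNReal) ∈ innerPart U m} ↔
      ((r : ℝ).toNNReal : ℝ≥0∞) < exitTime U Z ω := fun r ↦ by
    rw [lt_exitTime_iff hU hZ, forall_le_mem_iff hU hZ, mem_ofPred_eq]
  refine le_antisymm (iSup_le fun r ↦ ?_) (le_of_forall_lt fun x hx ↦ ?_)
  · by_cases h : ((r : ℝ).toNNReal : ℝ≥0∞) < exitTime U Z ω
    · rw [indicator_of_mem ((key r).2 h)]
      exact h.le
    · rw [indicator_of_notMem fun h' ↦ h ((key r).1 h')]
      exact zero_le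
  · obtain ⟨r, -, hr1, hr2⟩ := ENNReal.lt_iff_exists_rat_btwn.1 hx
    refine hr1.trans_le (le_trans ?_ (le_iSup _ r))
    rw [indicator_of_mem ((key r).2 hr2)]

variable [MeasurableSpace Ω] {P : Measure Ω}

theorem aemeasurable_exitTime (hU : IsOpen U) (hm : ∀ t, Measurable (Z t))
    (hc : ∀ᵐ ω ∂P, Continuous fun t ↦ Z t ω) : AEMeasurable (exitTime U Z) P := by
  refine ((measurable_exitFunctional U).comp (measurable_pi_lambda _ hm)).aemeasurable.congr ?_
  filter_upwards [hc] with ω hω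
  exact exitFunctional_eq hU hω

/-- Moments of the exit time depend only on the path law. The measurable `exitFunctional` replaces
an infimum over uncountably many times, and the two agree on continuous paths. -/
theorem lintegral_exitTime_eq (hU : IsOpen U) (hm : ∀ t, Measurable (Z t))
    (hc : ∀ᵐ ω ∂P, Continuous fun t ↦ Z t ω) (p : ℝ) :
    ∫⁻ ω, exitTime U Z ω ^ p ∂P =
      ∫⁻ w, exitFunctional U w ^ p ∂(P.map fun ω t ↦ Z t ω) := by
  rw [lintegral_map ((measurable_exitFunctional U).pow_const p) (measurable_pi_lambda _ hm)]
  refine lintegral_congr_ae ?_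
  filter_upwards [hc] with ω hω
  rw [exitFunctional_eq hU hω]

end ExitTime

/-! ### Reflection over a line and the mirror coupling. -/

namespace PlaneLine

/-- The linear part of the symmetry over a line. -/
noncomputable def linearRefl (Δ : PlaneLine) : ℂ ≃ₗᵢ[ℝ] ℂ :=
  (EuclideanGeometry.reflection Δ.toAffineSubspace).linearIsometryEquiv

theorem refl_add (Δ : PlaneLine) (z w : ℂ) : Δ.refl (z + w) = Δ.refl z + Δ.linearRefl w := by
  have := (EuclideanGeometry.reflection Δ.toAffineSubspace).map_vadd z w
  rw [vadd_eq_add, vadd_eq_add] at this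
  rw [add_comm z, add_comm (Δ.refl z)]
  exact this

theorem refl_refl (Δ : PlaneLine) (z : ℂ) : Δ.refl (Δ.refl z) = z :=
  EuclideanGeometry.reflection_reflection _ _

theorem linearRefl_linearRefl (Δ : PlaneLine) (w : ℂ) : Δ.linearRefl (Δ.linearRefl w) = w := by
  have h := Δ.refl_refl (0 + w)
  rw [Δ.refl_add, Δ.refl_add, Δ.refl_refl] at h
  simpa using h

theorem continuous_refl (Δ : PlaneLine) : Continuous Δ.refl :=
  (EuclideanGeometry.reflection Δ.toAffineSubspace).continuous

theorem continuous_form (Δ : PlaneLine) : Continuous Δ.form := by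
  unfold form
  fun_prop

theorem form_refl (Δ : PlaneLine) (z : ℂ) : Δ.form (Δ.refl z) = -Δ.form z := by
  have h := Δ.normSq_pos
  rw [refl_eq]
  set k := 2 * Δ.form z / (Δ.a ^ 2 + Δ.b ^ 2) with hk
  have hk' : k * (Δ.a ^ 2 + Δ.b ^ 2) = 2 * Δ.form z := by rw [hk]; field_simp
  simp only [form, Complex.sub_re, Complex.sub_im, Complex.mul_re, Complex.mul_im,
    Complex.ofReal_re, Complex.ofReal_im] at hk' ⊢
  linear_combination -hk'

theorem refl_of_form_eq_zero (Δ : PlaneLine) {z : ℂ} (h : Δ.form z = 0) : Δ.refl z = z := by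
  simp [refl_eq, h]

/-- Planar Brownian motion `Z` started at `a` and its mirror image `Z'`, which moves together with
`Z` from the time on when `Z` hits the line. -/
theorem exists_coupling (Δ : PlaneLine) {a : ℂ} (ha : 0 < Δ.form a) :
    ∃ (Ω : Type) (_ : MeasurableSpace Ω) (P : Measure Ω) (Z Z' : ℝ≥0 → Ω → ℂ),
      IsProbabilityMeasure P ∧ IsPlanarBrownian Z a P ∧ IsPlanarBrownian Z' (Δ.refl a) P ∧
      (∀ ω, Continuous fun t ↦ Z t ω) ∧ (∀ ω, Continuous fun t ↦ Z' t ω) ∧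
      ∀ ω, ∃ T : ℝ≥0∞, (∀ t : ℝ≥0, t < T → 0 < Δ.form (Z t ω) ∧ Z' t ω = Δ.refl (Z t ω)) ∧
        (∀ t : ℝ≥0, T ≤ t → Z' t ω = Z t ω) ∧ ∀ t : ℝ≥0, T = t → Δ.form (Z t ω) = 0 := by
  obtain ⟨Ω, _, P, W, h, hc, h0⟩ := exists_isPlanarPreBrownian
  have hP := h.isProbabilityMeasure
  set L := Δ.linearRefl with hL
  have hY := h.isometry L
  have hYc : ∀ ω, Continuous fun t ↦ L (W t ω) := fun ω ↦ L.continuous.comp (hc ω)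
  let H : Set ℂ := {z | 0 < Δ.form z}
  have hH : IsOpen H := isOpen_lt continuous_const Δ.continuous_form
  let Z : ℝ≥0 → Ω → ℂ := fun t ω ↦ a + W t ω
  have hZc : ∀ ω, Continuous fun t ↦ Z t ω := fun ω ↦ continuous_const.add (hc ω)
  let T : Ω → ℝ≥0∞ := exitTime H Z
  -- `map_reflectAt` will be applied to `L ∘ W`, so `T` must be a stopping time for that process. It
  -- is, because `L` is an involution and `W` is recovered from `L ∘ W`.
  have hT : ∀ r : ℝ≥0, MeasurableSet[past (fun t ω ↦ L (W t ω)) r] {ω | T ω ≤ r} := fun r ↦ by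
    refine measurableSet_exitTime_le hH hZc fun s hs ↦ ?_
    have h1 := measurable_past (fun t ω ↦ L (W t ω)) hs
    have h2 : Measurable fun z ↦ a + L z := (continuous_const.add L.continuous).measurable
    convert h2.comp h1 using 1
    funext ω
    simp [Z, hL, linearRefl_linearRefl]
  obtain ⟨hm, he⟩ := hY.map_reflectAt hYc L hT
  -- Up to `T` this is `L ∘ W`; afterwards `L` is applied twice, so the increments are those of `W`.
  let X : ℝ≥0 → Ω → ℂ := fun t ω ↦ reflectAt L (fun t ↦ L (W t ω)) (T ω) t
  have hXc : ∀ ω, Continuous fun t ↦ X t ω := fun ω ↦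
    continuous_reflectAt_right L (hYc ω) (T ω)
  have hB := hY.isPlanarBrownian (ae_of_all _ hYc) (Δ.refl a)
  refine ⟨Ω, _, P, Z, fun t ω ↦ Δ.refl a + X t ω, hP, h.isPlanarBrownian (ae_of_all _ hc) a,
    hB.of_map_eq (fun t ↦ (hm t).const_add _)
      (ae_of_all _ fun ω ↦ continuous_const.add (hXc ω)) ?_, hZc,
    fun ω ↦ continuous_const.add (hXc ω), fun ω ↦ ⟨T ω, fun t ht ↦ ?_, ?_⟩⟩
  · have hadd : Measurable fun (w : ℝ≥0 → ℂ) t ↦ Δ.refl a + w t := by fun_prop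
    have := congrArg (Measure.map fun (w : ℝ≥0 → ℂ) t ↦ Δ.refl a + w t) he
    rwa [Measure.map_map hadd (measurable_pi_lambda _ hm),
      Measure.map_map hadd (measurable_pi_lambda _ hY.measurable)] at this
  · refine ⟨mem_of_lt_exitTime ht, ?_⟩
    simp only [X, Z]
    rw [reflectAt_of_le L _ ht.le, Δ.refl_add]
  -- At the exit time from the open half-plane the form is not positive, since otherwise the exit
  -- would be later, and it is nonnegative as a limit from earlier times. Earlier times exist
  -- because the form is positive at `a`.
  · have hz : ∀ t : ℝ≥0, T ω = t → Δ.form (Z t ω) = 0 := fun t ht ↦ by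
      have h1 : ∀ s < t, 0 < Δ.form (Z s ω) := fun s hs ↦ by
        refine mem_of_lt_exitTime (U := H) (Z := Z) (ω := ω) ?_
        change _ < T ω
        rw [ht]
        exact ENNReal.coe_lt_coe.2 hs
      have h2 : ¬ 0 < Δ.form (Z t ω) := fun h2 ↦ by
        have h3 : (t : ℝ≥0∞) < exitTime H Z ω := (lt_exitTime_iff hH (hZc ω)).2 fun s hs ↦ by
          rcases hs.lt_or_eq with hs | rfl
          · exact h1 s hs
          · exact h2
        exact h3.ne' ht
      have ht0 : t ≠ 0 := by
        rintro rfl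
        simp [Z, h0, ha] at h2
      refine le_antisymm (not_lt.1 h2) ?_
      have hcl : IsClosed {s | 0 ≤ Δ.form (Z s ω)} :=
        isClosed_le continuous_const (Δ.continuous_form.comp (hZc ω))
      have h4 : closure (Iio t) ⊆ {s | 0 ≤ Δ.form (Z s ω)} :=
        closure_minimal (fun s hs ↦ (h1 s hs).le) hcl
      rw [closure_Iio' ⟨0, pos_iff_ne_zero.2 ht0⟩] at h4
      exact h4 (mem_Iic.2 le_rfl)
    refine ⟨fun t ht ↦ ?_, hz⟩
    obtain ⟨r, hr⟩ : ∃ r : ℝ≥0, T ω = r := ⟨(T ω).toNNReal,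
      (ENNReal.coe_toNNReal (ht.trans_lt ENNReal.coe_lt_top).ne).symm⟩
    rw [hr, ENNReal.coe_le_coe] at ht
    -- The point reached at time `T` is fixed by the reflection, so there the mirror path meets the
    -- original one; equal increments keep them together.
    have h1 := Δ.refl_of_form_eq_zero (hz r hr)
    simp only [Z, Δ.refl_add] at h1
    simp only [X, Z, hr]
    rw [reflectAt_of_ge L _ ht, map_sub, hL, linearRefl_linearRefl, linearRefl_linearRefl,
      ← add_assoc, h1]
    ring

end PlaneLine

/-! ### Connectedness of the opposite side, and comparison of the exit times. -/

namespace PlaneLine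

theorem convex_form_neg (Δ : PlaneLine) : Convex ℝ {z | Δ.form z < 0} := by
  intro z hz w hw s t hs ht hst
  have e : Δ.form (s • z + t • w) = s * Δ.form z + t * Δ.form w := by
    simp only [form, Complex.real_smul, Complex.add_re, Complex.add_im, Complex.mul_re,
      Complex.mul_im, Complex.ofReal_re, Complex.ofReal_im]
    linear_combination -Δ.c * hst
  rw [mem_ofPred_eq] at hz hw ⊢
  rw [e]
  rcases hs.eq_or_lt with rfl | hs
  · obtain rfl : t = 1 := by linarith
    simpa using hw
  · nlinarith [mul_nonneg ht (neg_nonneg.2 hw.le), mul_pos hs (neg_pos.2 hz)]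

theorem mem_closure_form_neg (Δ : PlaneLine) {z : ℂ} (hz : Δ.form z ≤ 0) :
    z ∈ closure {z | Δ.form z < 0} := by
  let u : ℕ → ℂ := fun n ↦ z - ((1 / ((n : ℝ) + 1) : ℝ) : ℂ) * ⟨Δ.a, Δ.b⟩
  have hu : Tendsto u atTop (𝓝 (z - ((0 : ℝ) : ℂ) * ⟨Δ.a, Δ.b⟩)) :=
    tendsto_const_nhds.sub (((Complex.continuous_ofReal.tendsto 0).comp
      (tendsto_one_div_add_atTop_nhds_zero_nat (𝕜 := ℝ))).mul_const _)
  rw [Complex.ofReal_zero, zero_mul, sub_zero] at hu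
  refine mem_closure_of_tendsto hu (Eventually.of_forall fun n ↦ ?_)
  have h1 : 0 < (1 / ((n : ℝ) + 1)) * (Δ.a ^ 2 + Δ.b ^ 2) := by
    have := Δ.normSq_pos
    positivity
  rw [mem_ofPred_eq]
  simp only [u, form, Complex.sub_re, Complex.sub_im, Complex.mul_re, Complex.mul_im,
    Complex.ofReal_re, Complex.ofReal_im] at hz h1 ⊢
  linarith

/-- Folding `U` along the line maps it onto its closed half, which is therefore connected. Removing
the boundary line keeps it connected, because near each boundary point the open side is a half-disc,
which is convex. -/
theorem isPreconnected_negSide (Δ : PlaneLine) {U : Set ℂ} (hU : IsOpen U) (hc : IsPreconnected U)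
    (h : Δ.refl '' Δ.posSide U ⊆ U) : IsPreconnected (Δ.negSide U) := by
  let f : ℂ → ℂ := fun z ↦ if Δ.form z ≤ 0 then z else Δ.refl z
  have hf : Continuous f := continuous_id.if_le Δ.continuous_refl Δ.continuous_form
    continuous_const fun z hz ↦ (Δ.refl_of_form_eq_zero hz).symm
  have hfU : f '' U = U ∩ {z | Δ.form z ≤ 0} := by
    refine Subset.antisymm ?_ fun z hz ↦ ⟨z, hz.1, if_pos hz.2⟩
    rintro _ ⟨z, hz, rfl⟩
    by_cases hz0 : Δ.form z ≤ 0
    · simp only [f, if_pos hz0]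
      exact ⟨hz, hz0⟩
    · simp only [f, if_neg hz0]
      refine ⟨h ⟨z, ⟨hz, not_le.1 hz0⟩, rfl⟩, ?_⟩
      rw [mem_ofPred_eq, form_refl]
      linarith
  have hM : IsPreconnected (U ∩ {z | Δ.form z ≤ 0}) := hfU ▸ hc.image f hf.continuousOn
  intro u v hu hv huv ⟨x, hx⟩ ⟨y, hy⟩
  -- The closures of the two parts cover the closed half, so by connectedness they share a point
  -- `z`; both parts then meet the convex piece of the open side around `z`.
  obtain ⟨z, hzM, hzu, hzv⟩ := isPreconnected_closed_iff.1 hM (closure (Δ.negSide U ∩ u))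
    (closure (Δ.negSide U ∩ v)) isClosed_closure isClosed_closure (fun z hz ↦ by
      rw [← closure_union, ← inter_union_distrib_left, inter_eq_self_of_subset_left huv]
      exact hU.inter_closure ⟨hz.1, Δ.mem_closure_form_neg hz.2⟩)
    ⟨x, ⟨hx.1.1, le_of_lt (a := Δ.form x) hx.1.2⟩, subset_closure hx⟩
    ⟨y, ⟨hy.1.1, le_of_lt (a := Δ.form y) hy.1.2⟩, subset_closure hy⟩
  obtain ⟨r, hr, hrU⟩ := Metric.isOpen_iff.1 hU z hzM.1
  have hQN : Metric.ball z r ∩ {z | Δ.form z < 0} ⊆ Δ.negSide U := inter_subset_inter_left _ hrU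
  have hQ : ∀ {u : Set ℂ}, z ∈ closure (Δ.negSide U ∩ u) →
      (Metric.ball z r ∩ {z | Δ.form z < 0} ∩ u).Nonempty := fun hz ↦ by
    obtain ⟨w, hw1, hw2⟩ := mem_closure_iff_nhds.1 hz _ (Metric.ball_mem_nhds z hr)
    exact ⟨w, ⟨hw1, hw2.1.2⟩, hw2.2⟩
  obtain ⟨w, hw1, hw2⟩ := ((convex_ball z r).inter Δ.convex_form_neg).isPreconnected u v hu hv
    (hQN.trans huv) (hQ hzu) (hQ hzv)
  exact ⟨w, hQN hw1, hw2⟩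

/-- Planar Brownian motions started at a point of the symmetric side and at its mirror image, with
ordered exit times. -/
theorem exists_coupling_exitTime (Δ : PlaneLine) {U : Set ℂ} (hU : IsOpen U)
    (hc : IsPreconnected U) (h : Δ.refl '' Δ.posSide U ⊆ U) {a : ℂ} (ha : a ∈ Δ.posSide U) :
    ∃ (Ω : Type) (_ : MeasurableSpace Ω) (P : Measure Ω) (Z Z' : ℝ≥0 → Ω → ℂ),
      IsProbabilityMeasure P ∧ IsPlanarBrownian Z a P ∧ IsPlanarBrownian Z' (Δ.refl a) P ∧
      (∀ ω, exitTime U Z ω ≤ exitTime U Z' ω) ∧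
      (IsNonpolar (Δ.negSide U \ Δ.refl '' Δ.posSide U) →
        0 < P {ω | exitTime U Z ω < exitTime U Z' ω}) := by
  obtain ⟨Ω, _, P, Z, Z', hP, hZ, hZ', hZc, hZc', hT⟩ := Δ.exists_coupling ha.2
  refine ⟨Ω, _, P, Z, Z', hP, hZ, hZ', fun ω ↦ ?_, ?_⟩
  · obtain ⟨T, hlt, hge, -⟩ := hT ω
    rw [exitTime_eq_iInf U Z']
    -- At any time when `Z'` is outside `U`, so is `Z`.
    refine le_iInf₂ fun t ht ↦ exitTime_le_of_notMem fun htU ↦ ht ?_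
    rcases lt_or_ge (t : ℝ≥0∞) T with htT | htT
    · rw [(hlt t htT).2]
      exact h ⟨_, ⟨htU, (hlt t htT).1⟩, rfl⟩
    · rwa [hge t htT]
  · rintro ⟨C, μ, hC, hCK, hμ, hμC, hμE⟩
    set N := Δ.negSide U with hN
    have hNo : IsOpen N := hU.inter (isOpen_lt Δ.continuous_form continuous_const)
    have haN : Δ.refl a ∈ N := by
      refine ⟨h ⟨a, ha, rfl⟩, ?_⟩
      rw [mem_ofPred_eq, form_refl, neg_lt_zero]
      exact ha.2
    obtain ⟨Ω₀, _, P₀, W, hW, hWc, hW0⟩ := exists_isPlanarPreBrownian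
    -- Hitting is proved for a separately constructed Brownian motion and transferred to `Z'`
    -- through equality of laws on the measurable set `hitEvent C N`.
    have hpos := hW.hitProb_ne_zero hWc hW0 hC hNo (Δ.isPreconnected_negSide hU hc h)
      (hCK.trans sdiff_subset) hμC hμE haN
    have hlaw := (hW.isPlanarBrownian (ae_of_all _ hWc) (Δ.refl a)).map_eq hZ'
    have he : hitProb W P₀ C N (Δ.refl a) = P {ω | (fun t ↦ Z' t ω) ∈ hitEvent C N} := by
      have := congrArg (fun ν ↦ ν (hitEvent C N)) hlaw
      rwa [Measure.map_apply
          (measurable_pi_lambda _ fun t ↦ (hW.measurable t).const_add _) (measurableSet_hitEvent C N),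
        Measure.map_apply (measurable_pi_lambda _ hZ'.measurable) (measurableSet_hitEvent C N)]
        at this
    rw [he] at hpos
    refine (pos_iff_ne_zero.2 hpos).trans_le (measure_mono fun ω hω ↦ ?_)
    obtain ⟨t, htC, htN⟩ := (mem_hitEvent_iff hC.isClosed hNo (hZc' ω)).1 hω
    obtain ⟨T, hlt, hge, hz⟩ := hT ω
    -- At time `T` the path `Z'` is on the line, hence outside `N`; so a hit of `C` inside `N`
    -- occurs before `T`.
    have htT : (t : ℝ≥0∞) < T := by
      by_contra! hle
      obtain ⟨r, rfl⟩ : ∃ r : ℝ≥0, T = r := ⟨T.toNNReal,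
        (ENNReal.coe_toNNReal (hle.trans_lt ENNReal.coe_lt_top).ne).symm⟩
      have h1 := (htN r (ENNReal.coe_le_coe.1 hle)).2
      rw [mem_ofPred_eq, hge r le_rfl, hz r rfl] at h1
      exact lt_irrefl _ h1
    -- Were `Z` in `U` at this time, it would be on the positive side and `Z'` in the reflected
    -- image of that side, which `C` avoids.
    have h2 : exitTime U Z ω ≤ t := exitTime_le_of_notMem fun htU ↦ (hCK htC).2 <| by
      rw [(hlt t htT).2]
      exact ⟨_, ⟨htU, (hlt t htT).1⟩, rfl⟩
    exact h2.trans_lt ((lt_exitTime_iff hU (hZc' ω)).2 fun s hs ↦ (htN s hs).1)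

theorem diff_posSide_union (Δ : PlaneLine) (U : Set ℂ) :
    U \ (Δ.posSide U ∪ Δ.toAffineSubspace) = Δ.negSide U := by
  ext z
  simp only [posSide, negSide, Set.mem_sdiff, mem_union, mem_inter_iff, mem_ofPred_eq,
    SetLike.mem_coe, mem_toAffineSubspace, not_or, not_and, not_lt]
  refine and_congr_right fun hz ↦ ⟨fun h ↦ lt_of_le_of_ne (h.1 hz) h.2, fun h ↦ ⟨fun _ ↦ h.le, h.ne⟩⟩

/-- The same line, with the opposite equation. -/
def opposite (Δ : PlaneLine) : PlaneLine := ⟨-Δ.a, -Δ.b, -Δ.c, by simpa using Δ.ne_zero⟩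

theorem form_opposite (Δ : PlaneLine) (z : ℂ) : Δ.opposite.form z = -Δ.form z := by
  simp only [form, opposite]
  ring

theorem refl_opposite (Δ : PlaneLine) : Δ.opposite.refl = Δ.refl := by
  funext z
  rw [refl_eq, refl_eq, form_opposite]
  have e : (⟨-Δ.a, -Δ.b⟩ : ℂ) = -⟨Δ.a, Δ.b⟩ := Complex.ext (by simp) (by simp)
  simp only [opposite, neg_sq, e]
  push_cast
  ring

theorem posSide_opposite (Δ : PlaneLine) (U : Set ℂ) : Δ.opposite.posSide U = Δ.negSide U := by
  simp [posSide, negSide, form_opposite]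

theorem toAffineSubspace_opposite (Δ : PlaneLine) :
    Δ.opposite.toAffineSubspace = Δ.toAffineSubspace := by
  ext z
  simp [mem_toAffineSubspace, form_opposite]

theorem exists_coupling_of_isSymmetricSide (Δ : PlaneLine) {U S : Set ℂ} (hU : IsOpen U)
    (hc : IsPreconnected U) (hS : Δ.IsSymmetricSide U S) {a : ℂ} (ha : a ∈ S) :
    ∃ (Ω : Type) (_ : MeasurableSpace Ω) (P : Measure Ω) (Z Z' : ℝ≥0 → Ω → ℂ),
      IsProbabilityMeasure P ∧ IsPlanarBrownian Z a P ∧ IsPlanarBrownian Z' (Δ.refl a) P ∧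
      (∀ ω, exitTime U Z ω ≤ exitTime U Z' ω) ∧
      (IsNonpolar ((U \ (S ∪ Δ.toAffineSubspace)) \ Δ.refl '' S) →
        0 < P {ω | exitTime U Z ω < exitTime U Z' ω}) := by
  obtain ⟨rfl | rfl, h⟩ := hS
  · rw [diff_posSide_union]
    exact Δ.exists_coupling_exitTime hU hc h ha
  -- The negative side becomes the positive side for the opposite equation, with the same line and
  -- the same reflection.
  · rw [← posSide_opposite, ← refl_opposite, ← toAffineSubspace_opposite] at *
    rw [diff_posSide_union]
    exact Δ.opposite.exists_coupling_exitTime hU hc h ha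

end PlaneLine

/-! ### The theorem: coupling, and comparison of moments. -/

theorem mainTheorem1 (U : Set ℂ) (hUo : IsOpen U) (hUc : IsConnected U)
    (Δ : PlaneLine) (hΔ : Δ.IsPartialSymmetryAxis U) (S : Set ℂ) (hS : Δ.IsSymmetricSide U S)
    (a : ℂ) (ha : a ∈ S) :
    (∃ (Ω : Type) (_ : MeasurableSpace Ω) (P : Measure Ω) (Z Z' : ℝ≥0 → Ω → ℂ),
      IsProbabilityMeasure P ∧
      IsPlanarBrownian Z a P ∧ IsPlanarBrownian Z' (Δ.refl a) P ∧
      (∀ᵐ ω ∂P, exitTime U Z ω ≤ exitTime U Z' ω) ∧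
      (IsNonpolar ((U \ (S ∪ Δ.toAffineSubspace)) \ Δ.refl '' S) →
        0 < P {ω | exitTime U Z ω < exitTime U Z' ω})) ∧
    (∀ (p : ℝ), 0 < p →
      ∀ (Ω₁ : Type*) [MeasurableSpace Ω₁] (P₁ : Measure Ω₁) [IsProbabilityMeasure P₁]
        (Z₁ : ℝ≥0 → Ω₁ → ℂ) (Ω₂ : Type*) [MeasurableSpace Ω₂] (P₂ : Measure Ω₂)
        [IsProbabilityMeasure P₂] (Z₂ : ℝ≥0 → Ω₂ → ℂ),
        IsPlanarBrownian Z₁ a P₁ → IsPlanarBrownian Z₂ (Δ.refl a) P₂ →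
        ∫⁻ ω, exitTime U Z₁ ω ^ p ∂P₁ ≤ ∫⁻ ω, exitTime U Z₂ ω ^ p ∂P₂ ∧
        (IsNonpolar ((U \ (S ∪ Δ.toAffineSubspace)) \ Δ.refl '' S) →
          ∫⁻ ω, exitTime U Z₁ ω ^ p ∂P₁ < ∞ →
          ∫⁻ ω, exitTime U Z₁ ω ^ p ∂P₁ < ∫⁻ ω, exitTime U Z₂ ω ^ p ∂P₂)) := by
  obtain ⟨Ω, _, P, Z, Z', hP, hZ, hZ', hle, hlt⟩ :=
    Δ.exists_coupling_of_isSymmetricSide hUo hUc.isPreconnected hS ha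
  refine ⟨⟨Ω, _, P, Z, Z', hP, hZ, hZ', ae_of_all _ hle, hlt⟩,
    fun p hp Ω₁ _ P₁ _ Z₁ Ω₂ _ P₂ _ Z₂ h₁ h₂ ↦ ?_⟩
  have e₁ : ∫⁻ ω, exitTime U Z₁ ω ^ p ∂P₁ = ∫⁻ ω, exitTime U Z ω ^ p ∂P := by
    rw [lintegral_exitTime_eq hUo h₁.measurable h₁.ae_continuous,
      lintegral_exitTime_eq hUo hZ.measurable hZ.ae_continuous, h₁.map_eq hZ]
  have e₂ : ∫⁻ ω, exitTime U Z₂ ω ^ p ∂P₂ = ∫⁻ ω, exitTime U Z' ω ^ p ∂P := by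
    rw [lintegral_exitTime_eq hUo h₂.measurable h₂.ae_continuous,
      lintegral_exitTime_eq hUo hZ'.measurable hZ'.ae_continuous, h₂.map_eq hZ']
  rw [e₁, e₂]
  refine ⟨lintegral_mono fun ω ↦ ENNReal.rpow_le_rpow (hle ω) hp.le, fun hK hfin ↦ ?_⟩
  -- Strict inequality on an event of positive probability makes the integrals differ, provided the
  -- smaller one is finite.
  refine lintegral_strict_mono_of_ae_le_of_ae_lt_on
    ((aemeasurable_exitTime hUo hZ'.measurable hZ'.ae_continuous).pow_const p) hfin.ne
    (ae_of_all _ fun ω ↦ ENNReal.rpow_le_rpow (hle ω) hp.le) (hlt hK).ne'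
    (ae_of_all _ fun ω hω ↦ ENNReal.rpow_lt_rpow hω hp)
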